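/- Setting. Let $\mathsf E$ be a Polish space with its Borel $\sigma$-algebra, $\mu$ a $\sigma$-finite measure on $\mathsf E$, $\pi(dx)=\pi(x)\mu(dx)$ a probability measure, $q(x,dy)=q(x,y)\mu(dy)$ a Markov kernel with jointly measurable density, and $w:\mathsf E\times\mathsf E\to(0,\infty)$ a measurable weight function with $(qw)(x):=\int q(x,dy)\,w(x,y)<\infty$ for every $x$. Put $\varpi(x,y):=w(x,y)/(qw)(x)$, $q^w(x,dy):=q(x,dy)\,\varpi(x,y)$ and $M_\varpi(r):=\int\pi(dx)\int q(x,dy)\,\varpi(x,y)^r$. For $n\ge1$ and $Y=(Y_1,\dots,Y_n)$ let $(\widehat{qw})_n(x,Y):=\frac1n\sum_{i=1}^n w(x,Y_i)$, and let $(\widetilde{qw})_n(x,y):=\mathbb E\big[(\widehat{qw})_n(x,Y)^{-1}\mid Y_1=y\big]^{-1}$, where here and below, given $Y_1=y$ and $Z_1=x$, the variables $Y_2,\dots,Y_n\sim q(x,\cdot)$ and $Z_2,\dots,Z_n\sim q(y,\cdot)$ are independent. Kernels. The ideal kernel $P_\infty$ is the Metropolis–Hastings kernel with proposal $q^w$ and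 acceptance probability $\min\big\{1,\frac{\pi(y)q(y,x)w(y,x)(qw)(x)}{\pi(x)q(x,y)w(x,y)(qw)(y)}\big\}$. The semi-ideal kernel $\widetilde P_n$ is the Metropolis–Hastings kernel with proposal $q(x,dy)w(x,y)/(\widetilde{qw})_n(x,y)$ and acceptance probability $\min\big\{1,\frac{\pi(y)q(y,x)w(y,x)(\widetilde{qw})_n(x,y)}{\pi(x)q(x,y)w(x,y)(\widetilde{qw})_n(y,x)}\big\}$. The Multiple-try Metropolis kernel $P_n$ acts from $x$ as follows: draw $Y_1,\dots,Y_n$ i.i.d. from $q(x,\cdot)$; select an index $I$ with $\mathbb P(I=i)=w(x,Y_i)/\sum_j w(x,Y_j)$ and set $y=Y_I$; draw $Z_j\sim q(y,\cdot)$ independently for $j\ne I$ and set $Z_I=x$; move to $y$ with probability $\min\big\{1,\frac{\pi(y)q(y,x)w(y,x)(\widehat{qw})_n(x,Y)}{\pi(x)q(x,y)w(x,y)(\widehat{qw})_n(y,Z)}\big\}$, otherwise remain at $x$. For $f\in L^2(\pi)$ let $\mathcal E(P,f):=\langle(\mathrm{Id}-P)f,f\rangle_{L^2(\pi)}$ and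 $\|f\|_{\mathrm{osc}}:=\operatorname{ess\,sup}_\pi f-\operatorname{ess\,inf}_\pi f\in[0,\infty]$ (with $0\cdot\infty=0$). Let $$\beta_{1,n}(s):=(\pi\otimes q^w)\Big(\mathbb E\Big[\tfrac{n}{\sum_{i=1}^n\varpi(X,Y_i)}\,\Big|\,Y_1=Y\Big]<\tfrac1s\Big),\qquad \beta_{2,n}(s):=(\pi\otimes\widetilde P_n)\big(\zeta_n(X,Y)<\tfrac1s\big),$$ $$\zeta_n(x,y):=\mathbb E\Big[\min\Big(\tfrac{(\widetilde{qw})_n(x,y)}{(\widehat{qw})_n(x,Y)},\tfrac{(\widetilde{qw})_n(y,x)}{(\widehat{qw})_n(y,Z)}\Big)\,\Big|\,Y_1=y,Z_1=x\Big],$$ $$\beta^{\circ}_n(s):=\inf\{\beta_{1,n}(s_1)+s_1\beta_{2,n}(s_2): s_1,s_2>0,\ s_1s_2=s\}.$$ Theorem. For every $n\ge1$, $f\in L^2(\pi)$ and $s>0$, $$\mathcal E(P_\infty,f)\le s\,\mathcal E(P_n,f)+\beta^{\circ}_n(s)\,\|f\|_{\mathrm{osc}}^2 .$$ Moreover there are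 functions $\beta_n:(0,\infty)\to[0,\infty)$ with $\beta_n(s)=\beta^\circ_n(s)$ for all $s\neq1$ and $\beta_n(1)\ge\beta_n^\circ(1)$ (so the same inequality holds with $\beta_n$) such that: (i) $\beta_n(s)\to\mathbf 1\{s\le1\}$ as $n\to\infty$, for every $s>0$; (ii) for every $p\in[1,\infty)$ such that $M_\varpi(2p)$ and $M_\varpi(-2p)$ are finite, there are constants $K_1,K_2,K_3\ge0$, not depending on $n$ and $s$, such that for all $n\ge1$ and $s>0$ $$\beta_n(s)\le s^{-\frac{p^2}{1+2p}}\Big\{c_2\Big(\frac{c_1p}{c_2(1+p)}\Big)^{1+p}+c_1\Big(\frac{c_1p}{c_2(1+p)}\Big)^{-p}\Big\},$$ where $c_1=M_\varpi(p)+K_1n^{-1}$ and $c_2=2^{p+1}\{K_2n^{-1}+K_3n^{-2}+M_\varpi(2p)+M_\varpi(-2p)\}$. -/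

import Mathlib

open MeasureTheory ProbabilityTheory Filter Topology
open scoped ENNReal NNReal

noncomputable section

namespace MultipleTry

variable {E : Type*} [MeasurableSpace E]

/-! ### Functionals on `L²(π)` -/

/-- The Dirichlet form `𝓔(P, f) = ⟨(Id - P) f, f⟩` in `L²(π)`. -/
def dirichletForm (π : Measure E) (P : E → Measure E) (f : E → ℝ) : ℝ :=
  ∫ x, (f x - ∫ y, f y ∂(P x)) * f x ∂π

/-- The oscillation seminorm `ess sup f - ess inf f`, with values in `[0, ∞]`. -/
def oscNorm (π : Measure E) (f : E → ℝ) : ℝ≥0∞ :=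
  (essSup (fun x => (f x : EReal)) π - essInf (fun x => (f x : EReal)) π).toENNReal

/-! ### Weights -/

/-- `(qw)(x) = ∫ q(x, dy) w(x, y)`. -/
def qwMean (q : Kernel E E) (w : E → E → ℝ≥0) (x : E) : ℝ≥0∞ :=
  ∫⁻ y, (w x y : ℝ≥0∞) ∂(q x)

/-- The importance weight `ϖ(x, y) = w(x, y) / (qw)(x)`. -/
def impWeight (q : Kernel E E) (w : E → E → ℝ≥0) (x y : E) : ℝ≥0∞ :=
  (w x y : ℝ≥0∞) / qwMean q w x

/-- The moment `M_ϖ(r) = (π ⊗ q)(ϖ(X, Y) ^ r)`, for a real exponent `r` of any sign. -/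
def weightMoment (π : Measure E) (q : Kernel E E) (w : E → E → ℝ≥0) (r : ℝ) : ℝ≥0∞ :=
  ∫⁻ x, ∫⁻ y, impWeight q w x y ^ r ∂(q x) ∂π

/-- The empirical mean `n⁻¹ ∑ᵢ w(x, Yᵢ)` over all `n` trials. -/
def qwHat (w : E → E → ℝ≥0) (n : ℕ) (x : E) (Y : Fin n → E) : ℝ≥0∞ :=
  (∑ i, (w x (Y i) : ℝ≥0∞)) / (n : ℝ≥0∞)

/-- The same empirical mean when the first of the `n` trials is pinned at `y` and `Y` lists the
remaining `n - 1` trials. -/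
def qwHatPinned (w : E → E → ℝ≥0) (n : ℕ) (x y : E) (Y : Fin (n - 1) → E) : ℝ≥0∞ :=
  ((w x y : ℝ≥0∞) + ∑ i, (w x (Y i) : ℝ≥0∞)) / (n : ℝ≥0∞)

/-- `E[(n⁻¹ ∑ᵢ w(x, Yᵢ))⁻¹ | Y₁ = y]⁻¹`, where `Y₂, …, Yₙ` are independent draws of `q(x, ·)`. -/
def qwTilde (q : Kernel E E) (w : E → E → ℝ≥0) (n : ℕ) (x y : E) : ℝ≥0∞ :=
  (∫⁻ Y, (qwHatPinned w n x y Y)⁻¹ ∂(Measure.pi fun _ : Fin (n - 1) => q x))⁻¹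

/-- The weighted proposal `q^w(x, dy) = q(x, dy) w(x, y) / (qw)(x)`. -/
def weightedProposal (q : Kernel E E) (w : E → E → ℝ≥0) (x : E) : Measure E :=
  (q x).withDensity fun y => (w x y : ℝ≥0∞) / qwMean q w x

/-- The effective proposal `q(x, dy) w(x, y) / (q̃w)ₙ(x, y)` of importance resampling. -/
def resampledProposal (q : Kernel E E) (w : E → E → ℝ≥0) (n : ℕ) (x : E) : Measure E :=
  (q x).withDensity fun y => (w x y : ℝ≥0∞) / qwTilde q w n x y

/-! ### The Markov kernels

`dπ` and `dq` are the densities of the target and of the proposal. -/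

/-- A transition that moves according to the sub-probability `move` of accepted moves and
otherwise remains at `x`. -/
def acceptReject (move : E → Measure E) (x : E) : Measure E :=
  move x + (1 - move x Set.univ) • Measure.dirac x

/-- Acceptance probability of the ideal chain. -/
def idealAccept (dπ : E → ℝ≥0) (dq : E → E → ℝ≥0) (q : Kernel E E) (w : E → E → ℝ≥0)
    (x y : E) : ℝ≥0∞ :=
  min 1 (((dπ y : ℝ≥0∞) * dq y x * w y x * qwMean q w x) /
    ((dπ x : ℝ≥0∞) * dq x y * w x y * qwMean q w y))

/-- The ideal Metropolis–Hastings kernel `P_∞`, with proposal `q^w`. -/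
def idealKernel (dπ : E → ℝ≥0) (dq : E → E → ℝ≥0) (q : Kernel E E) (w : E → E → ℝ≥0) :
    E → Measure E :=
  acceptReject fun x => (weightedProposal q w x).withDensity (idealAccept dπ dq q w x)

/-- Acceptance probability of the semi-ideal chain. -/
def semiIdealAccept (dπ : E → ℝ≥0) (dq : E → E → ℝ≥0) (q : Kernel E E) (w : E → E → ℝ≥0)
    (n : ℕ) (x y : E) : ℝ≥0∞ :=
  min 1 (((dπ y : ℝ≥0∞) * dq y x * w y x * qwTilde q w n x y) /
    ((dπ x : ℝ≥0∞) * dq x y * w x y * qwTilde q w n y x))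

/-- The semi-ideal Metropolis–Hastings kernel, whose proposal is the resampled one. -/
def semiIdealKernel (dπ : E → ℝ≥0) (dq : E → E → ℝ≥0) (q : Kernel E E) (w : E → E → ℝ≥0)
    (n : ℕ) : E → Measure E :=
  acceptReject fun x => (resampledProposal q w n x).withDensity (semiIdealAccept dπ dq q w n x)

/-- Acceptance probability of a Multiple-try move from `x` to `y`, given the trials `Y` and the
balancing trials `Z`. -/
def mtmAccept (dπ : E → ℝ≥0) (dq : E → E → ℝ≥0) (w : E → E → ℝ≥0) (n : ℕ)
    (x y : E) (Y Z : Fin n → E) : ℝ≥0∞ :=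
  min 1 (((dπ y : ℝ≥0∞) * dq y x * w y x * qwHat w n x Y) /
    ((dπ x : ℝ≥0∞) * dq x y * w x y * qwHat w n y Z))

/-- The law of an accepted Multiple-try move from `x`: draw `Y₁, …, Yₙ` from `q(x, ·)`, select the
index `i` with probability `w(x, Yᵢ) / ∑ⱼ w(x, Yⱼ)`, draw `Zⱼ` from `q(Yᵢ, ·)` for `j ≠ i`, set
`Zᵢ = x`, and accept `Yᵢ` with probability `mtmAccept`. -/
def mtmMove (dπ : E → ℝ≥0) (dq : E → E → ℝ≥0) (q : Kernel E E) (w : E → E → ℝ≥0)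
    (n : ℕ) (x : E) : Measure E :=
  ∑ i : Fin n, Measure.map (fun Y : Fin n → E => Y i)
    ((Measure.pi fun _ : Fin n => q x).withDensity fun Y =>
      (w x (Y i) : ℝ≥0∞) / (n * qwHat w n x Y) *
        ∫⁻ Z, mtmAccept dπ dq w n x (Y i) Y (Function.update Z i x)
          ∂(Measure.pi fun _ : Fin n => q (Y i)))

/-- The Multiple-try Metropolis kernel `Pₙ`. -/
def mtmKernel (dπ : E → ℝ≥0) (dq : E → E → ℝ≥0) (q : Kernel E E) (w : E → E → ℝ≥0)
    (n : ℕ) : E → Measure E :=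
  acceptReject (mtmMove dπ dq q w n)

/-! ### The comparison function -/

/-- `β₁,ₙ(s) = (π ⊗ q^w)(E[n / ∑ᵢ ϖ(X, Yᵢ) | Y₁ = Y] < 1 / s)`. -/
def betaOne (π : Measure E) (q : Kernel E E) (w : E → E → ℝ≥0) (n : ℕ) (s : ℝ) : ℝ≥0∞ :=
  ∫⁻ x, weightedProposal q w x
    {y | ∫⁻ Y, (n : ℝ≥0∞) / (impWeight q w x y + ∑ i, impWeight q w x (Y i))
        ∂(Measure.pi fun _ : Fin (n - 1) => q x) < ENNReal.ofReal (1 / s)} ∂π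

/-- `ζₙ(x, y)`: the mean of the smaller of `(q̃w)ₙ(x, y) / n⁻¹ ∑ᵢ w(x, Yᵢ)` and
`(q̃w)ₙ(y, x) / n⁻¹ ∑ᵢ w(y, Zᵢ)`, given `Y₁ = y` and `Z₁ = x`. -/
def zeta (q : Kernel E E) (w : E → E → ℝ≥0) (n : ℕ) (x y : E) : ℝ≥0∞ :=
  ∫⁻ Y, ∫⁻ Z, min (qwTilde q w n x y / qwHatPinned w n x y Y)
      (qwTilde q w n y x / qwHatPinned w n y x Z)
    ∂(Measure.pi fun _ : Fin (n - 1) => q y) ∂(Measure.pi fun _ : Fin (n - 1) => q x)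

/-- `β₂,ₙ(s) = (π ⊗ P̃ₙ)(ζₙ(X, Y) < 1 / s)`, with `P̃ₙ` the semi-ideal kernel. -/
def betaTwo (π : Measure E) (dπ : E → ℝ≥0) (dq : E → E → ℝ≥0) (q : Kernel E E)
    (w : E → E → ℝ≥0) (n : ℕ) (s : ℝ) : ℝ≥0∞ :=
  ∫⁻ x, semiIdealKernel dπ dq q w n x {y | zeta q w n x y < ENNReal.ofReal (1 / s)} ∂π

/-- `inf {β₁,ₙ(s₁) + s₁ β₂,ₙ(s₂) : s₁, s₂ > 0, s₁ s₂ = s}`. -/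
def chainedBeta (π : Measure E) (dπ : E → ℝ≥0) (dq : E → E → ℝ≥0) (q : Kernel E E)
    (w : E → E → ℝ≥0) (n : ℕ) (s : ℝ) : ℝ≥0∞ :=
  ⨅ (s₁ : ℝ) (s₂ : ℝ) (_ : 0 < s₁) (_ : 0 < s₂) (_ : s₁ * s₂ = s),
    betaOne π q w n s₁ + ENNReal.ofReal s₁ * betaTwo π dπ dq q w n s₂

/-! ### The constants of the polynomial rate -/

/-- `c₁ = M_ϖ(p) + K₁ / n`. -/
def rateC₁ (π : Measure E) (q : Kernel E E) (w : E → E → ℝ≥0) (p K₁ : ℝ) (n : ℕ) : ℝ :=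
  (weightMoment π q w p).toReal + K₁ * (n : ℝ)⁻¹

/-- `c₂ = 2 ^ (p + 1) (K₂ / n + K₃ / n² + M_ϖ(2p) + M_ϖ(-2p))`. -/
def rateC₂ (π : Measure E) (q : Kernel E E) (w : E → E → ℝ≥0) (p K₂ K₃ : ℝ) (n : ℕ) : ℝ :=
  2 ^ (p + 1) * (K₂ * (n : ℝ)⁻¹ + K₃ * ((n : ℝ) ^ 2)⁻¹
    + (weightMoment π q w (2 * p)).toReal + (weightMoment π q w (-2 * p)).toReal)

/-- `c₂ u ^ (1 + p) + c₁ u ^ (-p)` with `u = c₁ p / (c₂ (1 + p))`. -/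
def rateConst (p c₁ c₂ : ℝ) : ℝ :=
  c₂ * (c₁ * p / (c₂ * (1 + p))) ^ (1 + p) + c₁ * (c₁ * p / (c₂ * (1 + p))) ^ (-p)

end MultipleTry

end

set_option linter.unusedSectionVars false

noncomputable section

namespace MultipleTry

variable {E : Type*} [MeasurableSpace E]

/-! ### Jensen-type inequalities -/

section Jensen

variable {Ω : Type*} [MeasurableSpace Ω] {ν : Measure Ω} [IsProbabilityMeasure ν]

/-! Each of the three chains moves from `x` with some density `g x y` relative to `q x` and
otherwise stays put. At stationarity its accepted moves have density `F x y = dπ x * dq x y * g x y`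
relative to `μ ⊗ μ`. With `A = weightedFlow`, the three flows are minima of `A x y / a` and `A y x /
b`: the normalisers are `qwMean` for the ideal chain, `qwTilde` for the semi-ideal one, and the
empirical means, averaged over the trials, for Multiple-try. All are symmetric, so the chains are
reversible and each Dirichlet form is half the integral of `F x y * (f x - f y) ^ 2`. Comparing
Dirichlet forms thus reduces to comparing flows pointwise, up to an exceptional flow whose energy is
at most half its mass times the squared oscillation (`flowEnergy_le_add`).

The ideal flow is at most `s₁` times the semi-ideal flow unless `qwMean / qwTilde < 1 / s₁` in one
of the two directions (`idealFlow_le_add`); this costs `betaOne`. The product of `zeta` and the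
semi-ideal flow is at most the Multiple-try flow (`zeta_mul_semiIdealFlow_le`); where `zeta < 1 /
s₂` this costs `betaTwo`. Chaining the two bounds and optimising over `s₁ * s₂ = s` gives the
inequality, with truncation and Fatou for functions of infinite oscillation.

For the limits, `qwTilde` tends to `qwMean` pointwise. Jensen bounds it above; below, a Chernoff
bound controls the reciprocal of the empirical mean, which the pinned trial keeps below `n / w x y`
(`tendsto_lintegral_inv_mean_tsub`). The same estimate gives `zeta → 1`. Hence both betas vanish in
the limit for arguments above `1`, whereas below `1` the first tends to `1` and the second equals
`1`.

For the rate, Markov's inequality with negative powers and Jensen's inequality reduce the betas to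
moments of the importance weight (`betaOne_le`, `betaTwo_le`); reversibility of the semi-ideal chain
removes the dependence on the second variable. A power-law choice of `s₁` then balances the two
terms. -/

lemma rpow_lintegral_le_lintegral_rpow {f : Ω → ℝ≥0∞} (hf : Measurable f) {p : ℝ} (hp : 1 ≤ p) :
    (∫⁻ x, f x ∂ν) ^ p ≤ ∫⁻ x, f x ^ p ∂ν := by
  have hp0 : 0 < p := by linarith
  have h := eLpNorm'_le_eLpNorm'_of_exponent_le one_pos hp ν hf.aestronglyMeasurable
  simp only [eLpNorm'_eq_lintegral_enorm, enorm_eq_self, ENNReal.rpow_one, div_one] at h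
  calc (∫⁻ x, f x ∂ν) ^ p ≤ ((∫⁻ x, f x ^ p ∂ν) ^ (1 / p)) ^ p :=
        ENNReal.rpow_le_rpow h hp0.le
    _ = ∫⁻ x, f x ^ p ∂ν := by
        rw [← ENNReal.rpow_mul, one_div_mul_cancel hp0.ne', ENNReal.rpow_one]

/-- Cauchy–Schwarz for the square roots of `f` and of its reciprocal. -/
lemma one_le_lintegral_mul_lintegral_inv {f : Ω → ℝ≥0∞} (hf : Measurable f)
    (h0 : ∀ x, f x ≠ 0) (htop : ∀ x, f x ≠ ∞) :
    1 ≤ (∫⁻ x, f x ∂ν) * ∫⁻ x, (f x)⁻¹ ∂ν := by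
  have h := ENNReal.lintegral_mul_le_Lp_mul_Lq ν Real.HolderConjugate.two_two
    (hf.pow_const (1 / 2 : ℝ)).aemeasurable (hf.inv.pow_const (1 / 2 : ℝ)).aemeasurable
  simp only [Pi.mul_apply, ← ENNReal.rpow_mul, Pi.inv_apply] at h
  norm_num at h
  have h1 : ∀ x, f x ^ (1 / 2 : ℝ) * (f x)⁻¹ ^ (1 / 2 : ℝ) = 1 := fun x => by
    rw [← ENNReal.mul_rpow_of_nonneg _ _ (by norm_num), ENNReal.mul_inv_cancel (h0 x) (htop x),
      ENNReal.one_rpow]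
  simp only [h1, lintegral_const, measure_univ, mul_one] at h
  rw [← ENNReal.mul_rpow_of_nonneg _ _ (by norm_num)] at h
  by_contra hlt
  exact absurd h (not_le.2 (ENNReal.rpow_lt_one (not_le.1 hlt) (by norm_num)))

lemma inv_lintegral_inv_le {f : Ω → ℝ≥0∞} (hf : Measurable f)
    (h0 : ∀ x, f x ≠ 0) (htop : ∀ x, f x ≠ ∞) :
    (∫⁻ x, (f x)⁻¹ ∂ν)⁻¹ ≤ ∫⁻ x, f x ∂ν := by
  have h := one_le_lintegral_mul_lintegral_inv (ν := ν) hf h0 htop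
  calc (∫⁻ x, (f x)⁻¹ ∂ν)⁻¹
      ≤ ((∫⁻ x, f x ∂ν) * ∫⁻ x, (f x)⁻¹ ∂ν) * (∫⁻ x, (f x)⁻¹ ∂ν)⁻¹ := le_mul_of_one_le_left' h
    _ ≤ (∫⁻ x, f x ∂ν) * 1 := by
        rw [mul_assoc]
        gcongr
        exact ENNReal.mul_inv_le_one _
    _ = _ := mul_one _

/-- Harmonic–arithmetic comparison followed by the power mean inequality. It turns negative powers
of a mean reciprocal, as produced by Markov's inequality, into positive moments. -/
lemma lintegral_inv_rpow_neg_le {f : Ω → ℝ≥0∞} (hf : Measurable f)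
    (h0 : ∀ x, f x ≠ 0) (htop : ∀ x, f x ≠ ∞) {p : ℝ} (hp : 1 ≤ p) :
    (∫⁻ x, (f x)⁻¹ ∂ν) ^ (-p) ≤ ∫⁻ x, f x ^ p ∂ν := by
  rw [ENNReal.rpow_neg, ← ENNReal.inv_rpow]
  exact (ENNReal.rpow_le_rpow (inv_lintegral_inv_le hf h0 htop) (by linarith)).trans
    (rpow_lintegral_le_lintegral_rpow hf hp)

lemma rpow_mean_le_mean_rpow {m : ℕ} (hm : m ≠ 0) (z : Fin m → ℝ≥0∞) {p : ℝ} (hp : 1 ≤ p) :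
    ((∑ i, z i) / m) ^ p ≤ (∑ i, z i ^ p) / m := by
  have hm' : (m : ℝ≥0∞) ≠ 0 := by exact_mod_cast hm
  have h := ENNReal.rpow_arith_mean_le_arith_mean_rpow Finset.univ
    (fun _ : Fin m => (m : ℝ≥0∞)⁻¹) z (by
      simp [ENNReal.mul_inv_cancel hm' (ENNReal.natCast_ne_top m)]) hp
  simpa only [← Finset.mul_sum, ENNReal.div_eq_inv_mul] using h

lemma inv_mean_le_mean_inv {m : ℕ} (hm : m ≠ 0) (z : Fin m → ℝ≥0∞)
    (h0 : ∀ i, z i ≠ 0) (htop : ∀ i, z i ≠ ∞) :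
    ((∑ i, z i) / m)⁻¹ ≤ (∑ i, (z i)⁻¹) / m := by
  have hm' : (m : ℝ≥0∞) ≠ 0 := by exact_mod_cast hm
  let ν : Measure (Fin m) := (m : ℝ≥0∞)⁻¹ • Measure.count
  have : IsProbabilityMeasure ν := ⟨by
    simp [ν, Measure.count_univ, ENNReal.inv_mul_cancel hm' (ENNReal.natCast_ne_top m)]⟩
  -- The harmonic mean inequality for normalised counting measure, applied to the reciprocals.
  have h := inv_lintegral_inv_le (ν := ν) (f := fun i => (z i)⁻¹) (measurable_of_finite _)
    (fun i => ENNReal.inv_ne_zero.2 (htop i)) (fun i => ENNReal.inv_ne_top.2 (h0 i))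
  simpa [ν, lintegral_smul_measure, lintegral_count, ENNReal.div_eq_inv_mul] using h

end Jensen

/-! ### Independent trials -/

section Trials

lemma measurable_pi_measure (q : Kernel E E) [IsMarkovKernel q] (n : ℕ) :
    Measurable fun x => Measure.pi fun _ : Fin n => q x := by
  refine Measurable.measure_of_isPiSystem_of_isProbabilityMeasure generateFrom_pi.symm
    isPiSystem_pi ?_
  rintro _ ⟨s, hs, rfl⟩
  simp only [Measure.pi_pi]
  exact Finset.measurable_prod _ fun i _ => q.measurable_coe (hs i (Set.mem_univ i))

/-- The law of `n` independent draws of `q(x, ·)`. -/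
def trialKernel (q : Kernel E E) [IsMarkovKernel q] (n : ℕ) : Kernel E (Fin n → E) :=
  ⟨fun x => Measure.pi fun _ => q x, measurable_pi_measure q n⟩

instance (q : Kernel E E) [IsMarkovKernel q] (n : ℕ) : IsMarkovKernel (trialKernel q n) :=
  ⟨fun x => inferInstanceAs (IsProbabilityMeasure (Measure.pi fun _ : Fin n => q x))⟩

lemma measurable_lintegral_trials (q : Kernel E E) [IsMarkovKernel q] (n : ℕ)
    {α : Type*} [MeasurableSpace α] {b : α → E} (hb : Measurable b)
    {F : α → (Fin n → E) → ℝ≥0∞} (hF : Measurable (Function.uncurry F)) :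
    Measurable fun a => ∫⁻ Y, F a Y ∂(Measure.pi fun _ : Fin n => q (b a)) :=
  hF.lintegral_kernel_prod_right (κ := (trialKernel q n).comap b hb)

variable (ν : Measure E) [IsProbabilityMeasure ν]

lemma lintegral_pi_eval {n : ℕ} (i : Fin n) {f : E → ℝ≥0∞} (hf : Measurable f) :
    ∫⁻ Y, f (Y i) ∂(Measure.pi fun _ : Fin n => ν) = ∫⁻ y, f y ∂ν :=
  (measurePreserving_eval (fun _ : Fin n => ν) i).lintegral_comp hf

lemma lintegral_pi_mean {n : ℕ} (hn : n ≠ 0) {f : E → ℝ≥0∞} (hf : Measurable f) :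
    ∫⁻ Y, (∑ i, f (Y i)) / n ∂(Measure.pi fun _ : Fin n => ν) = ∫⁻ y, f y ∂ν := by
  have hn' : (n : ℝ≥0∞) ≠ 0 := by exact_mod_cast hn
  simp only [div_eq_mul_inv]
  have hfi : ∀ i, Measurable fun Y : Fin n → E => f (Y i) :=
    fun i => hf.comp (measurable_pi_apply i)
  rw [lintegral_mul_const _ (Finset.measurable_sum _ fun i _ => hfi i),
    lintegral_finsetSum _ fun i _ => hfi i]
  simp only [lintegral_pi_eval ν _ hf, Finset.sum_const, Finset.card_univ, Fintype.card_fin,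
    nsmul_eq_mul]
  rw [mul_right_comm, ENNReal.mul_inv_cancel hn' (ENNReal.natCast_ne_top n), one_mul]

lemma lintegral_pi_prod {n : ℕ} {f : E → ℝ≥0∞} (hf : Measurable f) :
    ∫⁻ Y, ∏ i, f (Y i) ∂(Measure.pi fun _ : Fin n => ν) = (∫⁻ y, f y ∂ν) ^ n := by
  have h := lintegral_prod_eq_prod_lintegral_of_indepFun Finset.univ
    (fun i (Y : Fin n → E) => f (Y i))
    (iIndepFun_pi (μ := fun _ : Fin n => ν) (X := fun _ => f) fun _ => hf.aemeasurable)
    fun i => hf.comp (measurable_pi_apply i)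
  simpa [lintegral_pi_eval ν _ hf] using h

/-- Singles out one trial of an i.i.d. sample. This links the kernels, defined with `n` full trials,
to the averages in which one trial is pinned. -/
lemma lintegral_pi_insertNth {m : ℕ} (i : Fin (m + 1)) {F : (Fin (m + 1) → E) → ℝ≥0∞}
    (hF : Measurable F) :
    ∫⁻ Y, F Y ∂(Measure.pi fun _ : Fin (m + 1) => ν)
      = ∫⁻ y, ∫⁻ Y', F (i.insertNth y Y') ∂(Measure.pi fun _ : Fin m => ν) ∂ν := by
  have h := measurePreserving_piFinSuccAbove (fun _ : Fin (m + 1) => ν) i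
  rw [← h.symm.lintegral_comp_emb (MeasurableEquiv.measurableEmbedding _)]
  exact lintegral_prod _ (hF.comp (MeasurableEquiv.measurable _)).aemeasurable

end Trials

/-! ### Reciprocals of empirical means -/

section Chernoff

variable (ν : Measure E) [IsProbabilityMeasure ν]

/-- The difference quotients `(1 - exp (-t v)) / t` tend to `v` as `t → 0`, so by Fatou their mean
exceeds `c` for some small `t`; then `1 - t c ≤ exp (-t c)`. Fatou makes integrability of `v`
unnecessary. -/
lemma exists_lintegral_exp_neg_le {v : E → ℝ≥0} (hv : Measurable v) {c : ℝ}
    (hc : ENNReal.ofReal c < ∫⁻ y, (v y : ℝ≥0∞) ∂ν) :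
    ∃ t : ℝ, 0 < t ∧
      ∫⁻ y, ENNReal.ofReal (Real.exp (-t * v y)) ∂ν ≤ ENNReal.ofReal (Real.exp (-t * c)) := by
  let t : ℕ → ℝ := fun j => 1 / ((j : ℝ) + 1)
  have ht0 : ∀ j, 0 < t j := fun j => by positivity
  have htend : Tendsto t atTop (𝓝[≠] 0) :=
    tendsto_nhdsWithin_iff.2 ⟨tendsto_one_div_add_atTop_nhds_zero_nat,
      Eventually.of_forall fun j => (ht0 j).ne'⟩
  have hlim : ∀ y, Tendsto (fun j => ENNReal.ofReal ((1 - Real.exp (-(t j) * v y)) / t j)) atTop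
      (𝓝 (v y : ℝ≥0∞)) := fun y => by
    have hd : HasDerivAt (fun s : ℝ => -Real.exp (-s * v y)) (v y : ℝ) 0 := by
      have h1 : HasDerivAt (fun s : ℝ => -s * (v y : ℝ)) (-1 * (v y : ℝ)) 0 :=
        (hasDerivAt_neg 0).mul_const _
      exact h1.exp.neg.congr_deriv (by simp)
    have h2 := (hasDerivAt_iff_tendsto_slope.1 hd).comp htend
    have h3 := ENNReal.tendsto_ofReal h2
    rw [ENNReal.ofReal_coe_nnreal] at h3
    refine h3.congr fun j => ?_
    simp only [Function.comp, slope_def_field]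
    simp
    ring_nf
  have hmeas : ∀ j, Measurable fun y => ENNReal.ofReal ((1 - Real.exp (-(t j) * v y)) / t j) :=
    fun j => by fun_prop
  have hF : ∫⁻ y, (v y : ℝ≥0∞) ∂ν
      ≤ liminf (fun j => ∫⁻ y, ENNReal.ofReal ((1 - Real.exp (-(t j) * v y)) / t j) ∂ν) atTop := by
    refine le_trans (le_of_eq ?_) (lintegral_liminf_le hmeas)
    exact lintegral_congr fun y => (hlim y).liminf_eq.symm
  obtain ⟨j, hj⟩ := (eventually_lt_of_lt_liminf (hc.trans_le hF)).exists
  refine ⟨t j, ht0 j, ?_⟩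
  have hbd : ∀ y, Real.exp (-(t j) * v y) ≤ 1 := fun y =>
    Real.exp_le_one_iff.2 (by nlinarith [ht0 j, (v y).coe_nonneg])
  have hint : Integrable (fun y => Real.exp (-(t j) * v y)) ν :=
    Integrable.of_bound (by fun_prop) 1 (ae_of_all _ fun y => by
      rw [Real.norm_eq_abs, abs_of_pos (Real.exp_pos _)]; exact hbd y)
  rw [← ofReal_integral_eq_lintegral_ofReal hint (ae_of_all _ fun y => (Real.exp_pos _).le)]
  have hint' : Integrable (fun y => (1 - Real.exp (-(t j) * v y)) / t j) ν :=
    ((integrable_const 1).sub hint).div_const _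
  rw [← ofReal_integral_eq_lintegral_ofReal hint'
    (ae_of_all _ fun y => div_nonneg (sub_nonneg.2 (hbd y)) (ht0 j).le), integral_div] at hj
  have hsub : ∫ y, ((1 : ℝ) - Real.exp (-(t j) * v y)) ∂ν
      = 1 - ∫ y, Real.exp (-(t j) * v y) ∂ν := by
    rw [integral_sub (integrable_const 1) hint]; simp
  rw [hsub] at hj
  refine ENNReal.ofReal_le_ofReal ?_
  have hj' := lt_of_not_ge fun hle => absurd hj (not_lt.2 (ENNReal.ofReal_le_ofReal hle))
  rw [lt_div_iff₀ (ht0 j)] at hj'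
  have := Real.add_one_le_exp (-(t j) * c)
  linarith

/-- The integrand vanishes unless the empirical mean is below `c`. There the pinned value `a` keeps
the reciprocal below `n / a`, while the Chernoff bound makes the event exponentially unlikely, and
`n * exp (-δ n) → 0`. -/
lemma tendsto_lintegral_inv_mean_tsub {v : E → ℝ≥0} (hv : Measurable v) {a c : ℝ≥0}
    (ha : 0 < a) (hc : (c : ℝ≥0∞) < ∫⁻ y, (v y : ℝ≥0∞) ∂ν) :
    Tendsto (fun n : ℕ => ∫⁻ Y, ((((a : ℝ≥0∞) + ∑ i, (v (Y i) : ℝ≥0∞)) / n)⁻¹ - (c : ℝ≥0∞)⁻¹)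
      ∂(Measure.pi fun _ : Fin (n - 1) => ν)) atTop (𝓝 0) := by
  -- The Laplace transform is controlled at a level `c'` strictly above `c`; the gap `c' - c`
  -- supplies the exponential decay.
  obtain ⟨c', hcc', hc'⟩ := ENNReal.lt_iff_exists_nnreal_btwn.1 hc
  obtain ⟨t, ht, hφ⟩ := exists_lintegral_exp_neg_le ν hv (c := c') (by simpa using hc')
  have hcc : (c : ℝ) < c' := by exact_mod_cast hcc'
  have hbound : ∀ n : ℕ, 1 ≤ n → ∫⁻ Y, ((((a : ℝ≥0∞) + ∑ i, (v (Y i) : ℝ≥0∞)) / n)⁻¹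
      - (c : ℝ≥0∞)⁻¹) ∂(Measure.pi fun _ : Fin (n - 1) => ν)
      ≤ ENNReal.ofReal ((a : ℝ)⁻¹ * Real.exp (t * c') * (n * Real.exp (-(t * (c' - c)) * n))) := by
    intro n hn
    obtain ⟨m, rfl⟩ : ∃ m, n = m + 1 := ⟨n - 1, by omega⟩
    have hpt : ∀ Y : Fin m → E, ((((a : ℝ≥0∞) + ∑ i, (v (Y i) : ℝ≥0∞)) / (m + 1 : ℕ))⁻¹
        - (c : ℝ≥0∞)⁻¹) ≤ ENNReal.ofReal ((m + 1 : ℕ) / a * Real.exp (t * c * (m + 1 : ℕ)))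
          * ∏ i, ENNReal.ofReal (Real.exp (-t * v (Y i))) := by
      intro Y
      rcases le_or_gt (c : ℝ≥0∞) (((a : ℝ≥0∞) + ∑ i, (v (Y i) : ℝ≥0∞)) / (m + 1 : ℕ)) with h | h
      · rw [tsub_eq_zero_of_le (ENNReal.inv_le_inv.2 h)]; exact zero_le
      · rw [← ENNReal.ofReal_prod_of_nonneg fun i _ => (Real.exp_pos _).le, ← Real.exp_sum,
          ← ENNReal.ofReal_mul (by positivity), mul_assoc, ← Real.exp_add]
        have h1 : (a : ℝ) + ∑ i, (v (Y i) : ℝ) < c * (m + 1 : ℕ) := by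
          rw [ENNReal.div_lt_iff (by simp) (by simp)] at h
          exact_mod_cast h
        refine tsub_le_self.trans ?_
        rw [ENNReal.inv_div (by simp) (by simp)]
        calc ((m + 1 : ℕ) : ℝ≥0∞) / ((a : ℝ≥0∞) + ∑ i, (v (Y i) : ℝ≥0∞))
            ≤ ((m + 1 : ℕ) : ℝ≥0∞) / (a : ℝ≥0∞) := by gcongr; exact le_self_add
          _ = ENNReal.ofReal ((m + 1 : ℕ) / a) := by
              rw [ENNReal.ofReal_div_of_pos (by exact_mod_cast ha), ENNReal.ofReal_natCast,
                ENNReal.ofReal_coe_nnreal]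
          _ ≤ _ := by
              -- On this event the sum of the `v (Y i)` is below `c * n`, so the exponential factor
              -- is at least one.
              refine ENNReal.ofReal_le_ofReal (le_mul_of_one_le_right (by positivity) ?_)
              rw [Real.one_le_exp_iff, ← Finset.mul_sum]
              have : 0 ≤ (a : ℝ) := a.coe_nonneg
              nlinarith
    calc _ ≤ ∫⁻ Y, ENNReal.ofReal ((m + 1 : ℕ) / a * Real.exp (t * c * (m + 1 : ℕ)))
          * ∏ i, ENNReal.ofReal (Real.exp (-t * v (Y i))) ∂(Measure.pi fun _ : Fin m => ν) :=
          lintegral_mono hpt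
      _ = ENNReal.ofReal ((m + 1 : ℕ) / a * Real.exp (t * c * (m + 1 : ℕ)))
          * (∫⁻ y, ENNReal.ofReal (Real.exp (-t * v y)) ∂ν) ^ m := by
          rw [lintegral_const_mul' _ _ ENNReal.ofReal_ne_top,
            lintegral_pi_prod ν (f := fun y => ENNReal.ofReal (Real.exp (-t * v y))) (by fun_prop)]
      _ ≤ ENNReal.ofReal ((m + 1 : ℕ) / a * Real.exp (t * c * (m + 1 : ℕ)))
          * (ENNReal.ofReal (Real.exp (-t * c'))) ^ m := by gcongr
      _ = _ := by
          rw [← ENNReal.ofReal_pow (Real.exp_pos _).le, ← ENNReal.ofReal_mul (by positivity),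
            ← Real.exp_nat_mul]
          congr 1
          rw [mul_assoc, ← Real.exp_add]
          have : t * c * (m + 1 : ℕ) + m * (-t * c') = t * c' + (-(t * (c' - c)) * (m + 1 : ℕ)) := by
            push_cast; ring
          rw [this, Real.exp_add]
          ring
  refine tendsto_of_tendsto_of_tendsto_of_le_of_le' tendsto_const_nhds ?_
    (Eventually.of_forall fun _ => zero_le)
    ((eventually_ge_atTop 1).mono hbound)
  have hpos : 0 < t * ((c' : ℝ) - c) := mul_pos ht (sub_pos.2 hcc)
  have h1 : Tendsto (fun n : ℕ => (n : ℝ) * Real.exp (-(t * (c' - c)) * n)) atTop (𝓝 0) := by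
    have := (Real.tendsto_pow_mul_exp_neg_atTop_nhds_zero 1).comp
      (tendsto_natCast_atTop_atTop.const_mul_atTop hpos)
    have h2 := this.const_mul (t * ((c' : ℝ) - c))⁻¹
    rw [mul_zero] at h2
    refine h2.congr fun n => ?_
    simp only [Function.comp, pow_one, neg_mul]
    rw [← mul_assoc, ← mul_assoc, inv_mul_cancel₀ hpos.ne', one_mul]
  have h3 := ENNReal.tendsto_ofReal (h1.const_mul ((a : ℝ)⁻¹ * Real.exp (t * c')))
  simpa using h3

end Chernoff

/-! ### Dirichlet forms of reversible kernels -/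

section Dirichlet

variable {π : Measure E} [IsProbabilityMeasure π] {κ : Kernel E E} [IsMarkovKernel κ]

lemma measurePreserving_fst_compProd : MeasurePreserving Prod.fst (π ⊗ₘ κ) π :=
  ⟨measurable_fst, by rw [← Measure.fst, Measure.fst_compProd]⟩

lemma measurePreserving_snd_compProd (hrev : (π ⊗ₘ κ).map Prod.swap = π ⊗ₘ κ) :
    MeasurePreserving Prod.snd (π ⊗ₘ κ) π := by
  have hswap : MeasurePreserving Prod.swap (π ⊗ₘ κ) (π ⊗ₘ κ) := ⟨measurable_swap, hrev⟩
  exact measurePreserving_fst_compProd.comp hswap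

/-- Swapping the coordinates, which preserves the joint law, turns the integral of `(f x - f y) f x`
into minus that of `(f x - f y) f y`. Their difference is the integral of the square. -/
lemma dirichletForm_eq_integral (hrev : (π ⊗ₘ κ).map Prod.swap = π ⊗ₘ κ) {f : E → ℝ}
    (hf : MemLp f 2 π) :
    Integrable (fun p : E × E => (f p.1 - f p.2) ^ 2) (π ⊗ₘ κ) ∧
    dirichletForm π κ f = 2⁻¹ * ∫ p, (f p.1 - f p.2) ^ 2 ∂(π ⊗ₘ κ) := by
  have h1 : MemLp (fun p : E × E => f p.1) 2 (π ⊗ₘ κ) :=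
    hf.comp_measurePreserving measurePreserving_fst_compProd
  have h2 : MemLp (fun p : E × E => f p.2) 2 (π ⊗ₘ κ) :=
    hf.comp_measurePreserving (measurePreserving_snd_compProd hrev)
  have hsub : MemLp (fun p : E × E => f p.1 - f p.2) 2 (π ⊗ₘ κ) := h1.sub h2
  have hi1 : Integrable (fun p : E × E => (f p.1 - f p.2) * f p.1) (π ⊗ₘ κ) :=
    hsub.integrable_mul h1
  have hi2 : Integrable (fun p : E × E => (f p.1 - f p.2) * f p.2) (π ⊗ₘ κ) :=
    hsub.integrable_mul h2
  -- The inner Bochner integral in `dirichletForm` is meaningful for almost every `x`, since `f` is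
  -- square integrable under the second marginal too.
  have hae : ∀ᵐ x ∂π, Integrable f (κ x) := by
    have := (h2.integrable one_le_two)
    exact ((Measure.integrable_compProd_iff this.aestronglyMeasurable).1 this).1
  have hE : dirichletForm π κ f = ∫ p, (f p.1 - f p.2) * f p.1 ∂(π ⊗ₘ κ) := by
    rw [Measure.integral_compProd hi1, dirichletForm]
    refine integral_congr_ae ?_
    filter_upwards [hae] with x hx
    rw [integral_mul_const, integral_sub (integrable_const _) hx]
    simp
  have hswap : ∫ p, (f p.1 - f p.2) * f p.1 ∂(π ⊗ₘ κ)
      = - ∫ p, (f p.1 - f p.2) * f p.2 ∂(π ⊗ₘ κ) := by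
    conv_lhs => rw [← hrev]
    rw [integral_map measurable_swap.aemeasurable (by rw [hrev]; exact hi1.aestronglyMeasurable),
      ← integral_neg]
    refine integral_congr_ae (ae_of_all _ fun p => ?_)
    simp only [Prod.fst_swap, Prod.snd_swap]
    ring
  refine ⟨hsub.integrable_sq, ?_⟩
  have hsum : ∫ p, (f p.1 - f p.2) ^ 2 ∂(π ⊗ₘ κ)
      = ∫ p, (f p.1 - f p.2) * f p.1 ∂(π ⊗ₘ κ) - ∫ p, (f p.1 - f p.2) * f p.2 ∂(π ⊗ₘ κ) := by
    rw [← integral_sub hi1 hi2]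
    refine integral_congr_ae (ae_of_all _ fun p => ?_)
    ring
  rw [hE, hsum, hswap]
  ring

lemma dirichletForm_congr (hrev : (π ⊗ₘ κ).map Prod.swap = π ⊗ₘ κ) {f g : E → ℝ}
    (hf : MemLp f 2 π) (hfg : f =ᵐ[π] g) : dirichletForm π κ f = dirichletForm π κ g := by
  rw [(dirichletForm_eq_integral hrev hf).2,
    (dirichletForm_eq_integral hrev (hf.ae_eq hfg)).2]
  congr 1
  refine integral_congr_ae ?_
  filter_upwards [measurePreserving_fst_compProd.quasiMeasurePreserving.ae hfg,
    (measurePreserving_snd_compProd hrev).quasiMeasurePreserving.ae hfg] with p h1 h2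
  simp only [h1, h2]

lemma ofReal_dirichletForm (hrev : (π ⊗ₘ κ).map Prod.swap = π ⊗ₘ κ) {f : E → ℝ}
    (hf : MemLp f 2 π) :
    ENNReal.ofReal (dirichletForm π κ f)
      = 2⁻¹ * ∫⁻ p, ENNReal.ofReal ((f p.1 - f p.2) ^ 2) ∂(π ⊗ₘ κ) := by
  obtain ⟨hint, h⟩ := dirichletForm_eq_integral hrev hf
  rw [h, ENNReal.ofReal_mul (by norm_num),
    ofReal_integral_eq_lintegral_ofReal hint (ae_of_all _ fun p => sq_nonneg _),
    ENNReal.ofReal_inv_of_pos two_pos]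
  simp

end Dirichlet

/-! ### Metropolis–Hastings kernels -/

section MetropolisHastings

/-- The kernel that moves with density `g x` relative to `q x` and otherwise stays put. -/
def mhKernel (q : Kernel E E) [IsSFiniteKernel q] (g : E → E → ℝ≥0∞) : Kernel E E :=
  q.withDensity g + (Kernel.id : Kernel E E).withDensity fun x _ => 1 - ∫⁻ y, g x y ∂(q x)

variable {q : Kernel E E} [IsMarkovKernel q] {g : E → E → ℝ≥0∞}

lemma mhKernel_apply (hg : Measurable (Function.uncurry g)) (x : E) :
    mhKernel q g x
      = (q x).withDensity (g x) + (1 - ∫⁻ y, g x y ∂(q x)) • Measure.dirac x := by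
  have hm : Measurable fun x => 1 - ∫⁻ y, g x y ∂(q x) :=
    measurable_const.sub hg.lintegral_kernel_prod_right
  rw [mhKernel, FunLike.coe_add, Pi.add_apply, Kernel.withDensity_apply _ hg,
    Kernel.withDensity_apply _ (f := fun x _ => 1 - ∫⁻ y, g x y ∂(q x)) (hm.comp measurable_fst), Kernel.id_apply, withDensity_const]

lemma acceptReject_eq_mhKernel (hg : Measurable (Function.uncurry g)) {move : E → Measure E}
    (hmove : ∀ x, move x = (q x).withDensity (g x)) : acceptReject move = mhKernel q g := by
  funext x
  rw [acceptReject, mhKernel_apply hg, hmove, withDensity_apply _ MeasurableSet.univ,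
    Measure.restrict_univ]

lemma lintegral_mhKernel (hg : Measurable (Function.uncurry g)) (x : E) {h : E → ℝ≥0∞}
    (hh : Measurable h) :
    ∫⁻ y, h y ∂(mhKernel q g x)
      = ∫⁻ y, g x y * h y ∂(q x) + (1 - ∫⁻ y, g x y ∂(q x)) * h x := by
  rw [mhKernel_apply hg, lintegral_add_measure, lintegral_smul_measure, lintegral_dirac' _ hh,
    lintegral_withDensity_eq_lintegral_mul _ hg.of_uncurry_left hh]
  rfl

lemma isMarkovKernel_mhKernel (hg : Measurable (Function.uncurry g))
    (hmass : ∀ x, ∫⁻ y, g x y ∂(q x) ≤ 1) : IsMarkovKernel (mhKernel q g) := by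
  refine ⟨fun x => ⟨?_⟩⟩
  rw [← lintegral_one, lintegral_mhKernel hg x (h := fun _ => 1) measurable_const]
  simp only [mul_one]
  exact add_tsub_cancel_of_le (hmass x)

/-- `dπ` and `dq` are densities of `π` and of `q` with respect to `μ`. -/
structure HasDensities (μ π : Measure E) (q : Kernel E E) (dπ : E → ℝ≥0) (dq : E → E → ℝ≥0) :
    Prop where
  measurable_target : Measurable dπ
  target_eq : π = μ.withDensity fun x => (dπ x : ℝ≥0∞)
  measurable_proposal : Measurable (Function.uncurry dq)
  proposal_eq : ∀ x, q x = μ.withDensity fun y => (dq x y : ℝ≥0∞)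

variable {μ π : Measure E} {dπ : E → ℝ≥0} {dq : E → E → ℝ≥0}

lemma lintegral_lintegral_density (hd : HasDensities μ π q dπ dq)
    {h : E → E → ℝ≥0∞} (hh : Measurable (Function.uncurry h)) :
    ∫⁻ x, ∫⁻ y, h x y ∂(q x) ∂π = ∫⁻ x, ∫⁻ y, dπ x * dq x y * h x y ∂μ ∂μ := by
  have hm : Measurable fun x => ∫⁻ y, h x y ∂(q x) := hh.lintegral_kernel_prod_right
  rw [hd.target_eq, lintegral_withDensity_eq_lintegral_mul _ hd.measurable_target.coe_nnreal_ennreal hm]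
  refine lintegral_congr fun x => ?_
  rw [Pi.mul_apply, hd.proposal_eq, lintegral_withDensity_eq_lintegral_mul _
    hd.measurable_proposal.of_uncurry_left.coe_nnreal_ennreal hh.of_uncurry_left,
    ← lintegral_const_mul' _ _ ENNReal.coe_ne_top]
  simp only [Pi.mul_apply, mul_assoc]

lemma lintegral_lintegral_flow (hd : HasDensities μ π q dπ dq)
    (hg : Measurable (Function.uncurry g)) {F : E → E → ℝ≥0∞}
    (hF : ∀ x y, dπ x * dq x y * g x y = F x y)
    {h : E → E → ℝ≥0∞} (hh : Measurable (Function.uncurry h)) :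
    ∫⁻ x, ∫⁻ y, g x y * h x y ∂(q x) ∂π = ∫⁻ x, ∫⁻ y, F x y * h x y ∂μ ∂μ := by
  rw [lintegral_lintegral_density hd (h := fun x y => g x y * h x y) (hg.mul hh)]
  simp only [← mul_assoc, hF]

/-- Rejected proposals stay on the diagonal, where `h` vanishes, so only the flow of accepted moves
counts. -/
lemma lintegral_compProd_mhKernel_of_diag [SFinite π] (hd : HasDensities μ π q dπ dq)
    (hg : Measurable (Function.uncurry g)) (hmass : ∀ x, ∫⁻ y, g x y ∂(q x) ≤ 1)
    {F : E → E → ℝ≥0∞} (hF : ∀ x y, dπ x * dq x y * g x y = F x y)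
    {h : E × E → ℝ≥0∞} (hh : Measurable h) (hdiag : ∀ x, h (x, x) = 0) :
    ∫⁻ p, h p ∂(π ⊗ₘ mhKernel q g) = ∫⁻ x, ∫⁻ y, F x y * h (x, y) ∂μ ∂μ := by
  have := isMarkovKernel_mhKernel hg hmass
  rw [Measure.lintegral_compProd hh,
    ← lintegral_lintegral_flow hd hg hF (h := fun x y => h (x, y)) hh]
  refine lintegral_congr fun x => ?_
  rw [lintegral_mhKernel hg x (h := fun y => h (x, y)) (hh.comp measurable_prodMk_left), hdiag, mul_zero, add_zero]

variable [SigmaFinite μ]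

lemma lintegral_lintegral_flow_swap {F : E → E → ℝ≥0∞} (hFm : Measurable (Function.uncurry F))
    (hsymm : ∀ x y, F x y = F y x) {h : E → E → ℝ≥0∞} (hh : Measurable (Function.uncurry h)) :
    ∫⁻ x, ∫⁻ y, F x y * h y x ∂μ ∂μ = ∫⁻ x, ∫⁻ y, F x y * h x y ∂μ ∂μ := by
  rw [lintegral_lintegral_swap ((hFm.mul (hh.comp measurable_swap)).aemeasurable)]
  simp only [hsymm]

variable [IsProbabilityMeasure π]

/-- Detailed balance: the joint law is the symmetric flow plus a measure on the diagonal, and the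
swap preserves both. -/
lemma map_swap_compProd_mhKernel (hd : HasDensities μ π q dπ dq)
    (hg : Measurable (Function.uncurry g)) (hmass : ∀ x, ∫⁻ y, g x y ∂(q x) ≤ 1)
    {F : E → E → ℝ≥0∞} (hFm : Measurable (Function.uncurry F))
    (hF : ∀ x y, dπ x * dq x y * g x y = F x y) (hsymm : ∀ x y, F x y = F y x) :
    (π ⊗ₘ mhKernel q g).map Prod.swap = π ⊗ₘ mhKernel q g := by
  have := isMarkovKernel_mhKernel hg hmass
  have key : ∀ h : E × E → ℝ≥0∞, Measurable h → ∫⁻ p, h p ∂(π ⊗ₘ mhKernel q g)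
      = ∫⁻ x, ∫⁻ y, F x y * h (x, y) ∂μ ∂μ
        + ∫⁻ x, (1 - ∫⁻ y, g x y ∂(q x)) * h (x, x) ∂π := fun h hh => by
    have hh' : Measurable (Function.uncurry fun x y => h (x, y)) := hh
    rw [Measure.lintegral_compProd hh, ← lintegral_lintegral_flow hd hg hF hh',
      ← lintegral_add_left (Measurable.lintegral_kernel_prod_right
        (f := fun x y => g x y * h (x, y)) (hg.mul hh'))]
    exact lintegral_congr fun x => lintegral_mhKernel hg x (hh.comp measurable_prodMk_left)
  refine Measure.ext_of_lintegral _ fun h hh => ?_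
  rw [lintegral_map hh measurable_swap, key h hh, key (fun p => h p.swap) (hh.comp measurable_swap)]
  congr 1
  exact lintegral_lintegral_flow_swap hFm hsymm (h := fun x y => h (x, y)) hh

end MetropolisHastings

/-! ### Empirical means of the weights -/

section Weights

/-- A positive measurable weight with finite mean under the proposal. -/
structure AdmissibleWeight (q : Kernel E E) (w : E → E → ℝ≥0) : Prop where
  measurable : Measurable (Function.uncurry w)
  pos : ∀ x y, 0 < w x y
  mean_ne_top : ∀ x, qwMean q w x ≠ ∞

variable {q : Kernel E E} {w : E → E → ℝ≥0} {n : ℕ} {α : Type*} [MeasurableSpace α]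

namespace AdmissibleWeight

lemma measurable_weight (hw : AdmissibleWeight q w) {a b : α → E} (ha : Measurable a)
    (hb : Measurable b) : Measurable fun z => (w (a z) (b z) : ℝ≥0∞) :=
  (hw.measurable.comp (ha.prodMk hb)).coe_nnreal_ennreal

lemma coe_ne_zero (hw : AdmissibleWeight q w) (x y : E) : (w x y : ℝ≥0∞) ≠ 0 :=
  ENNReal.coe_ne_zero.2 (hw.pos x y).ne'

lemma measurable_qwHatPinned (hw : AdmissibleWeight q w) {a b : α → E} (ha : Measurable a)
    (hb : Measurable b) {Y : α → Fin (n - 1) → E} (hY : Measurable Y) :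
    Measurable fun z => qwHatPinned w n (a z) (b z) (Y z) :=
  ((hw.measurable_weight ha hb).add (Finset.measurable_sum _ fun i _ =>
    hw.measurable_weight ha ((measurable_pi_apply i).comp hY))).div_const _

lemma measurable_qwHat (hw : AdmissibleWeight q w) {a : α → E} (ha : Measurable a)
    {Y : α → Fin n → E} (hY : Measurable Y) :
    Measurable fun z => qwHat w n (a z) (Y z) :=
  (Finset.measurable_sum _ fun i _ =>
    hw.measurable_weight ha ((measurable_pi_apply i).comp hY)).div_const _

lemma qwHatPinned_ne_zero (hw : AdmissibleWeight q w) (x y : E) (Y : Fin (n - 1) → E) :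
    qwHatPinned w n x y Y ≠ 0 := by
  rw [qwHatPinned, Ne, ENNReal.div_eq_zero_iff, not_or]
  exact ⟨fun h => hw.coe_ne_zero x y (add_eq_zero.1 h).1, ENNReal.natCast_ne_top n⟩

lemma sum_coe_ne_top {ι : Type*} (s : Finset ι) (v : ι → ℝ≥0) : ∑ i ∈ s, (v i : ℝ≥0∞) ≠ ∞ :=
  ENNReal.sum_ne_top.2 fun _ _ => ENNReal.coe_ne_top

lemma qwHatPinned_ne_top (hn : n ≠ 0) (x y : E) (Y : Fin (n - 1) → E) :
    qwHatPinned w n x y Y ≠ ∞ :=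
  ENNReal.div_ne_top (ENNReal.add_ne_top.2 ⟨ENNReal.coe_ne_top, sum_coe_ne_top _ _⟩)
    (by exact_mod_cast hn)

lemma measurable_qwMean [IsMarkovKernel q] (hw : AdmissibleWeight q w) :
    Measurable (qwMean q w) :=
  Measurable.lintegral_kernel_prod_right (hw.measurable.coe_nnreal_ennreal)

lemma qwMean_ne_zero [IsMarkovKernel q] (hw : AdmissibleWeight q w) (x : E) :
    qwMean q w x ≠ 0 := by
  intro h
  replace h := (lintegral_eq_zero_iff
    (hw.measurable_weight (a := fun _ => x) measurable_const measurable_id)).1 h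
  obtain ⟨y, hy⟩ := h.exists
  exact hw.coe_ne_zero x y hy

variable [IsMarkovKernel q]

lemma measurable_lintegral_inv_qwHatPinned (hw : AdmissibleWeight q w) {a b : α → E}
    (ha : Measurable a) (hb : Measurable b) :
    Measurable fun z => ∫⁻ Y, (qwHatPinned w n (a z) (b z) Y)⁻¹
      ∂(Measure.pi fun _ : Fin (n - 1) => q (a z)) :=
  measurable_lintegral_trials q (n - 1) ha
    (F := fun z Y => (qwHatPinned w n (a z) (b z) Y)⁻¹)
    (hw.measurable_qwHatPinned (ha.comp measurable_fst) (hb.comp measurable_fst)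
      measurable_snd).inv

lemma measurable_qwTilde (hw : AdmissibleWeight q w) {a b : α → E}
    (ha : Measurable a) (hb : Measurable b) :
    Measurable fun z => qwTilde q w n (a z) (b z) :=
  (hw.measurable_lintegral_inv_qwHatPinned ha hb).inv

lemma inv_qwTilde (x y : E) : (qwTilde q w n x y)⁻¹
    = ∫⁻ Y, (qwHatPinned w n x y Y)⁻¹ ∂(Measure.pi fun _ : Fin (n - 1) => q x) :=
  inv_inv _

/-- The pinned weight alone bounds the reciprocal of the empirical mean by `n / w x y`. -/
lemma qwTilde_ne_zero (hw : AdmissibleWeight q w) (x y : E) : qwTilde q w n x y ≠ 0 := by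
  rw [qwTilde, ENNReal.inv_ne_zero]
  refine ne_top_of_le_ne_top (b := (n : ℝ≥0∞) / w x y)
    (ENNReal.div_ne_top (ENNReal.natCast_ne_top n) (hw.coe_ne_zero x y)) ?_
  refine (lintegral_mono (g := fun _ => (n : ℝ≥0∞) / w x y) fun Y => ?_).trans_eq (by simp)
  rw [qwHatPinned, ENNReal.inv_div (Or.inl (ENNReal.natCast_ne_top n))
    (Or.inr fun h => hw.coe_ne_zero x y (add_eq_zero.1 h).1)]
  exact ENNReal.div_le_div_left le_self_add _

lemma qwTilde_ne_top (hw : AdmissibleWeight q w) (hn : n ≠ 0) (x y : E) :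
    qwTilde q w n x y ≠ ∞ := by
  rw [qwTilde, ENNReal.inv_ne_top]
  intro h
  replace h := (lintegral_eq_zero_iff (hw.measurable_qwHatPinned (a := fun _ => x)
    (b := fun _ => y) measurable_const measurable_const measurable_id).inv).1 h
  obtain ⟨Y, hY⟩ := h.exists
  exact ENNReal.inv_ne_zero.2 (qwHatPinned_ne_top hn x y Y) hY

lemma lintegral_qwTilde_div_qwHatPinned (hw : AdmissibleWeight q w) (hn : n ≠ 0) (x y : E) :
    ∫⁻ Y, qwTilde q w n x y / qwHatPinned w n x y Y ∂(Measure.pi fun _ : Fin (n - 1) => q x)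
      = 1 := by
  simp only [div_eq_mul_inv]
  rw [lintegral_const_mul' _ _ (hw.qwTilde_ne_top hn x y), ← inv_qwTilde,
    ENNReal.mul_inv_cancel (hw.qwTilde_ne_zero x y) (hw.qwTilde_ne_top hn x y)]

lemma qwHat_insertNth {m : ℕ} (i : Fin (m + 1)) (x y : E) (Y : Fin m → E) :
    qwHat w (m + 1) x (i.insertNth y Y) = qwHatPinned w (m + 1) x y Y := by
  rw [qwHat, qwHatPinned, Fin.sum_univ_succAbove _ i]
  simp

lemma qwHat_ne_zero (hw : AdmissibleWeight q w) (hn : n ≠ 0) (x : E) (Y : Fin n → E) :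
    qwHat w n x Y ≠ 0 := by
  rw [qwHat, Ne, ENNReal.div_eq_zero_iff, not_or]
  refine ⟨fun h => ?_, ENNReal.natCast_ne_top n⟩
  exact hw.coe_ne_zero x _ (Finset.sum_eq_zero_iff.1 h ⟨0, Nat.pos_of_ne_zero hn⟩
    (Finset.mem_univ _))

lemma qwHat_ne_top (hn : n ≠ 0) (x : E) (Y : Fin n → E) : qwHat w n x Y ≠ ∞ :=
  ENNReal.div_ne_top (sum_coe_ne_top _ _) (by exact_mod_cast hn)

/-- The selection probabilities of the `n` trials sum to one, and by exchangeability each index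
contributes the same amount. Hence importance resampling has an effective proposal of total mass
one. -/
lemma lintegral_weight_div_qwHatPinned (hw : AdmissibleWeight q w) (hn : n ≠ 0) (x : E) :
    ∫⁻ y, ∫⁻ Y, w x y / qwHatPinned w n x y Y ∂(Measure.pi fun _ : Fin (n - 1) => q x) ∂(q x)
      = 1 := by
  obtain ⟨m, rfl⟩ := Nat.exists_eq_succ_of_ne_zero hn
  have hm0 : ((m + 1 : ℕ) : ℝ≥0∞) ≠ 0 := by simp
  have hmt : ((m + 1 : ℕ) : ℝ≥0∞) ≠ ∞ := ENNReal.natCast_ne_top _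
  have hmeas : ∀ i : Fin (m + 1),
      Measurable fun Y : Fin (m + 1) → E => (w x (Y i) : ℝ≥0∞) / qwHat w (m + 1) x Y := fun i =>
    (hw.measurable_weight measurable_const (measurable_pi_apply i)).div
      (hw.measurable_qwHat measurable_const measurable_id)
  have h1 : ∀ i : Fin (m + 1), ∫⁻ Y, (w x (Y i) : ℝ≥0∞) / qwHat w (m + 1) x Y
      ∂(Measure.pi fun _ : Fin (m + 1) => q x)
      = ∫⁻ y, ∫⁻ Y, w x y / qwHatPinned w (m + 1) x y Y
        ∂(Measure.pi fun _ : Fin m => q x) ∂(q x) := fun i => by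
    rw [lintegral_pi_insertNth (q x) i (hmeas i)]
    simp only [Fin.insertNth_apply_same, qwHat_insertNth]
  have h2 : ∑ i : Fin (m + 1), ∫⁻ Y, (w x (Y i) : ℝ≥0∞) / qwHat w (m + 1) x Y
      ∂(Measure.pi fun _ : Fin (m + 1) => q x) = (m + 1 : ℕ) := by
    rw [← lintegral_finsetSum _ fun i _ => hmeas i]
    have : ∀ Y : Fin (m + 1) → E, ∑ i, (w x (Y i) : ℝ≥0∞) / qwHat w (m + 1) x Y
        = (m + 1 : ℕ) := fun Y => by
      have hmul : ((m + 1 : ℕ) : ℝ≥0∞) * qwHat w (m + 1) x Y = ∑ i, (w x (Y i) : ℝ≥0∞) :=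
        ENNReal.mul_div_cancel hm0 hmt
      simp only [div_eq_mul_inv]
      rw [← Finset.sum_mul, ← hmul, mul_assoc, ENNReal.mul_inv_cancel
        (hw.qwHat_ne_zero hn x Y) (qwHat_ne_top hn x Y), mul_one]
    simp [this]
  simp only [h1, Finset.sum_const, Finset.card_univ, Fintype.card_fin, nsmul_eq_mul] at h2
  exact (ENNReal.mul_right_inj hm0 hmt).1 (by rw [mul_one]; exact h2)

lemma lintegral_weight_div_qwTilde (hw : AdmissibleWeight q w) (hn : n ≠ 0) (x : E) :
    ∫⁻ y, w x y / qwTilde q w n x y ∂(q x) = 1 := by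
  rw [← hw.lintegral_weight_div_qwHatPinned hn x]
  refine lintegral_congr fun y => ?_
  simp only [div_eq_mul_inv]
  rw [lintegral_const_mul' _ _ ENNReal.coe_ne_top, ← inv_qwTilde]

lemma lintegral_weight_div_qwMean (hw : AdmissibleWeight q w) (x : E) :
    ∫⁻ y, w x y / qwMean q w x ∂(q x) = 1 := by
  simp only [div_eq_mul_inv]
  rw [lintegral_mul_const' _ _ (ENNReal.inv_ne_top.2 (hw.qwMean_ne_zero x))]
  exact ENNReal.mul_inv_cancel (hw.qwMean_ne_zero x) (hw.mean_ne_top x)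

end AdmissibleWeight

end Weights

/-! ### Flows of the three kernels -/

section Flows

/-- The algebra of every acceptance ratio here: proposal density times acceptance probability is a
minimum in which the roles of `(A, c)` and `(B, d)` are interchangeable. When `A = 0` the ratio
degenerates but both sides vanish. -/
lemma div_mul_min_one {A B c d : ℝ≥0∞} (hA : A ≠ ∞) (hc : c ≠ 0) (hc' : c ≠ ∞) :
    A / c * min 1 (B * c / (A * d)) = min (A / c) (B / d) := by
  rcases eq_or_ne A 0 with rfl | hA0
  · simp
  rw [mul_min, mul_one]
  congr 1
  rw [ENNReal.div_eq_inv_mul (b := A * d), ENNReal.mul_inv (Or.inl hA0) (Or.inl hA)]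
  simp only [div_eq_mul_inv]
  calc A * c⁻¹ * (A⁻¹ * d⁻¹ * (B * c)) = (A * A⁻¹) * (c * c⁻¹) * (B * d⁻¹) := by ring
    _ = B * d⁻¹ := by
      rw [ENNReal.mul_inv_cancel hA0 hA, ENNReal.mul_inv_cancel hc hc', one_mul, one_mul]

/-- The density `π(x) q(x, y) w(x, y)`. -/
def weightedFlow (dπ : E → ℝ≥0) (dq w : E → E → ℝ≥0) (x y : E) : ℝ≥0∞ :=
  (dπ x : ℝ≥0∞) * dq x y * w x y

/-- The density of accepted moves of the ideal chain at stationarity. -/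
def idealFlow (dπ : E → ℝ≥0) (dq : E → E → ℝ≥0) (q : Kernel E E) (w : E → E → ℝ≥0) (x y : E) :
    ℝ≥0∞ :=
  min (weightedFlow dπ dq w x y / qwMean q w x) (weightedFlow dπ dq w y x / qwMean q w y)

/-- The density of accepted moves of the semi-ideal chain at stationarity. -/
def semiIdealFlow (dπ : E → ℝ≥0) (dq : E → E → ℝ≥0) (q : Kernel E E) (w : E → E → ℝ≥0) (n : ℕ)
    (x y : E) : ℝ≥0∞ :=
  min (weightedFlow dπ dq w x y / qwTilde q w n x y)
    (weightedFlow dπ dq w y x / qwTilde q w n y x)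

/-- The density of accepted moves of the Multiple-try chain at stationarity. -/
def mtmFlow (dπ : E → ℝ≥0) (dq : E → E → ℝ≥0) (q : Kernel E E) (w : E → E → ℝ≥0) (n : ℕ)
    (x y : E) : ℝ≥0∞ :=
  ∫⁻ Y, ∫⁻ Z, min (weightedFlow dπ dq w x y / qwHatPinned w n x y Y)
      (weightedFlow dπ dq w y x / qwHatPinned w n y x Z)
    ∂(Measure.pi fun _ : Fin (n - 1) => q y) ∂(Measure.pi fun _ : Fin (n - 1) => q x)

/-- The density of accepted moves of the Multiple-try chain relative to `q x`. -/
def mtmDensity (dπ : E → ℝ≥0) (dq : E → E → ℝ≥0) (q : Kernel E E) (w : E → E → ℝ≥0) (n : ℕ)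
    (x y : E) : ℝ≥0∞ :=
  ∫⁻ Y, ∫⁻ Z, w x y / qwHatPinned w n x y Y *
      min 1 ((weightedFlow dπ dq w y x * qwHatPinned w n x y Y) /
        (weightedFlow dπ dq w x y * qwHatPinned w n y x Z))
    ∂(Measure.pi fun _ : Fin (n - 1) => q y) ∂(Measure.pi fun _ : Fin (n - 1) => q x)

variable {μ π : Measure E} {q : Kernel E E} [IsMarkovKernel q] {dπ : E → ℝ≥0}
  {dq w : E → E → ℝ≥0} {n : ℕ}

lemma weightedFlow_ne_top (x y : E) : weightedFlow dπ dq w x y ≠ ∞ :=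
  ENNReal.mul_ne_top (ENNReal.mul_ne_top ENNReal.coe_ne_top ENNReal.coe_ne_top) ENNReal.coe_ne_top

lemma measurable_weightedFlow (hd : HasDensities μ π q dπ dq) (hw : AdmissibleWeight q w)
    {α : Type*} [MeasurableSpace α] {a b : α → E} (ha : Measurable a) (hb : Measurable b) :
    Measurable fun z => weightedFlow dπ dq w (a z) (b z) :=
  ((hd.measurable_target.comp ha).coe_nnreal_ennreal.mul
    (hd.measurable_proposal.comp (ha.prodMk hb)).coe_nnreal_ennreal).mul
    (hw.measurable_weight ha hb)

lemma idealFlow_symm (x y : E) : idealFlow dπ dq q w x y = idealFlow dπ dq q w y x :=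
  min_comm _ _

lemma semiIdealFlow_symm (x y : E) :
    semiIdealFlow dπ dq q w n x y = semiIdealFlow dπ dq q w n y x :=
  min_comm _ _

lemma mtmFlow_symm (hw : AdmissibleWeight q w) (x y : E) :
    mtmFlow dπ dq q w n x y = mtmFlow dπ dq q w n y x := by
  rw [mtmFlow, mtmFlow, lintegral_lintegral_swap]
  · simp only [min_comm]
  · exact ((measurable_const.div (hw.measurable_qwHatPinned measurable_const measurable_const
      measurable_fst)).min (measurable_const.div (hw.measurable_qwHatPinned measurable_const
      measurable_const measurable_snd))).aemeasurable

lemma measurable_idealFlow (hd : HasDensities μ π q dπ dq) (hw : AdmissibleWeight q w) :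
    Measurable (Function.uncurry (idealFlow dπ dq q w)) :=
  ((measurable_weightedFlow hd hw measurable_fst measurable_snd).div
    (hw.measurable_qwMean.comp measurable_fst)).min
    ((measurable_weightedFlow hd hw measurable_snd measurable_fst).div
    (hw.measurable_qwMean.comp measurable_snd))

lemma measurable_semiIdealFlow (hd : HasDensities μ π q dπ dq) (hw : AdmissibleWeight q w) :
    Measurable (Function.uncurry (semiIdealFlow dπ dq q w n)) :=
  ((measurable_weightedFlow hd hw measurable_fst measurable_snd).div
    (hw.measurable_qwTilde measurable_fst measurable_snd)).min
    ((measurable_weightedFlow hd hw measurable_snd measurable_fst).div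
    (hw.measurable_qwTilde measurable_snd measurable_fst))

lemma measurable_lintegral_pinned {G : E × E → ℝ≥0∞ → ℝ≥0∞ → ℝ≥0∞}
    (hG : Measurable fun r : (E × E) × ℝ≥0∞ × ℝ≥0∞ => G r.1 r.2.1 r.2.2)
    (hw : AdmissibleWeight q w) :
    Measurable fun p : E × E => ∫⁻ Y, ∫⁻ Z,
      G p (qwHatPinned w n p.1 p.2 Y) (qwHatPinned w n p.2 p.1 Z)
      ∂(Measure.pi fun _ : Fin (n - 1) => q p.2) ∂(Measure.pi fun _ : Fin (n - 1) => q p.1) := by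
  refine measurable_lintegral_trials q (n - 1) measurable_fst (F := fun p Y => ∫⁻ Z,
      G p (qwHatPinned w n p.1 p.2 Y) (qwHatPinned w n p.2 p.1 Z)
      ∂(Measure.pi fun _ : Fin (n - 1) => q p.2)) ?_
  refine measurable_lintegral_trials q (n - 1) (b := fun r : (E × E) × (Fin (n - 1) → E) => r.1.2)
    (by fun_prop)
    (F := fun r Z => G r.1 (qwHatPinned w n r.1.1 r.1.2 r.2) (qwHatPinned w n r.1.2 r.1.1 Z)) ?_
  exact hG.comp (Measurable.prodMk (by fun_prop) (Measurable.prodMk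
    (hw.measurable_qwHatPinned (by fun_prop) (by fun_prop) (by fun_prop))
    (hw.measurable_qwHatPinned (by fun_prop) (by fun_prop) (by fun_prop))))

lemma measurable_mtmFlow (hd : HasDensities μ π q dπ dq) (hw : AdmissibleWeight q w) :
    Measurable (Function.uncurry (mtmFlow dπ dq q w n)) := by
  refine measurable_lintegral_pinned (G := fun p u v => min (weightedFlow dπ dq w p.1 p.2 / u)
    (weightedFlow dπ dq w p.2 p.1 / v)) ?_ hw
  exact ((measurable_weightedFlow hd hw (by fun_prop) (by fun_prop)).div (by fun_prop)).min
    ((measurable_weightedFlow hd hw (by fun_prop) (by fun_prop)).div (by fun_prop))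

lemma measurable_mtmDensity (hd : HasDensities μ π q dπ dq) (hw : AdmissibleWeight q w) :
    Measurable (Function.uncurry (mtmDensity dπ dq q w n)) := by
  refine measurable_lintegral_pinned (G := fun p u v => w p.1 p.2 / u *
      min 1 ((weightedFlow dπ dq w p.2 p.1 * u) / (weightedFlow dπ dq w p.1 p.2 * v))) ?_ hw
  have h1 := measurable_weightedFlow hd hw (α := (E × E) × ℝ≥0∞ × ℝ≥0∞)
    (a := fun r => r.1.1) (b := fun r => r.1.2) (by fun_prop) (by fun_prop)
  have h2 := measurable_weightedFlow hd hw (α := (E × E) × ℝ≥0∞ × ℝ≥0∞)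
    (a := fun r => r.1.2) (b := fun r => r.1.1) (by fun_prop) (by fun_prop)
  exact ((hw.measurable_weight (by fun_prop) (by fun_prop)).div (by fun_prop)).mul
    (measurable_const.min ((h2.mul (by fun_prop)).div (h1.mul (by fun_prop))))

lemma mul_mtmDensity (hw : AdmissibleWeight q w) (hn : n ≠ 0) (x y : E) :
    dπ x * dq x y * mtmDensity dπ dq q w n x y = mtmFlow dπ dq q w n x y := by
  have hfin : (dπ x : ℝ≥0∞) * dq x y ≠ ∞ :=
    ENNReal.mul_ne_top ENNReal.coe_ne_top ENNReal.coe_ne_top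
  rw [mtmDensity, mtmFlow, ← lintegral_const_mul' _ _ hfin]
  refine lintegral_congr fun Y => ?_
  rw [← lintegral_const_mul' _ _ hfin]
  refine lintegral_congr fun Z => ?_
  rw [← mul_assoc, ← mul_div_assoc]
  exact div_mul_min_one (weightedFlow_ne_top x y) (hw.qwHatPinned_ne_zero x y Y)
    (AdmissibleWeight.qwHatPinned_ne_top hn x y Y)

lemma mtmDensity_le (x y : E) : mtmDensity dπ dq q w n x y
    ≤ ∫⁻ Y, w x y / qwHatPinned w n x y Y ∂(Measure.pi fun _ : Fin (n - 1) => q x) := by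
  refine lintegral_mono fun Y => (lintegral_mono (g := fun _ => w x y / qwHatPinned w n x y Y)
    fun Z => ?_).trans_eq (by simp)
  exact mul_le_of_le_one_right' (min_le_left _ _)

lemma lintegral_mtmDensity_le_one (hw : AdmissibleWeight q w) (hn : n ≠ 0) (x : E) :
    ∫⁻ y, mtmDensity dπ dq q w n x y ∂(q x) ≤ 1 :=
  (lintegral_mono fun y => mtmDensity_le x y).trans_eq (hw.lintegral_weight_div_qwHatPinned hn x)

/-- The trials being i.i.d., each selected index contributes the same measure, `1 / n` times the one
with the pinned density; the sum over indices cancels `1 / n`. -/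
lemma mtmMove_eq_withDensity (hd : HasDensities μ π q dπ dq) (hw : AdmissibleWeight q w)
    (hn : n ≠ 0) (x : E) :
    mtmMove dπ dq q w n x = (q x).withDensity (mtmDensity dπ dq q w n x) := by
  obtain ⟨m, rfl⟩ := Nat.exists_eq_succ_of_ne_zero hn
  have hm0 : ((m + 1 : ℕ) : ℝ≥0∞) ≠ 0 := by simp
  have hmt : ((m + 1 : ℕ) : ℝ≥0∞) ≠ ∞ := ENNReal.natCast_ne_top _
  let A : E → ℝ≥0∞ → ℝ≥0∞ := fun y u => ∫⁻ Z, min 1 ((weightedFlow dπ dq w y x * u) /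
    (weightedFlow dπ dq w x y * qwHatPinned w (m + 1) y x Z))
    ∂(Measure.pi fun _ : Fin m => q y)
  have hinner : ∀ (i : Fin (m + 1)) (Y : Fin (m + 1) → E),
      ∫⁻ Z, mtmAccept dπ dq w (m + 1) x (Y i) Y (Function.update Z i x)
        ∂(Measure.pi fun _ : Fin (m + 1) => q (Y i)) = A (Y i) (qwHat w (m + 1) x Y) := by
    intro i Y
    have hmeas : Measurable fun Z : Fin (m + 1) → E =>
        mtmAccept dπ dq w (m + 1) x (Y i) Y (Function.update Z i x) :=
      measurable_const.min (measurable_const.div (measurable_const.mul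
        (hw.measurable_qwHat measurable_const (by fun_prop))))
    rw [lintegral_pi_insertNth (q (Y i)) i hmeas]
    -- The draw in slot `i` of the balancing trials is overwritten by `x`, so it integrates out.
    have hupd : ∀ (z : E) (Z : Fin m → E),
        Function.update (i.insertNth z Z : Fin (m + 1) → E) i x = i.insertNth x Z := by
      intro z Z
      simp
    simp only [hupd, mtmAccept, AdmissibleWeight.qwHat_insertNth, lintegral_const, measure_univ,
      mul_one]
    rfl
  have hA : Measurable fun r : E × ℝ≥0∞ => A r.1 r.2 := by
    refine measurable_lintegral_trials q m measurable_fst (F := fun r Z =>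
      min 1 ((weightedFlow dπ dq w r.1 x * r.2) /
        (weightedFlow dπ dq w x r.1 * qwHatPinned w (m + 1) r.1 x Z))) ?_
    have h1 := measurable_weightedFlow hd hw (α := (E × ℝ≥0∞) × (Fin m → E))
      (a := fun r => r.1.1) (b := fun _ => x) (by fun_prop) (by fun_prop)
    have h2 := measurable_weightedFlow hd hw (α := (E × ℝ≥0∞) × (Fin m → E))
      (a := fun _ => x) (b := fun r => r.1.1) (by fun_prop) (by fun_prop)
    exact measurable_const.min ((h1.mul (by fun_prop)).div (h2.mul
      (hw.measurable_qwHatPinned (by fun_prop) (by fun_prop) measurable_snd)))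
  ext s hs
  have hterm : ∀ i : Fin (m + 1), Measure.map (fun Y : Fin (m + 1) → E => Y i)
      ((Measure.pi fun _ : Fin (m + 1) => q x).withDensity fun Y =>
        (w x (Y i) : ℝ≥0∞) / ((m + 1 : ℕ) * qwHat w (m + 1) x Y) *
          ∫⁻ Z, mtmAccept dπ dq w (m + 1) x (Y i) Y (Function.update Z i x)
            ∂(Measure.pi fun _ : Fin (m + 1) => q (Y i))) s
      = ((m + 1 : ℕ) : ℝ≥0∞)⁻¹ * (q x).withDensity (mtmDensity dπ dq q w (m + 1) x) s := by
    intro i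
    have hsi : MeasurableSet ((fun Y : Fin (m + 1) → E => Y i) ⁻¹' s) := measurable_pi_apply i hs
    rw [Measure.map_apply (measurable_pi_apply i) hs, withDensity_apply _ hsi,
      withDensity_apply _ hs, ← lintegral_indicator hsi, ← lintegral_indicator hs]
    simp only [hinner]
    have hqH : Measurable fun Y : Fin (m + 1) → E => qwHat w (m + 1) x Y :=
      hw.measurable_qwHat measurable_const measurable_id
    have hm1 : Measurable fun Y : Fin (m + 1) → E =>
        (w x (Y i) : ℝ≥0∞) / ((m + 1 : ℕ) * qwHat w (m + 1) x Y)
          * A (Y i) (qwHat w (m + 1) x Y) :=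
      ((hw.measurable_weight measurable_const (measurable_pi_apply i)).div
        (measurable_const.mul hqH)).mul (hA.comp ((measurable_pi_apply i).prodMk hqH))
    rw [lintegral_pi_insertNth (q x) i (hm1.indicator hsi),
      ← lintegral_const_mul' _ _ (ENNReal.inv_ne_top.2 hm0)]
    refine lintegral_congr fun y => ?_
    by_cases hy : y ∈ s
    · rw [Set.indicator_of_mem hy, mtmDensity, ← lintegral_const_mul' _ _ (ENNReal.inv_ne_top.2 hm0)]
      refine lintegral_congr fun Y => ?_
      have hmem : (i.insertNth y Y : Fin (m + 1) → E) ∈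
          (fun Y : Fin (m + 1) → E => Y i) ⁻¹' s := by simpa using hy
      rw [Set.indicator_of_mem hmem, Fin.insertNth_apply_same, AdmissibleWeight.qwHat_insertNth]
      refine Eq.trans ?_ (congrArg _ (lintegral_const_mul' _ _ (ENNReal.div_ne_top
        ENNReal.coe_ne_top (hw.qwHatPinned_ne_zero (n := m + 1) x y Y))).symm)
      rw [← mul_assoc]
      congr 1
      simp only [div_eq_mul_inv]
      rw [ENNReal.mul_inv (Or.inl hm0) (Or.inl hmt)]
      ring
    · have hmem : ∀ Y : Fin m → E, (i.insertNth y Y : Fin (m + 1) → E) ∉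
          (fun Y : Fin (m + 1) → E => Y i) ⁻¹' s := by
        intro Y; simpa using hy
      simp [Set.indicator_of_notMem hy, Set.indicator_of_notMem (hmem _)]
  rw [mtmMove, Measure.finsetSum_apply, Finset.sum_congr rfl fun i _ => hterm i]
  rw [Finset.sum_const, Finset.card_univ, Fintype.card_fin, nsmul_eq_mul, ← mul_assoc,
    ENNReal.mul_inv_cancel hm0 hmt, one_mul]

lemma mtmKernel_eq_mhKernel (hd : HasDensities μ π q dπ dq) (hw : AdmissibleWeight q w)
    (hn : n ≠ 0) : mtmKernel dπ dq q w n = mhKernel q (mtmDensity dπ dq q w n) :=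
  acceptReject_eq_mhKernel (measurable_mtmDensity hd hw) (mtmMove_eq_withDensity hd hw hn)

/-- The density of accepted moves of the ideal chain relative to `q x`. -/
def idealDensity (dπ : E → ℝ≥0) (dq : E → E → ℝ≥0) (q : Kernel E E) (w : E → E → ℝ≥0)
    (x y : E) : ℝ≥0∞ :=
  w x y / qwMean q w x * idealAccept dπ dq q w x y

/-- The density of accepted moves of the semi-ideal chain relative to `q x`. -/
def semiIdealDensity (dπ : E → ℝ≥0) (dq : E → E → ℝ≥0) (q : Kernel E E) (w : E → E → ℝ≥0) (n : ℕ)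
    (x y : E) : ℝ≥0∞ :=
  w x y / qwTilde q w n x y * semiIdealAccept dπ dq q w n x y

lemma measurable_idealAccept (hd : HasDensities μ π q dπ dq) (hw : AdmissibleWeight q w) :
    Measurable (Function.uncurry (idealAccept dπ dq q w)) :=
  measurable_const.min (((measurable_weightedFlow hd hw measurable_snd measurable_fst).mul
    (hw.measurable_qwMean.comp measurable_fst)).div
    ((measurable_weightedFlow hd hw measurable_fst measurable_snd).mul
    (hw.measurable_qwMean.comp measurable_snd)))

lemma measurable_semiIdealAccept (hd : HasDensities μ π q dπ dq) (hw : AdmissibleWeight q w) :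
    Measurable (Function.uncurry (semiIdealAccept dπ dq q w n)) :=
  measurable_const.min (((measurable_weightedFlow hd hw measurable_snd measurable_fst).mul
    (hw.measurable_qwTilde measurable_fst measurable_snd)).div
    ((measurable_weightedFlow hd hw measurable_fst measurable_snd).mul
    (hw.measurable_qwTilde measurable_snd measurable_fst)))

lemma measurable_idealDensity (hd : HasDensities μ π q dπ dq) (hw : AdmissibleWeight q w) :
    Measurable (Function.uncurry (idealDensity dπ dq q w)) :=
  ((hw.measurable_weight measurable_fst measurable_snd).div
    (hw.measurable_qwMean.comp measurable_fst)).mul (measurable_idealAccept hd hw)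

lemma measurable_semiIdealDensity (hd : HasDensities μ π q dπ dq) (hw : AdmissibleWeight q w) :
    Measurable (Function.uncurry (semiIdealDensity dπ dq q w n)) :=
  ((hw.measurable_weight measurable_fst measurable_snd).div
    (hw.measurable_qwTilde measurable_fst measurable_snd)).mul (measurable_semiIdealAccept hd hw)

lemma mul_idealDensity (hw : AdmissibleWeight q w) (x y : E) :
    dπ x * dq x y * idealDensity dπ dq q w x y = idealFlow dπ dq q w x y := by
  rw [idealDensity, ← mul_assoc, ← mul_div_assoc]
  exact div_mul_min_one (weightedFlow_ne_top x y) (hw.qwMean_ne_zero x) (hw.mean_ne_top x)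

lemma mul_semiIdealDensity (hw : AdmissibleWeight q w) (hn : n ≠ 0) (x y : E) :
    dπ x * dq x y * semiIdealDensity dπ dq q w n x y = semiIdealFlow dπ dq q w n x y := by
  rw [semiIdealDensity, ← mul_assoc, ← mul_div_assoc]
  exact div_mul_min_one (weightedFlow_ne_top x y) (hw.qwTilde_ne_zero x y)
    (hw.qwTilde_ne_top hn x y)

lemma lintegral_idealDensity_le_one (hw : AdmissibleWeight q w) (x : E) :
    ∫⁻ y, idealDensity dπ dq q w x y ∂(q x) ≤ 1 :=
  (lintegral_mono fun _ => mul_le_of_le_one_right' (min_le_left _ _)).trans_eq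
    (hw.lintegral_weight_div_qwMean x)

lemma lintegral_semiIdealDensity_le_one (hw : AdmissibleWeight q w) (hn : n ≠ 0) (x : E) :
    ∫⁻ y, semiIdealDensity dπ dq q w n x y ∂(q x) ≤ 1 :=
  (lintegral_mono fun _ => mul_le_of_le_one_right' (min_le_left _ _)).trans_eq
    (hw.lintegral_weight_div_qwTilde hn x)

lemma idealKernel_eq_mhKernel (hd : HasDensities μ π q dπ dq) (hw : AdmissibleWeight q w) :
    idealKernel dπ dq q w = mhKernel q (idealDensity dπ dq q w) := by
  refine acceptReject_eq_mhKernel (measurable_idealDensity hd hw) fun x => ?_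
  exact (withDensity_mul _ ((hw.measurable_weight measurable_const measurable_id).div_const _)
    (measurable_idealAccept hd hw).of_uncurry_left).symm

lemma semiIdealKernel_eq_mhKernel (hd : HasDensities μ π q dπ dq) (hw : AdmissibleWeight q w) :
    semiIdealKernel dπ dq q w n = mhKernel q (semiIdealDensity dπ dq q w n) := by
  refine acceptReject_eq_mhKernel (measurable_semiIdealDensity hd hw) fun x => ?_
  exact (withDensity_mul _ ((hw.measurable_weight measurable_const measurable_id).div
    (hw.measurable_qwTilde measurable_const measurable_id))
    (measurable_semiIdealAccept hd hw).of_uncurry_left).symm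

end Flows

/-! ### Energies and oscillation -/

section Energy

/-- `½ ∬ F(x, y) (f(x) - f(y))² μ(dx) μ(dy)`. -/
def flowEnergy (μ : Measure E) (F : E → E → ℝ≥0∞) (f : E → ℝ) : ℝ≥0∞ :=
  2⁻¹ * ∫⁻ x, ∫⁻ y, F x y * ENNReal.ofReal ((f x - f y) ^ 2) ∂μ ∂μ

lemma measurable_ofReal_sq_sub {f : E → ℝ} (hf : Measurable f) :
    Measurable fun p : E × E => ENNReal.ofReal ((f p.1 - f p.2) ^ 2) := by
  fun_prop

lemma ofReal_dirichletForm_mhKernel {μ π : Measure E} [SigmaFinite μ] [IsProbabilityMeasure π]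
    {q : Kernel E E} [IsMarkovKernel q] {dπ : E → ℝ≥0} {dq : E → E → ℝ≥0}
    (hd : HasDensities μ π q dπ dq) {g : E → E → ℝ≥0∞} (hg : Measurable (Function.uncurry g))
    (hmass : ∀ x, ∫⁻ y, g x y ∂(q x) ≤ 1) {F : E → E → ℝ≥0∞}
    (hFm : Measurable (Function.uncurry F)) (hF : ∀ x y, dπ x * dq x y * g x y = F x y)
    (hsymm : ∀ x y, F x y = F y x) {f f' : E → ℝ} (hf : MemLp f 2 π) (hf' : Measurable f')
    (hff' : f =ᵐ[π] f') :
    ENNReal.ofReal (dirichletForm π (mhKernel q g) f) = flowEnergy μ F f' := by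
  have := isMarkovKernel_mhKernel hg hmass
  have hrev := map_swap_compProd_mhKernel hd hg hmass hFm hF hsymm
  rw [dirichletForm_congr hrev hf hff', ofReal_dirichletForm hrev (hf.ae_eq hff'), flowEnergy,
    lintegral_compProd_mhKernel_of_diag hd hg hmass hF (measurable_ofReal_sq_sub hf') (by simp)]

lemma oscNorm_congr {π : Measure E} {f g : E → ℝ} (hfg : f =ᵐ[π] g) :
    oscNorm π f = oscNorm π g := by
  have h : (fun x => (f x : EReal)) =ᵐ[π] fun x => (g x : EReal) := by
    filter_upwards [hfg] with x hx
    rw [hx]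
  rw [oscNorm, oscNorm, essSup_congr_ae h, essInf_congr_ae h]

lemma ofReal_sub_le_oscNorm {π : Measure E} {f : E → ℝ} {x y : E}
    (hx : (f x : EReal) ≤ essSup (fun x => (f x : EReal)) π)
    (hy : essInf (fun x => (f x : EReal)) π ≤ (f y : EReal)) :
    ENNReal.ofReal (f x - f y) ≤ oscNorm π f := by
  have h : ((f x - f y : ℝ) : EReal) ≤ essSup (fun x => (f x : EReal)) π
      - essInf (fun x => (f x : EReal)) π := by
    rw [EReal.coe_sub]
    exact EReal.sub_le_sub hx hy
  exact EReal.toENNReal_le_toENNReal h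

/-- One `π`-conull set serves both variables, so the bound can later be used under `μ ⊗ μ`, one
variable at a time. -/
lemma ae_ofReal_sq_sub_le (π : Measure E) (f : E → ℝ) :
    ∃ s : Set E, (∀ᵐ x ∂π, x ∈ s) ∧
      ∀ x ∈ s, ∀ y ∈ s, ENNReal.ofReal ((f x - f y) ^ 2) ≤ oscNorm π f ^ 2 := by
  refine ⟨{x | (f x : EReal) ≤ essSup (fun x => (f x : EReal)) π ∧
    essInf (fun x => (f x : EReal)) π ≤ (f x : EReal)}, ?_, ?_⟩
  · filter_upwards [ae_le_essSup (μ := π) (f := fun x => (f x : EReal)),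
      ae_essInf_le (μ := π) (f := fun x => (f x : EReal))] with x h1 h2 using ⟨h1, h2⟩
  · rintro x ⟨hx1, hx2⟩ y ⟨hy1, hy2⟩
    rcases le_total (f y) (f x) with h | h
    · rw [ENNReal.ofReal_pow (sub_nonneg.2 h)]
      exact pow_le_pow_left' (ofReal_sub_le_oscNorm hx1 hy2) 2
    · rw [← neg_sub, neg_sq, ENNReal.ofReal_pow (sub_nonneg.2 h)]
      exact pow_le_pow_left' (ofReal_sub_le_oscNorm hy1 hx2) 2

lemma oscNorm_ne_top {π : Measure E} [IsProbabilityMeasure π] {f : E → ℝ} {a b : ℝ}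
    (hf : ∀ x, f x ∈ Set.Icc a b) : oscNorm π f ≠ ∞ := by
  have h1 : essSup (fun x => (f x : EReal)) π ≤ (b : EReal) :=
    essSup_le_of_ae_le _ (ae_of_all _ fun x => EReal.coe_le_coe_iff.2 (hf x).2)
  have h2 : (a : EReal) ≤ essInf (fun x => (f x : EReal)) π :=
    le_essInf_of_ae_le _ (ae_of_all _ fun x => EReal.coe_le_coe_iff.2 (hf x).1)
  have h3 : oscNorm π f ≤ ENNReal.ofReal (b - a) :=
    EReal.toENNReal_le_toENNReal (y := ((b - a : ℝ) : EReal)) (EReal.sub_le_sub h1 h2)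
  exact ne_top_of_le_ne_top ENNReal.ofReal_ne_top h3

/-- Flows that are controlled up to an exceptional flow `G` have energies that are controlled up
to the mass of `G` times the squared oscillation. -/
lemma flowEnergy_le_add {μ π : Measure E} [SFinite μ] {dπ : E → ℝ≥0} (hdπ : Measurable dπ)
    (hπ : π = μ.withDensity fun x => (dπ x : ℝ≥0∞)) {F F' G : E → E → ℝ≥0∞} {c : ℝ≥0∞}
    (hF' : Measurable (Function.uncurry F'))
    (hG : Measurable (Function.uncurry G)) (hle : ∀ x y, F x y ≤ c * F' x y + G x y)
    (hG0 : ∀ x y, G x y ≠ 0 → dπ x ≠ 0 ∧ dπ y ≠ 0) {f : E → ℝ} (hf : Measurable f) :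
    flowEnergy μ F f ≤ c * flowEnergy μ F' f
      + 2⁻¹ * (∫⁻ x, ∫⁻ y, G x y ∂μ ∂μ) * oscNorm π f ^ 2 := by
  have hD := measurable_ofReal_sq_sub hf
  obtain ⟨s, hs, hosc⟩ := ae_ofReal_sq_sub_le π f
  -- A `π`-null set may be large for `μ` where `dπ` vanishes; `hG0` ensures that the exceptional
  -- flow does not charge such points.
  have hs' : ∀ᵐ x ∂μ, dπ x ≠ 0 → x ∈ s := by
    rw [hπ, ae_withDensity_iff hdπ.coe_nnreal_ennreal] at hs
    filter_upwards [hs] with x hx h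
    exact hx (by simpa using h)
  have hGle : ∫⁻ x, ∫⁻ y, G x y * ENNReal.ofReal ((f x - f y) ^ 2) ∂μ ∂μ
      ≤ (∫⁻ x, ∫⁻ y, G x y ∂μ ∂μ) * oscNorm π f ^ 2 := by
    rw [← lintegral_mul_const _ hG.lintegral_prod_right]
    refine lintegral_mono_ae ?_
    filter_upwards [hs'] with x hx
    rw [← lintegral_mul_const _ hG.of_uncurry_left]
    refine lintegral_mono_ae ?_
    filter_upwards [hs'] with y hy
    rcases eq_or_ne (G x y) 0 with h | h
    · simp [h]
    · gcongr
      exact hosc x (hx (hG0 x y h).1) y (hy (hG0 x y h).2)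
  have hm : Measurable (Function.uncurry fun x y =>
      c * F' x y * ENNReal.ofReal ((f x - f y) ^ 2)) := (hF'.const_mul c).mul hD
  calc flowEnergy μ F f
      ≤ 2⁻¹ * ∫⁻ x, ∫⁻ y, (c * F' x y * ENNReal.ofReal ((f x - f y) ^ 2)
          + G x y * ENNReal.ofReal ((f x - f y) ^ 2)) ∂μ ∂μ := by
        unfold flowEnergy
        gcongr with x y
        rw [← add_mul]
        gcongr
        exact hle x y
    _ = 2⁻¹ * (∫⁻ x, ∫⁻ y, c * F' x y * ENNReal.ofReal ((f x - f y) ^ 2) ∂μ ∂μ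
          + ∫⁻ x, ∫⁻ y, G x y * ENNReal.ofReal ((f x - f y) ^ 2) ∂μ ∂μ) := by
        rw [← lintegral_add_left hm.lintegral_prod_right]
        congr 1
        exact lintegral_congr fun x => lintegral_add_left hm.of_uncurry_left _
    _ ≤ 2⁻¹ * (c * ∫⁻ x, ∫⁻ y, F' x y * ENNReal.ofReal ((f x - f y) ^ 2) ∂μ ∂μ
          + (∫⁻ x, ∫⁻ y, G x y ∂μ ∂μ) * oscNorm π f ^ 2) := by
        have h : ∀ x, ∫⁻ y, c * F' x y * ENNReal.ofReal ((f x - f y) ^ 2) ∂μ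
            = c * ∫⁻ y, F' x y * ENNReal.ofReal ((f x - f y) ^ 2) ∂μ := fun x => by
          simp only [mul_assoc]
          exact lintegral_const_mul c
            (f := fun y => F' x y * ENNReal.ofReal ((f x - f y) ^ 2))
            (hF'.of_uncurry_left.mul (by fun_prop))
        simp only [h]
        rw [lintegral_const_mul c (f := fun x => ∫⁻ y, F' x y
          * ENNReal.ofReal ((f x - f y) ^ 2) ∂μ) (hF'.mul hD).lintegral_prod_right]
        gcongr
    _ = _ := by
        unfold flowEnergy
        ring

/-- Truncation of a real function at height `k`. -/
def truncate (f : E → ℝ) (k : ℕ) (x : E) : ℝ := max (min k (f x)) (-(k : ℝ))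

lemma truncate_mem (f : E → ℝ) (k : ℕ) (x : E) : truncate f k x ∈ Set.Icc (-(k : ℝ)) k :=
  ⟨le_max_right _ _, max_le (min_le_left _ _) (by linarith [k.cast_nonneg (α := ℝ)])⟩

lemma measurable_truncate {f : E → ℝ} (hf : Measurable f) (k : ℕ) :
    Measurable (truncate f k) :=
  (measurable_const.min hf).max measurable_const

lemma sq_truncate_sub_le (f : E → ℝ) (k : ℕ) (x y : E) :
    (truncate f k x - truncate f k y) ^ 2 ≤ (f x - f y) ^ 2 := by
  refine sq_le_sq.2 ?_
  exact (abs_max_sub_max_le_abs _ _ _).trans (by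
    simpa using abs_min_sub_min_le_max (k : ℝ) (f x) k (f y))

lemma eventually_truncate_eq (f : E → ℝ) (x : E) : ∀ᶠ k in atTop, truncate f k x = f x := by
  obtain ⟨K, hK⟩ := exists_nat_ge |f x|
  filter_upwards [eventually_ge_atTop K] with k hk
  have h : |f x| ≤ k := hK.trans (by exact_mod_cast hk)
  rw [truncate, min_eq_right (abs_le.1 h).2, max_eq_left (abs_le.1 h).1]

lemma flowEnergy_truncate_le (μ : Measure E) (F : E → E → ℝ≥0∞) (f : E → ℝ) (k : ℕ) :
    flowEnergy μ F (truncate f k) ≤ flowEnergy μ F f := by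
  unfold flowEnergy
  gcongr _ * ∫⁻ x, ∫⁻ y, _ * ENNReal.ofReal ?_ ∂_ ∂_
  exact sq_truncate_sub_le f k _ _

/-- Fatou in each variable, since the truncations are eventually equal to `f` at every point. It
recovers unbounded functions from bounded ones. -/
lemma flowEnergy_le_liminf_truncate {μ : Measure E} [SFinite μ] {F : E → E → ℝ≥0∞}
    (hF : Measurable (Function.uncurry F)) {f : E → ℝ} (hf : Measurable f) :
    flowEnergy μ F f ≤ liminf (fun k => flowEnergy μ F (truncate f k)) atTop := by
  have hm : ∀ k, Measurable (Function.uncurry fun x y =>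
      F x y * ENNReal.ofReal ((truncate f k x - truncate f k y) ^ 2)) := fun k =>
    hF.mul (measurable_ofReal_sq_sub (measurable_truncate hf k))
  simp only [flowEnergy]
  rw [ENNReal.liminf_const_mul_of_ne_zero_of_ne_top (by simp) (by simp)]
  gcongr
  refine le_trans (lintegral_mono fun x => ?_)
    (lintegral_liminf_le fun k => (hm k).lintegral_prod_right)
  refine le_trans (lintegral_mono fun y => ?_) (lintegral_liminf_le fun k => (hm k).of_uncurry_left)
  refine le_of_eq (Tendsto.liminf_eq ?_).symm
  refine tendsto_const_nhds.congr' ?_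
  filter_upwards [eventually_truncate_eq f x, eventually_truncate_eq f y] with k hx hy
  rw [hx, hy]

end Energy

/-! ### Comparison of the flows -/

section Comparison

variable {μ π : Measure E} {q : Kernel E E} [IsMarkovKernel q] {dπ : E → ℝ≥0}
  {dq w : E → E → ℝ≥0} {n : ℕ}

lemma weightedFlow_eq_zero {x : E} (hx : dπ x = 0) (y : E) : weightedFlow dπ dq w x y = 0 := by
  simp [weightedFlow, hx]

lemma ne_zero_of_idealFlow_ne_zero {x y : E} (h : idealFlow dπ dq q w x y ≠ 0) :
    dπ x ≠ 0 ∧ dπ y ≠ 0 :=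
  ⟨fun hx => h (by simp [idealFlow, weightedFlow_eq_zero hx]),
    fun hy => h (by simp [idealFlow, weightedFlow_eq_zero hy])⟩

lemma ne_zero_of_semiIdealFlow_ne_zero {x y : E} (h : semiIdealFlow dπ dq q w n x y ≠ 0) :
    dπ x ≠ 0 ∧ dπ y ≠ 0 :=
  ⟨fun hx => h (by simp [semiIdealFlow, weightedFlow_eq_zero hx]),
    fun hy => h (by simp [semiIdealFlow, weightedFlow_eq_zero hy])⟩

/-- Dividing all weights by the constant `qwMean q w x` scales the empirical mean. The event in
`betaOne` thus compares the ideal and the resampled proposal densities. -/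
lemma lintegral_div_sum_impWeight (hw : AdmissibleWeight q w) (hn : n ≠ 0) (x y : E) :
    ∫⁻ Y, (n : ℝ≥0∞) / (impWeight q w x y + ∑ i, impWeight q w x (Y i))
        ∂(Measure.pi fun _ : Fin (n - 1) => q x) = qwMean q w x / qwTilde q w n x y := by
  have hn0 : (n : ℝ≥0∞) ≠ 0 := by exact_mod_cast hn
  rw [div_eq_mul_inv (qwMean q w x), AdmissibleWeight.inv_qwTilde,
    ← lintegral_const_mul' _ _ (hw.mean_ne_top x)]
  refine lintegral_congr fun Y => ?_
  have h : impWeight q w x y + ∑ i, impWeight q w x (Y i)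
      = (w x y + ∑ i, (w x (Y i) : ℝ≥0∞)) * (qwMean q w x)⁻¹ := by
    simp only [impWeight, div_eq_mul_inv]
    rw [add_mul, Finset.sum_mul]
  have h0 : (w x y : ℝ≥0∞) + ∑ i, (w x (Y i) : ℝ≥0∞) ≠ 0 := fun h =>
    hw.coe_ne_zero x y (add_eq_zero.1 h).1
  rw [h, qwHatPinned, ENNReal.inv_div (Or.inl (ENNReal.natCast_ne_top n)) (Or.inr h0),
    div_eq_mul_inv, ENNReal.mul_inv (Or.inl h0) (Or.inr (ENNReal.inv_ne_zero.2 (hw.mean_ne_top x))),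
    inv_inv, div_eq_mul_inv]
  ring

/-- The pairs at which the resampled proposal is too small. -/
def resampledSmall (q : Kernel E E) (w : E → E → ℝ≥0) (n : ℕ) (s : ℝ) (x : E) : Set E :=
  {y | qwMean q w x / qwTilde q w n x y < ENNReal.ofReal (1 / s)}

lemma betaOne_eq (hw : AdmissibleWeight q w) (hn : n ≠ 0) (s : ℝ) :
    betaOne π q w n s = ∫⁻ x, weightedProposal q w x (resampledSmall q w n s x) ∂π := by
  simp only [betaOne, lintegral_div_sum_impWeight hw hn, resampledSmall]

lemma measurableSet_resampledSmall (hw : AdmissibleWeight q w) (s : ℝ) :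
    MeasurableSet {p : E × E | p.2 ∈ resampledSmall q w n s p.1} :=
  measurableSet_lt ((hw.measurable_qwMean.comp measurable_fst).div
    (hw.measurable_qwTilde measurable_fst measurable_snd)) measurable_const

lemma measurable_zeta (hw : AdmissibleWeight q w) :
    Measurable (Function.uncurry (zeta q w n)) := by
  refine measurable_lintegral_pinned (G := fun p u v => min (qwTilde q w n p.1 p.2 / u)
    (qwTilde q w n p.2 p.1 / v)) ?_ hw
  exact ((hw.measurable_qwTilde (by fun_prop) (by fun_prop)).div (by fun_prop)).min
    ((hw.measurable_qwTilde (by fun_prop) (by fun_prop)).div (by fun_prop))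

lemma measurableSet_zeta_lt (hw : AdmissibleWeight q w) (s : ℝ) :
    MeasurableSet {p : E × E | zeta q w n p.1 p.2 < ENNReal.ofReal (1 / s)} :=
  measurableSet_lt (measurable_zeta hw) measurable_const

lemma le_ofReal_mul_of_inv_le {s : ℝ} (hs : 0 < s) {a b : ℝ≥0∞}
    (h : ENNReal.ofReal (1 / s) * a ≤ b) : a ≤ ENNReal.ofReal s * b := by
  calc a = ENNReal.ofReal s * (ENNReal.ofReal (1 / s) * a) := by
        rw [← mul_assoc, ← ENNReal.ofReal_mul hs.le, mul_one_div_cancel hs.ne', ENNReal.ofReal_one,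
          one_mul]
    _ ≤ _ := by gcongr

open Classical in
-- Both flows are minima over the two directions, so the comparison holds as soon as the normalisers
-- compare in both. The two exceptional flows are transposes of each other.
lemma idealFlow_le_add (hw : AdmissibleWeight q w) {s : ℝ} (hs : 0 < s) (x y : E) :
    idealFlow dπ dq q w x y ≤ ENNReal.ofReal s * semiIdealFlow dπ dq q w n x y
      + ((if y ∈ resampledSmall q w n s x then idealFlow dπ dq q w x y else 0)
        + if x ∈ resampledSmall q w n s y then idealFlow dπ dq q w y x else 0) := by
  by_cases hx : y ∈ resampledSmall q w n s x
  · rw [if_pos hx]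
    exact le_add_left le_self_add
  by_cases hy : x ∈ resampledSmall q w n s y
  · rw [if_pos hy, idealFlow_symm x y]
    exact le_add_left (le_add_left le_rfl)
  rw [if_neg hx, if_neg hy, add_zero, add_zero]
  have key : ∀ {x y : E} {a : ℝ≥0∞}, y ∉ resampledSmall q w n s x →
      a / qwMean q w x ≤ ENNReal.ofReal s * (a / qwTilde q w n x y) := by
    intro x y a h
    refine le_ofReal_mul_of_inv_le hs ?_
    calc ENNReal.ofReal (1 / s) * (a / qwMean q w x)
        ≤ qwMean q w x / qwTilde q w n x y * (a / qwMean q w x) := by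
          gcongr
          exact not_lt.1 h
      _ = a / qwTilde q w n x y * (qwMean q w x * (qwMean q w x)⁻¹) := by
          simp only [div_eq_mul_inv]; ring
      _ = a / qwTilde q w n x y := by
          rw [ENNReal.mul_inv_cancel (hw.qwMean_ne_zero x) (hw.mean_ne_top x), mul_one]
  rw [idealFlow, semiIdealFlow, mul_min]
  exact min_le_min (key hx) (key hy)

/-- A product of two minima is at most the minimum of the matching products, in which `qwTilde`
cancels and leaves the Multiple-try integrand. -/
lemma zeta_mul_semiIdealFlow_le (hw : AdmissibleWeight q w) (hn : n ≠ 0) (x y : E) :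
    zeta q w n x y * semiIdealFlow dπ dq q w n x y ≤ mtmFlow dπ dq q w n x y := by
  have hfin : semiIdealFlow dπ dq q w n x y ≠ ∞ := ne_top_of_le_ne_top
    (ENNReal.div_ne_top (weightedFlow_ne_top x y) (hw.qwTilde_ne_zero x y)) (min_le_left _ _)
  rw [zeta, mtmFlow, ← lintegral_mul_const' _ _ hfin]
  refine lintegral_mono fun Y => ?_
  rw [← lintegral_mul_const' _ _ hfin]
  refine lintegral_mono fun Z => ?_
  have key : ∀ {a T H : ℝ≥0∞}, T ≠ 0 → T ≠ ∞ → T / H * (a / T) = a / H := by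
    intro a T H h0 h1
    calc T / H * (a / T) = a / H * (T * T⁻¹) := by simp only [div_eq_mul_inv]; ring
      _ = a / H := by rw [ENNReal.mul_inv_cancel h0 h1, mul_one]
  refine le_min ?_ ?_
  · exact (mul_le_mul' (min_le_left _ _) (min_le_left _ _)).trans_eq
      (key (hw.qwTilde_ne_zero x y) (hw.qwTilde_ne_top hn x y))
  · exact (mul_le_mul' (min_le_right _ _) (min_le_right _ _)).trans_eq
      (key (hw.qwTilde_ne_zero y x) (hw.qwTilde_ne_top hn y x))

open Classical in
lemma semiIdealFlow_le_add (hw : AdmissibleWeight q w) (hn : n ≠ 0) {s : ℝ} (hs : 0 < s)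
    (x y : E) : semiIdealFlow dπ dq q w n x y ≤ ENNReal.ofReal s * mtmFlow dπ dq q w n x y
      + if zeta q w n x y < ENNReal.ofReal (1 / s) then semiIdealFlow dπ dq q w n x y else 0 := by
  split_ifs with h
  · exact le_add_left le_rfl
  · rw [add_zero]
    refine le_ofReal_mul_of_inv_le hs ((mul_le_mul_left (not_lt.1 h) _).trans ?_)
    exact zeta_mul_semiIdealFlow_le hw hn x y

open Classical in
-- Accepted moves are at most proposed moves, and the proposal of the ideal chain is
-- `weightedProposal`.
lemma lintegral_idealFlow_resampledSmall_le (hd : HasDensities μ π q dπ dq)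
    (hw : AdmissibleWeight q w) (hn : n ≠ 0) (s : ℝ) :
    ∫⁻ x, ∫⁻ y, (if y ∈ resampledSmall q w n s x then idealFlow dπ dq q w x y else 0) ∂μ ∂μ
      ≤ betaOne π q w n s := by
  have hset := measurableSet_resampledSmall (n := n) hw s
  have hm : Measurable (Function.uncurry fun x y =>
      if y ∈ resampledSmall q w n s x then (1 : ℝ≥0∞) else 0) :=
    Measurable.ite hset measurable_const measurable_const
  rw [betaOne_eq hw hn]
  calc _ = ∫⁻ x, ∫⁻ y, idealFlow dπ dq q w x y
        * (if y ∈ resampledSmall q w n s x then (1 : ℝ≥0∞) else 0) ∂μ ∂μ := by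
        simp only [mul_ite, mul_one, mul_zero]
    _ = ∫⁻ x, ∫⁻ y, idealDensity dπ dq q w x y
        * (if y ∈ resampledSmall q w n s x then (1 : ℝ≥0∞) else 0) ∂(q x) ∂π :=
        (lintegral_lintegral_flow hd (measurable_idealDensity hd hw) (mul_idealDensity hw) hm).symm
    _ ≤ _ := by
        refine lintegral_mono fun x => ?_
        have hx : MeasurableSet (resampledSmall q w n s x) := measurable_prodMk_left hset
        rw [weightedProposal, withDensity_apply _ hx, ← lintegral_indicator hx]
        refine lintegral_mono fun y => ?_
        by_cases h : y ∈ resampledSmall q w n s x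
        · rw [Set.indicator_of_mem h, if_pos h, mul_one]
          exact mul_le_of_le_one_right' (min_le_left _ _)
        · rw [if_neg h, mul_zero]; exact zero_le

open Classical in
lemma lintegral_semiIdealFlow_zeta_le (hd : HasDensities μ π q dπ dq)
    (hw : AdmissibleWeight q w) (hn : n ≠ 0) (s : ℝ) :
    ∫⁻ x, ∫⁻ y, (if zeta q w n x y < ENNReal.ofReal (1 / s) then semiIdealFlow dπ dq q w n x y
      else 0) ∂μ ∂μ ≤ betaTwo π dπ dq q w n s := by
  have hset := measurableSet_zeta_lt (n := n) hw s
  have hm : Measurable (Function.uncurry fun x y =>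
      if zeta q w n x y < ENNReal.ofReal (1 / s) then (1 : ℝ≥0∞) else 0) :=
    Measurable.ite hset measurable_const measurable_const
  calc _ = ∫⁻ x, ∫⁻ y, semiIdealFlow dπ dq q w n x y
        * (if zeta q w n x y < ENNReal.ofReal (1 / s) then (1 : ℝ≥0∞) else 0) ∂μ ∂μ := by
        simp only [mul_ite, mul_one, mul_zero]
    _ = ∫⁻ x, ∫⁻ y, semiIdealDensity dπ dq q w n x y
        * (if zeta q w n x y < ENNReal.ofReal (1 / s) then (1 : ℝ≥0∞) else 0) ∂(q x) ∂π :=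
        (lintegral_lintegral_flow hd (measurable_semiIdealDensity hd hw)
          (mul_semiIdealDensity hw hn) hm).symm
    _ ≤ _ := by
        refine lintegral_mono fun x => ?_
        have hx : MeasurableSet {y | zeta q w n x y < ENNReal.ofReal (1 / s)} :=
          measurable_prodMk_left hset
        rw [semiIdealKernel_eq_mhKernel hd hw, ← lintegral_indicator_one hx,
          lintegral_mhKernel (measurable_semiIdealDensity hd hw) x (measurable_one.indicator hx)]
        refine le_add_right (le_of_eq (lintegral_congr fun y => ?_))
        simp [Set.indicator_apply]

/-! ### From flow inequalities to energy inequalities -/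

variable [SigmaFinite μ] [IsProbabilityMeasure π]

open Classical in
lemma flowEnergy_ideal_le_semiIdeal (hd : HasDensities μ π q dπ dq) (hw : AdmissibleWeight q w)
    (hn : n ≠ 0) {s : ℝ} (hs : 0 < s) {f : E → ℝ} (hf : Measurable f) :
    flowEnergy μ (idealFlow dπ dq q w) f
      ≤ ENNReal.ofReal s * flowEnergy μ (semiIdealFlow dπ dq q w n) f
        + betaOne π q w n s * oscNorm π f ^ 2 := by
  let G : E → E → ℝ≥0∞ := fun x y =>
    if y ∈ resampledSmall q w n s x then idealFlow dπ dq q w x y else 0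
  have hG : Measurable (Function.uncurry G) :=
    Measurable.ite (measurableSet_resampledSmall hw s) (measurable_idealFlow hd hw)
      measurable_const
  have hG0 : ∀ x y, G x y ≠ 0 → dπ x ≠ 0 ∧ dπ y ≠ 0 := fun x y h =>
    ne_zero_of_idealFlow_ne_zero (q := q) (dq := dq) (w := w) fun h0 => h (by simp [G, h0])
  refine (flowEnergy_le_add hd.measurable_target hd.target_eq
    (measurable_semiIdealFlow (n := n) hd hw) (G := fun x y => G x y + G y x)
    (hG.add (hG.comp measurable_swap)) (idealFlow_le_add hw hs) ?_ hf).trans ?_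
  · intro x y h
    by_cases h1 : G x y = 0
    · exact (hG0 y x fun h2 => h (by simp [h1, h2])).symm
    · exact hG0 x y h1
  · gcongr
    -- The transposed exceptional flows have equal mass, so the factor one half of the energy
    -- cancels exactly.
    have hsum : ∫⁻ x, ∫⁻ y, (G x y + G y x) ∂μ ∂μ = 2 * ∫⁻ x, ∫⁻ y, G x y ∂μ ∂μ := by
      have h1 : ∫⁻ x, ∫⁻ y, G y x ∂μ ∂μ = ∫⁻ x, ∫⁻ y, G x y ∂μ ∂μ :=
        lintegral_lintegral_swap (hG.comp measurable_swap).aemeasurable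
      rw [two_mul]
      nth_rewrite 2 [← h1]
      rw [← lintegral_add_left hG.lintegral_prod_right]
      exact lintegral_congr fun x => lintegral_add_left hG.of_uncurry_left _
    rw [hsum, ← mul_assoc, ENNReal.inv_mul_cancel two_ne_zero ENNReal.ofNat_ne_top, one_mul]
    exact lintegral_idealFlow_resampledSmall_le hd hw hn s

open Classical in
lemma flowEnergy_semiIdeal_le_mtm (hd : HasDensities μ π q dπ dq) (hw : AdmissibleWeight q w)
    (hn : n ≠ 0) {s : ℝ} (hs : 0 < s) {f : E → ℝ} (hf : Measurable f) :
    flowEnergy μ (semiIdealFlow dπ dq q w n) f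
      ≤ ENNReal.ofReal s * flowEnergy μ (mtmFlow dπ dq q w n) f
        + betaTwo π dπ dq q w n s * oscNorm π f ^ 2 := by
  refine (flowEnergy_le_add hd.measurable_target hd.target_eq (measurable_mtmFlow (n := n) hd hw)
    (G := fun x y =>
      if zeta q w n x y < ENNReal.ofReal (1 / s) then semiIdealFlow dπ dq q w n x y else 0)
    (Measurable.ite (measurableSet_zeta_lt hw s) (measurable_semiIdealFlow hd hw)
      measurable_const) (semiIdealFlow_le_add hw hn hs) ?_ hf).trans ?_
  · intro x y h
    exact ne_zero_of_semiIdealFlow_ne_zero (q := q) (dq := dq) (w := w) (n := n)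
      fun h0 => h (by simp [h0])
  · gcongr
    -- There is a single exceptional flow here, and the factor one half is given away.
    refine le_trans (mul_le_of_le_one_left' (ENNReal.inv_le_one.2 one_le_two)) ?_
    exact lintegral_semiIdealFlow_zeta_le hd hw hn s

lemma flowEnergy_ideal_le_mtm_of_mul (hd : HasDensities μ π q dπ dq) (hw : AdmissibleWeight q w)
    (hn : n ≠ 0) {s₁ s₂ : ℝ} (hs₁ : 0 < s₁) (hs₂ : 0 < s₂) {f : E → ℝ} (hf : Measurable f) :
    flowEnergy μ (idealFlow dπ dq q w) f
      ≤ ENNReal.ofReal (s₁ * s₂) * flowEnergy μ (mtmFlow dπ dq q w n) f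
        + (betaOne π q w n s₁ + ENNReal.ofReal s₁ * betaTwo π dπ dq q w n s₂)
          * oscNorm π f ^ 2 := by
  calc _ ≤ ENNReal.ofReal s₁ * (ENNReal.ofReal s₂ * flowEnergy μ (mtmFlow dπ dq q w n) f
        + betaTwo π dπ dq q w n s₂ * oscNorm π f ^ 2) + betaOne π q w n s₁ * oscNorm π f ^ 2 :=
        (flowEnergy_ideal_le_semiIdeal hd hw hn hs₁ hf).trans (by
          gcongr
          exact flowEnergy_semiIdeal_le_mtm hd hw hn hs₂ hf)
    _ = _ := by
        rw [ENNReal.ofReal_mul hs₁.le]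
        ring

lemma flowEnergy_ideal_le_mtm_of_oscNorm_ne_top (hd : HasDensities μ π q dπ dq)
    (hw : AdmissibleWeight q w) (hn : n ≠ 0) {s : ℝ} (hs : 0 < s) {f : E → ℝ}
    (hf : Measurable f) (hosc : oscNorm π f ≠ ∞) :
    flowEnergy μ (idealFlow dπ dq q w) f
      ≤ ENNReal.ofReal s * flowEnergy μ (mtmFlow dπ dq q w n) f
        + chainedBeta π dπ dq q w n s * oscNorm π f ^ 2 := by
  have hmul : ∀ s₁ s₂ : ℝ, 0 < s₁ → 0 < s₂ → s₁ * s₂ = s →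
      flowEnergy μ (idealFlow dπ dq q w) f
        ≤ ENNReal.ofReal s * flowEnergy μ (mtmFlow dπ dq q w n) f
          + (betaOne π q w n s₁ + ENNReal.ofReal s₁ * betaTwo π dπ dq q w n s₂)
            * oscNorm π f ^ 2 := by
    rintro s₁ s₂ h₁ h₂ rfl
    exact flowEnergy_ideal_le_mtm_of_mul hd hw hn h₁ h₂ hf
  -- The infimum is reached by dividing by the squared oscillation; if that is zero, any single
  -- splitting of `s` suffices.
  rcases eq_or_ne (oscNorm π f) 0 with h0 | h0
  · simpa [h0] using hmul s 1 hs one_pos (mul_one s)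
  · rw [← tsub_le_iff_left]
    refine (ENNReal.div_le_iff_le_mul (Or.inl (pow_ne_zero 2 h0))
      (Or.inl (ENNReal.pow_ne_top hosc))).1 ?_
    refine le_iInf fun s₁ => le_iInf fun s₂ => le_iInf fun h₁ => le_iInf fun h₂ =>
      le_iInf fun h => ?_
    exact ENNReal.div_le_of_le_mul (tsub_le_iff_left.2 (hmul s₁ s₂ h₁ h₂ h))

/-- With infinite oscillation the bound is trivial unless `chainedBeta` is zero. In that case `0 * ∞
= 0` and a bound without remainder is needed: it holds for the truncations, whose energies do not
exceed that of `f`, and passes to the limit. -/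
lemma flowEnergy_ideal_le_mtm (hd : HasDensities μ π q dπ dq)
    (hw : AdmissibleWeight q w) (hn : n ≠ 0) {s : ℝ} (hs : 0 < s) {f : E → ℝ}
    (hf : Measurable f) :
    flowEnergy μ (idealFlow dπ dq q w) f
      ≤ ENNReal.ofReal s * flowEnergy μ (mtmFlow dπ dq q w n) f
        + chainedBeta π dπ dq q w n s * oscNorm π f ^ 2 := by
  by_cases hosc : oscNorm π f = ∞
  · by_cases hβ : chainedBeta π dπ dq q w n s = 0
    · rw [hβ, zero_mul, add_zero]
      refine (flowEnergy_le_liminf_truncate (measurable_idealFlow hd hw) hf).trans ?_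
      refine (liminf_le_liminf (Eventually.of_forall fun k => ?_)).trans_eq (liminf_const _)
      have h := flowEnergy_ideal_le_mtm_of_oscNorm_ne_top (n := n) hd hw hn hs
        (measurable_truncate hf k) (oscNorm_ne_top (π := π) (truncate_mem f k))
      rw [hβ, zero_mul, add_zero] at h
      exact h.trans (by gcongr; exact flowEnergy_truncate_le _ _ _ _)
    · rw [hosc, ENNReal.top_pow two_ne_zero, ENNReal.mul_top hβ]
      simp
  · exact flowEnergy_ideal_le_mtm_of_oscNorm_ne_top hd hw hn hs hf hosc

/-- The comparison inequality between the ideal and the Multiple-try chains. -/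
theorem dirichletForm_ideal_le_mtm (hd : HasDensities μ π q dπ dq)
    (hw : AdmissibleWeight q w) (hn : n ≠ 0) {f : E → ℝ} (hf : MemLp f 2 π) {s : ℝ}
    (hs : 0 < s) :
    ENNReal.ofReal (dirichletForm π (idealKernel dπ dq q w) f)
      ≤ ENNReal.ofReal (s * dirichletForm π (mtmKernel dπ dq q w n) f)
        + chainedBeta π dπ dq q w n s * oscNorm π f ^ 2 := by
  -- Dirichlet forms and oscillation depend only on the almost everywhere class, so a measurable
  -- representative may be used.
  obtain ⟨f', hf', hff'⟩ := hf.aestronglyMeasurable.aemeasurable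
  rw [ENNReal.ofReal_mul hs.le, idealKernel_eq_mhKernel hd hw, mtmKernel_eq_mhKernel hd hw hn,
    ofReal_dirichletForm_mhKernel hd (measurable_idealDensity hd hw)
      (lintegral_idealDensity_le_one hw) (measurable_idealFlow hd hw) (mul_idealDensity hw)
      idealFlow_symm hf hf' hff',
    ofReal_dirichletForm_mhKernel hd (measurable_mtmDensity hd hw)
      (lintegral_mtmDensity_le_one hw hn) (measurable_mtmFlow hd hw) (mul_mtmDensity hw hn)
      (mtmFlow_symm hw) hf hf' hff', oscNorm_congr hff']
  exact flowEnergy_ideal_le_mtm hd hw hn hs hf'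

end Comparison

/-! ### Large numbers of trials -/

section Limits

variable {μ π : Measure E} {q : Kernel E E} [IsMarkovKernel q] {dπ : E → ℝ≥0}
  {dq w : E → E → ℝ≥0} {n : ℕ}

lemma tendsto_lintegral_inv_qwHatPinned_tsub (hw : AdmissibleWeight q w) (x y : E) {c : ℝ≥0}
    (hc : (c : ℝ≥0∞) < qwMean q w x) :
    Tendsto (fun n : ℕ => ∫⁻ Y, ((qwHatPinned w n x y Y)⁻¹ - (c : ℝ≥0∞)⁻¹)
      ∂(Measure.pi fun _ : Fin (n - 1) => q x)) atTop (𝓝 0) :=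
  tendsto_lintegral_inv_mean_tsub (q x) (v := w x) hw.measurable.of_uncurry_left (hw.pos x y) hc

lemma qwTilde_le (hw : AdmissibleWeight q w) (hn : n ≠ 0) (x y : E) :
    qwTilde q w n x y ≤ w x y / n + qwMean q w x := by
  have hn0 : (n : ℝ≥0∞) ≠ 0 := by exact_mod_cast hn
  have hm : ∀ i : Fin (n - 1), Measurable fun Y : Fin (n - 1) → E => (w x (Y i) : ℝ≥0∞) :=
    fun i => hw.measurable_weight measurable_const (measurable_pi_apply i)
  have hi : ∀ i : Fin (n - 1), ∫⁻ Y, (w x (Y i) : ℝ≥0∞)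
      ∂(Measure.pi fun _ : Fin (n - 1) => q x) = qwMean q w x := fun i =>
    lintegral_pi_eval (q x) i (f := fun y => (w x y : ℝ≥0∞))
      (hw.measurable_weight measurable_const measurable_id)
  calc qwTilde q w n x y
      ≤ ∫⁻ Y, qwHatPinned w n x y Y ∂(Measure.pi fun _ : Fin (n - 1) => q x) :=
        inv_lintegral_inv_le (hw.measurable_qwHatPinned measurable_const measurable_const
          measurable_id) (hw.qwHatPinned_ne_zero x y) (AdmissibleWeight.qwHatPinned_ne_top hn x y)
    _ = (w x y + (n - 1 : ℕ) * qwMean q w x) / n := by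
        simp only [qwHatPinned, div_eq_mul_inv]
        rw [lintegral_mul_const' _ _ (ENNReal.inv_ne_top.2 hn0),
          lintegral_add_left measurable_const, lintegral_finsetSum _ fun i _ => hm i]
        simp [hi]
    _ ≤ (w x y + n * qwMean q w x) / n := by
        gcongr
        exact Nat.sub_le _ _
    _ = w x y / n + qwMean q w x := by
        rw [ENNReal.add_div, mul_comm, ENNReal.mul_div_cancel_right hn0 (ENNReal.natCast_ne_top n)]

lemma inv_qwTilde_le (x y : E) (c : ℝ≥0∞) :
    (qwTilde q w n x y)⁻¹ ≤ c⁻¹ + ∫⁻ Y, ((qwHatPinned w n x y Y)⁻¹ - c⁻¹)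
      ∂(Measure.pi fun _ : Fin (n - 1) => q x) := by
  rw [AdmissibleWeight.inv_qwTilde]
  calc _ ≤ ∫⁻ Y, (c⁻¹ + ((qwHatPinned w n x y Y)⁻¹ - c⁻¹))
        ∂(Measure.pi fun _ : Fin (n - 1) => q x) := lintegral_mono fun Y => le_add_tsub
    _ = _ := by rw [lintegral_add_left measurable_const]; simp

/-- The lower bound uses the Chernoff estimate at each level `c` below the mean; the upper bound is
the harmonic–arithmetic inequality, with the pinned weight contributing only `w x y / n`. -/
lemma tendsto_qwTilde (hw : AdmissibleWeight q w) (x y : E) :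
    Tendsto (fun n => qwTilde q w n x y) atTop (𝓝 (qwMean q w x)) := by
  refine tendsto_order.2 ⟨fun a ha => ?_, fun a ha => ?_⟩
  · obtain ⟨c, hac, hcm⟩ := ENNReal.lt_iff_exists_nnreal_btwn.1 ha
    have h := (tendsto_lintegral_inv_qwHatPinned_tsub hw x y hcm).const_add ((c : ℝ≥0∞)⁻¹)
    rw [add_zero] at h
    filter_upwards [h.eventually_lt_const (ENNReal.inv_lt_inv.2 hac)] with n hn
    exact ENNReal.inv_lt_inv.1 ((inv_qwTilde_le x y c).trans_lt hn)
  · have h : Tendsto (fun n : ℕ => (w x y : ℝ≥0∞) / n + qwMean q w x) atTop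
        (𝓝 (0 + qwMean q w x)) := by
      refine Tendsto.add_const _ ?_
      exact ENNReal.Tendsto.const_div ENNReal.tendsto_nat_nhds_top (Or.inr ENNReal.coe_ne_top)
        |>.trans_eq (by simp)
    rw [zero_add] at h
    filter_upwards [h.eventually_lt_const ha, eventually_ne_atTop 0] with n hn hn0
    exact (qwTilde_le hw hn0 x y).trans_lt hn

lemma tendsto_qwMean_div_qwTilde (hw : AdmissibleWeight q w) (x y : E) :
    Tendsto (fun n => qwMean q w x / qwTilde q w n x y) atTop (𝓝 1) := by
  have h := ENNReal.Tendsto.const_div (tendsto_qwTilde hw x y) (Or.inr (hw.mean_ne_top x))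
  rwa [ENNReal.div_self (hw.qwMean_ne_zero x) (hw.mean_ne_top x)] at h

lemma tendsto_lintegral_qwTilde_div_tsub (hw : AdmissibleWeight q w) (x y : E) :
    Tendsto (fun n : ℕ => ∫⁻ Y, (qwTilde q w n x y / qwHatPinned w n x y Y - 1)
      ∂(Measure.pi fun _ : Fin (n - 1) => q x)) atTop (𝓝 0) := by
  have hm0 := hw.qwMean_ne_zero x
  have hmt := hw.mean_ne_top x
  refine tendsto_order.2 ⟨fun a ha => absurd ha not_lt_zero, fun ε hε => ?_⟩
  -- A level `c` above this value makes the limit `qwMean q w x / c - 1` of the main term smaller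
  -- than `ε`; a level below the mean lets the Chernoff estimate handle the rest.
  have hlt : qwMean q w x / (1 + ε) < qwMean q w x := by
    rcases eq_or_ne ε ∞ with rfl | hεt
    · simpa using pos_iff_ne_zero.2 hm0
    · refine ENNReal.div_lt_of_lt_mul' ?_
      rw [add_mul, one_mul]
      exact ENNReal.lt_add_right hmt (mul_ne_zero hε.ne' hm0)
  obtain ⟨c, hc1, hc2⟩ := ENNReal.lt_iff_exists_nnreal_btwn.1 hlt
  have hc0 : (c : ℝ≥0∞) ≠ 0 := (bot_le.trans_lt hc1).ne'
  have hT := tendsto_qwTilde hw x y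
  have hr := tendsto_lintegral_inv_qwHatPinned_tsub hw x y hc2
  have hlim : Tendsto (fun n : ℕ => (qwTilde q w n x y / c - 1)
      + qwTilde q w n x y * ∫⁻ Y, ((qwHatPinned w n x y Y)⁻¹ - (c : ℝ≥0∞)⁻¹)
        ∂(Measure.pi fun _ : Fin (n - 1) => q x)) atTop
      (𝓝 ((qwMean q w x / c - 1) + qwMean q w x * 0)) := by
    refine Tendsto.add ?_ (ENNReal.Tendsto.mul hT (Or.inl hm0) hr (Or.inr hmt))
    exact ENNReal.Tendsto.sub (ENNReal.Tendsto.div_const hT (Or.inr hc0)) tendsto_const_nhds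
      (Or.inr ENNReal.one_ne_top)
  have hε' : (qwMean q w x / c - 1) + qwMean q w x * 0 < ε := by
    rw [mul_zero, add_zero]
    refine ENNReal.sub_lt_of_lt_add ?_ ?_
    · rw [ENNReal.le_div_iff_mul_le (Or.inl hc0) (Or.inl ENNReal.coe_ne_top), one_mul]
      exact hc2.le
    · rw [add_comm]
      have h1 : qwMean q w x < c * (1 + ε) :=
        (ENNReal.div_lt_iff (Or.inl (by simp)) (Or.inr hmt)).1 hc1
      exact ENNReal.div_lt_of_lt_mul' h1
  filter_upwards [hlim.eventually_lt_const hε', eventually_ne_atTop 0] with n hn hn0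
  refine lt_of_le_of_lt ?_ hn
  have hTt := hw.qwTilde_ne_top hn0 x y
  calc _ ≤ ∫⁻ Y, ((qwTilde q w n x y / c - 1)
        + qwTilde q w n x y * ((qwHatPinned w n x y Y)⁻¹ - (c : ℝ≥0∞)⁻¹))
        ∂(Measure.pi fun _ : Fin (n - 1) => q x) := by
        refine lintegral_mono fun Y => tsub_le_iff_right.2 ?_
        calc qwTilde q w n x y / qwHatPinned w n x y Y
            ≤ qwTilde q w n x y * ((c : ℝ≥0∞)⁻¹
              + ((qwHatPinned w n x y Y)⁻¹ - (c : ℝ≥0∞)⁻¹)) := by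
              rw [div_eq_mul_inv]
              gcongr
              exact le_add_tsub
          _ = qwTilde q w n x y / c
              + qwTilde q w n x y * ((qwHatPinned w n x y Y)⁻¹ - (c : ℝ≥0∞)⁻¹) := by
              rw [mul_add, div_eq_mul_inv]
          _ ≤ ((qwTilde q w n x y / c - 1) + 1)
              + qwTilde q w n x y * ((qwHatPinned w n x y Y)⁻¹ - (c : ℝ≥0∞)⁻¹) := by
              gcongr
              exact le_tsub_add
          _ = _ := by ring
    _ = _ := by
        rw [lintegral_add_left measurable_const, lintegral_const_mul' _ _ hTt]
        simp

/-- A variable of mean one has equal excess and deficit. Deficits are what `zeta` feels, and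
excesses are what the Chernoff estimate controls. -/
lemma lintegral_one_tsub_eq {Ω : Type*} [MeasurableSpace Ω] {ν : Measure Ω}
    [IsProbabilityMeasure ν] {A : Ω → ℝ≥0∞} (hA : Measurable A) (h1 : ∫⁻ x, A x ∂ν = 1) :
    ∫⁻ x, (1 - A x) ∂ν = ∫⁻ x, (A x - 1) ∂ν := by
  have h : ∫⁻ x, (A x + (1 - A x)) ∂ν = ∫⁻ x, (1 + (A x - 1)) ∂ν := by
    refine lintegral_congr fun x => ?_
    rcases le_total (A x) 1 with h | h
    · rw [add_tsub_cancel_of_le h, tsub_eq_zero_of_le h, add_zero]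
    · rw [add_tsub_cancel_of_le h, tsub_eq_zero_of_le h, add_zero]
  rw [lintegral_add_left hA, lintegral_add_left measurable_const, h1] at h
  simpa using (ENNReal.add_right_inj ENNReal.one_ne_top).1 (by simpa using h)

lemma zeta_le_one (hw : AdmissibleWeight q w) (hn : n ≠ 0) (x y : E) : zeta q w n x y ≤ 1 := by
  rw [← hw.lintegral_qwTilde_div_qwHatPinned hn x y]
  exact lintegral_mono fun Y => (lintegral_mono fun Z => min_le_left _ _).trans_eq (by simp)

/-- Integrates `1 ≤ min A B + (1 - A) + (1 - B)` over the independent trials, then trades deficits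
for excesses. -/
lemma one_le_zeta_add (hw : AdmissibleWeight q w) (hn : n ≠ 0) (x y : E) :
    1 ≤ zeta q w n x y + (∫⁻ Y, (qwTilde q w n x y / qwHatPinned w n x y Y - 1)
        ∂(Measure.pi fun _ : Fin (n - 1) => q x)
      + ∫⁻ Z, (qwTilde q w n y x / qwHatPinned w n y x Z - 1)
        ∂(Measure.pi fun _ : Fin (n - 1) => q y)) := by
  have hA : ∀ x y : E, Measurable fun Y => qwTilde q w n x y / qwHatPinned w n x y Y := fun x y =>
    measurable_const.div (hw.measurable_qwHatPinned measurable_const measurable_const measurable_id)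
  rw [← lintegral_one_tsub_eq (hA x y) (hw.lintegral_qwTilde_div_qwHatPinned hn x y),
    ← lintegral_one_tsub_eq (hA y x) (hw.lintegral_qwTilde_div_qwHatPinned hn y x)]
  have hmin : ∀ A B : ℝ≥0∞, 1 ≤ min A B + ((1 - A) + (1 - B)) := by
    intro A B
    rcases min_choice A B with h | h <;> rw [h]
    · exact le_add_tsub.trans (by gcongr; exact le_self_add)
    · exact le_add_tsub.trans (by gcongr; exact le_add_self)
  calc (1 : ℝ≥0∞) = ∫⁻ _, ∫⁻ _, 1 ∂(Measure.pi fun _ : Fin (n - 1) => q y)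
        ∂(Measure.pi fun _ : Fin (n - 1) => q x) := by simp
    _ ≤ ∫⁻ Y, ∫⁻ Z, (min (qwTilde q w n x y / qwHatPinned w n x y Y)
          (qwTilde q w n y x / qwHatPinned w n y x Z)
          + ((1 - qwTilde q w n x y / qwHatPinned w n x y Y)
            + (1 - qwTilde q w n y x / qwHatPinned w n y x Z)))
        ∂(Measure.pi fun _ : Fin (n - 1) => q y) ∂(Measure.pi fun _ : Fin (n - 1) => q x) :=
        lintegral_mono fun Y => lintegral_mono fun Z => hmin _ _
    _ = ∫⁻ Y, ((∫⁻ Z, min (qwTilde q w n x y / qwHatPinned w n x y Y)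
          (qwTilde q w n y x / qwHatPinned w n y x Z) ∂(Measure.pi fun _ : Fin (n - 1) => q y))
          + ((1 - qwTilde q w n x y / qwHatPinned w n x y Y)
            + ∫⁻ Z, (1 - qwTilde q w n y x / qwHatPinned w n y x Z)
              ∂(Measure.pi fun _ : Fin (n - 1) => q y)))
        ∂(Measure.pi fun _ : Fin (n - 1) => q x) := by
        refine lintegral_congr fun Y => ?_
        rw [lintegral_add_left (measurable_const.min (hA y x)), lintegral_add_left measurable_const]
        simp
    _ = _ := by
        have hm : Measurable fun Y => 1 - qwTilde q w n x y / qwHatPinned w n x y Y :=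
          measurable_const.sub (hA x y)
        have hm' : Measurable fun Y => 1 - qwTilde q w n x y / qwHatPinned w n x y Y
            + ∫⁻ Z, (1 - qwTilde q w n y x / qwHatPinned w n y x Z)
              ∂(Measure.pi fun _ : Fin (n - 1) => q y) := hm.add measurable_const
        rw [lintegral_add_right _ hm', lintegral_add_left hm]
        simp [zeta]

lemma tendsto_zeta (hw : AdmissibleWeight q w) (x y : E) :
    Tendsto (fun n => zeta q w n x y) atTop (𝓝 1) := by
  have h := (tendsto_lintegral_qwTilde_div_tsub hw x y).add
    (tendsto_lintegral_qwTilde_div_tsub hw y x)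
  have h' := ENNReal.Tendsto.sub (tendsto_const_nhds (x := (1 : ℝ≥0∞))) h
    (Or.inl ENNReal.one_ne_top)
  rw [add_zero, tsub_zero] at h'
  refine tendsto_of_tendsto_of_tendsto_of_le_of_le' h' tendsto_const_nhds ?_ ?_
  · filter_upwards [eventually_ne_atTop 0] with n hn
    exact tsub_le_iff_right.2 (one_le_zeta_add hw hn x y)
  · filter_upwards [eventually_ne_atTop 0] with n hn using zeta_le_one hw hn x y

lemma one_lt_ofReal_one_div {s : ℝ} (hs : 0 < s) (hs1 : s < 1) : 1 < ENNReal.ofReal (1 / s) := by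
  rw [← ENNReal.ofReal_one]
  exact (ENNReal.ofReal_lt_ofReal_iff (by positivity)).2 ((one_lt_div hs).2 hs1)

lemma ofReal_one_div_lt_one {s : ℝ} (hs1 : 1 < s) : ENNReal.ofReal (1 / s) < 1 := by
  rw [← ENNReal.ofReal_one]
  exact (ENNReal.ofReal_lt_ofReal_iff one_pos).2 ((div_lt_one (by linarith)).2 hs1)

lemma isProbabilityMeasure_weightedProposal (hw : AdmissibleWeight q w) (x : E) :
    IsProbabilityMeasure (weightedProposal q w x) := by
  refine ⟨?_⟩
  rw [weightedProposal, withDensity_apply _ MeasurableSet.univ, Measure.restrict_univ]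
  exact hw.lintegral_weight_div_qwMean x

lemma isProbabilityMeasure_resampledProposal (hw : AdmissibleWeight q w) (hn : n ≠ 0) (x : E) :
    IsProbabilityMeasure (resampledProposal q w n x) := by
  refine ⟨?_⟩
  rw [resampledProposal, withDensity_apply _ MeasurableSet.univ, Measure.restrict_univ]
  exact hw.lintegral_weight_div_qwTilde hn x

lemma isMarkovKernel_semiIdeal (hd : HasDensities μ π q dπ dq) (hw : AdmissibleWeight q w)
    (hn : n ≠ 0) : IsMarkovKernel (mhKernel q (semiIdealDensity dπ dq q w n)) :=
  isMarkovKernel_mhKernel (measurable_semiIdealDensity hd hw)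
    (lintegral_semiIdealDensity_le_one hw hn)

/-! ### Limits of `betaOne`, `betaTwo` and `chainedBeta` -/

variable [IsProbabilityMeasure π]

lemma betaOne_le_one (hw : AdmissibleWeight q w) (hn : n ≠ 0) (s : ℝ) :
    betaOne π q w n s ≤ 1 := by
  rw [betaOne_eq hw hn]
  have := isProbabilityMeasure_weightedProposal hw
  exact (lintegral_mono fun x => prob_le_one).trans_eq (by simp)

lemma betaTwo_le_one (hd : HasDensities μ π q dπ dq) (hw : AdmissibleWeight q w) (hn : n ≠ 0)
    (s : ℝ) : betaTwo π dπ dq q w n s ≤ 1 := by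
  rw [betaTwo, semiIdealKernel_eq_mhKernel hd hw]
  have := isMarkovKernel_semiIdeal hd hw hn
  exact (lintegral_mono fun x => prob_le_one).trans_eq (by simp)

lemma betaOne_anti {s t : ℝ} (hs : 0 < s) (hst : s ≤ t) :
    betaOne π q w n t ≤ betaOne π q w n s := by
  refine lintegral_mono fun x => measure_mono fun y hy => ?_
  exact lt_of_lt_of_le hy (ENNReal.ofReal_le_ofReal (one_div_le_one_div_of_le hs hst))

lemma betaTwo_eq_one (hd : HasDensities μ π q dπ dq) (hw : AdmissibleWeight q w) (hn : n ≠ 0)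
    {s : ℝ} (hs : 0 < s) (hs1 : s < 1) : betaTwo π dπ dq q w n s = 1 := by
  have h : ∀ x, {y | zeta q w n x y < ENNReal.ofReal (1 / s)} = Set.univ := fun x =>
    Set.eq_univ_of_forall fun y => (zeta_le_one hw hn x y).trans_lt (one_lt_ofReal_one_div hs hs1)
  rw [betaTwo, semiIdealKernel_eq_mhKernel hd hw]
  have := isMarkovKernel_semiIdeal hd hw hn
  simp only [h, measure_univ, lintegral_const, mul_one]

/-- Dominated convergence, first in `y` and then in `x`. The limiting set `A` is the whole space for
`s < 1` and empty for `s > 1`. -/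
lemma tendsto_betaOne (hw : AdmissibleWeight q w) {s : ℝ} {A : Set E} (hA : MeasurableSet A)
    (h : ∀ x y, ∀ᶠ n in atTop, y ∈ resampledSmall q w n s x ↔ y ∈ A) {l : ℝ≥0∞}
    (hl : ∀ x, weightedProposal q w x A = l) :
    Tendsto (fun n => betaOne π q w n s) atTop (𝓝 l) := by
  have := isProbabilityMeasure_weightedProposal hw
  have hker : ∀ x, weightedProposal q w x = q.withDensity (fun x y => w x y / qwMean q w x) x :=
    fun x => (Kernel.withDensity_apply q (f := fun x y => (w x y : ℝ≥0∞) / qwMean q w x) ((hw.measurable_weight measurable_fst measurable_snd).div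
      (hw.measurable_qwMean.comp measurable_fst)) x).symm
  have hlim : Tendsto (fun n => ∫⁻ x, weightedProposal q w x (resampledSmall q w n s x) ∂π) atTop
      (𝓝 (∫⁻ x, weightedProposal q w x A ∂π)) := by
    refine tendsto_lintegral_of_dominated_convergence (fun _ => 1) (fun n => ?_)
      (fun n => ae_of_all _ fun x => prob_le_one) (by simp) (ae_of_all _ fun x => ?_)
    · simp only [hker]
      have : IsMarkovKernel (q.withDensity (fun x y => w x y / qwMean q w x)) :=
        ⟨fun x => hker x ▸ inferInstance⟩
      exact Kernel.measurable_kernel_prodMk_left (measurableSet_resampledSmall hw s)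
    · exact tendsto_measure_of_ae_tendsto_indicator_of_isFiniteMeasure atTop hA
        (fun n => measurable_prodMk_left (measurableSet_resampledSmall hw s))
        (ae_of_all _ (h x))
  simp only [hl, lintegral_const, measure_univ, mul_one] at hlim
  refine hlim.congr' ?_
  filter_upwards [eventually_ne_atTop 0] with n hn using (betaOne_eq hw hn s).symm

lemma tendsto_betaOne_of_lt_one (hw : AdmissibleWeight q w) {s : ℝ} (hs : 0 < s) (hs1 : s < 1) :
    Tendsto (fun n => betaOne π q w n s) atTop (𝓝 1) := by
  have := isProbabilityMeasure_weightedProposal hw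
  refine tendsto_betaOne hw MeasurableSet.univ (fun x y => ?_) fun x => measure_univ
  filter_upwards [(tendsto_qwMean_div_qwTilde hw x y).eventually_lt_const
    (one_lt_ofReal_one_div hs hs1)] with n hn
  simpa [resampledSmall] using hn

lemma tendsto_betaOne_of_one_lt (hw : AdmissibleWeight q w) {s : ℝ} (hs1 : 1 < s) :
    Tendsto (fun n => betaOne π q w n s) atTop (𝓝 0) := by
  refine tendsto_betaOne hw MeasurableSet.empty (fun x y => ?_) fun x => measure_empty
  filter_upwards [(tendsto_qwMean_div_qwTilde hw x y).eventually_const_lt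
    (ofReal_one_div_lt_one hs1)] with n hn
  simpa [resampledSmall] using hn.le

/-- A Scheffé-type argument: the proposal varies with `n`, but its densities converge pointwise to a
density of mass one. Fatou on the complement of the set shows that all the mass eventually sits
there. -/
lemma tendsto_resampledProposal_zeta_lt (hw : AdmissibleWeight q w) {s : ℝ} (hs1 : 1 < s)
    (x : E) :
    Tendsto (fun n => resampledProposal q w n x {y | zeta q w n x y < ENNReal.ofReal (1 / s)})
      atTop (𝓝 0) := by
  have hset : ∀ n, MeasurableSet {y | zeta q w n x y < ENNReal.ofReal (1 / s)} := fun n =>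
    measurable_prodMk_left (measurableSet_zeta_lt (n := n) hw s)
  have hdens : ∀ n, Measurable fun y => (w x y : ℝ≥0∞) / qwTilde q w n x y := fun n =>
    (hw.measurable_weight measurable_const measurable_id).div
      (hw.measurable_qwTilde measurable_const measurable_id)
  have hlow : 1 ≤ liminf (fun n =>
      resampledProposal q w n x {y | zeta q w n x y < ENNReal.ofReal (1 / s)}ᶜ) atTop := by
    have hQ : ∀ n, resampledProposal q w n x {y | zeta q w n x y < ENNReal.ofReal (1 / s)}ᶜ
        = ∫⁻ y, {y | zeta q w n x y < ENNReal.ofReal (1 / s)}ᶜ.indicator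
          (fun y => (w x y : ℝ≥0∞) / qwTilde q w n x y) y ∂(q x) := fun n => by
      rw [resampledProposal, withDensity_apply _ (hset n).compl, lintegral_indicator (hset n).compl]
    simp only [hQ]
    refine le_trans ?_ (lintegral_liminf_le fun n => (hdens n).indicator (hset n).compl)
    rw [← hw.lintegral_weight_div_qwMean x]
    refine lintegral_mono fun y => (Tendsto.liminf_eq ?_).ge
    have h1 : Tendsto (fun n => (w x y : ℝ≥0∞) / qwTilde q w n x y) atTop
        (𝓝 (w x y / qwMean q w x)) :=
      ENNReal.Tendsto.const_div (tendsto_qwTilde hw x y) (Or.inr ENNReal.coe_ne_top)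
    refine h1.congr' ?_
    filter_upwards [(tendsto_zeta hw x y).eventually_const_lt (ofReal_one_div_lt_one hs1)] with n hn
    rw [Set.indicator_of_mem]
    exact not_lt.2 hn.le
  have hprob : ∀ᶠ n in atTop, IsProbabilityMeasure (resampledProposal q w n x) := by
    filter_upwards [eventually_ne_atTop 0] with n hn
    exact isProbabilityMeasure_resampledProposal hw hn x
  have hone : Tendsto (fun n =>
      resampledProposal q w n x {y | zeta q w n x y < ENNReal.ofReal (1 / s)}ᶜ) atTop (𝓝 1) := by
    refine tendsto_of_le_liminf_of_limsup_le hlow ?_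
    refine limsup_le_of_le (by isBoundedDefault) ?_
    filter_upwards [hprob] with n hn using prob_le_one
  have h := ENNReal.Tendsto.sub (tendsto_const_nhds (x := (1 : ℝ≥0∞))) hone
    (Or.inl ENNReal.one_ne_top)
  rw [tsub_self] at h
  refine h.congr' ?_
  filter_upwards [hprob] with n hn
  rw [prob_compl_eq_one_sub (hset n)]
  exact ENNReal.sub_sub_cancel ENNReal.one_ne_top prob_le_one

lemma tendsto_betaTwo_of_one_lt (hd : HasDensities μ π q dπ dq) (hw : AdmissibleWeight q w)
    {s : ℝ} (hs1 : 1 < s) : Tendsto (fun n => betaTwo π dπ dq q w n s) atTop (𝓝 0) := by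
  have hset : ∀ n x, MeasurableSet {y | zeta q w n x y < ENNReal.ofReal (1 / s)} := fun n x =>
    measurable_prodMk_left (measurableSet_zeta_lt (n := n) hw s)
  let B : ℕ → E → ℝ≥0∞ := fun n x =>
    mhKernel q (semiIdealDensity dπ dq q w n) x {y | zeta q w n x y < ENNReal.ofReal (1 / s)}
  have hB : ∀ n x, n ≠ 0 → B n x ≤ 1 := fun n x hn => by
    have := isMarkovKernel_semiIdeal hd hw hn
    exact prob_le_one
  have hpt : ∀ x, Tendsto (fun n => B n x) atTop (𝓝 0) := by
    intro x
    refine tendsto_of_tendsto_of_tendsto_of_le_of_le' tendsto_const_nhds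
      (tendsto_resampledProposal_zeta_lt hw hs1 x) (Eventually.of_forall fun _ => zero_le) ?_
    -- The rejection atom at `x` does not count: `zeta` at `(x, x)` also tends to `1`, so `x`
    -- eventually leaves the set.
    filter_upwards [(tendsto_zeta hw x x).eventually_const_lt (ofReal_one_div_lt_one hs1)] with n hn
    simp only [B]
    rw [← lintegral_indicator_one (hset n x), lintegral_mhKernel (measurable_semiIdealDensity hd hw)
      x (measurable_one.indicator (hset n x)), Set.indicator_of_notMem (by exact not_lt.2 hn.le),
      mul_zero, add_zero, resampledProposal, withDensity_apply _ (hset n x),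
      ← lintegral_indicator (hset n x)]
    refine lintegral_mono fun y => ?_
    by_cases hy : y ∈ {y | zeta q w n x y < ENNReal.ofReal (1 / s)}
    · rw [Set.indicator_of_mem hy, Set.indicator_of_mem hy, Pi.one_apply, mul_one]
      exact mul_le_of_le_one_right' (min_le_left _ _)
    · rw [Set.indicator_of_notMem hy, mul_zero]
      exact zero_le
  have hlim : Tendsto (fun n => ∫⁻ x, B n x ∂π) atTop (𝓝 (∫⁻ _, 0 ∂π)) := by
    refine tendsto_lintegral_filter_of_dominated_convergence (fun _ => 1) ?_ ?_ (by simp)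
      (ae_of_all _ hpt)
    · filter_upwards [eventually_ne_atTop 0] with n hn
      have := isMarkovKernel_semiIdeal hd hw hn
      exact Kernel.measurable_kernel_prodMk_left (measurableSet_zeta_lt hw s)
    · filter_upwards [eventually_ne_atTop 0] with n hn
      exact ae_of_all _ fun x => hB n x hn
  rw [lintegral_zero] at hlim
  refine hlim.congr fun n => ?_
  rw [betaTwo, semiIdealKernel_eq_mhKernel hd hw]

lemma chainedBeta_le {s₁ s₂ s : ℝ} (h₁ : 0 < s₁) (h₂ : 0 < s₂) (h : s₁ * s₂ = s) :
    chainedBeta π dπ dq q w n s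
      ≤ betaOne π q w n s₁ + ENNReal.ofReal s₁ * betaTwo π dπ dq q w n s₂ :=
  iInf_le_of_le s₁ <| iInf_le_of_le s₂ <| iInf_le_of_le h₁ <| iInf_le_of_le h₂ <| iInf_le _ h

/-- Let `s₁ → 0`: the first term is at most `1` and the second at most `s₁`. -/
lemma chainedBeta_le_one (hd : HasDensities μ π q dπ dq) (hw : AdmissibleWeight q w) (hn : n ≠ 0)
    {s : ℝ} (hs : 0 < s) : chainedBeta π dπ dq q w n s ≤ 1 := by
  refine ENNReal.le_of_forall_pos_le_add fun ε hε _ => ?_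
  have hε' : (0 : ℝ) < ε := hε
  refine (chainedBeta_le hε' (div_pos hs hε') (mul_div_cancel₀ s hε'.ne')).trans ?_
  refine add_le_add (betaOne_le_one hw hn _) ?_
  exact (mul_le_of_le_one_right' (betaTwo_le_one hd hw hn _)).trans_eq ENNReal.ofReal_coe_nnreal

lemma tendsto_chainedBeta_of_one_lt (hd : HasDensities μ π q dπ dq) (hw : AdmissibleWeight q w)
    {s : ℝ} (hs1 : 1 < s) : Tendsto (fun n => chainedBeta π dπ dq q w n s) atTop (𝓝 0) := by
  -- Splitting evenly keeps both arguments above `1`, where both betas vanish in the limit.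
  have hr : 1 < √s := Real.lt_sqrt_of_sq_lt (by simpa using hs1)
  have hr0 : 0 < √s := by linarith
  have h := (tendsto_betaOne_of_one_lt (π := π) hw hr).add (ENNReal.Tendsto.const_mul
    (tendsto_betaTwo_of_one_lt hd hw hr) (Or.inr (ENNReal.ofReal_ne_top (r := √s))))
  rw [mul_zero, add_zero] at h
  exact tendsto_of_tendsto_of_tendsto_of_le_of_le tendsto_const_nhds h (fun _ => zero_le)
    fun n => chainedBeta_le hr0 hr0 (Real.mul_self_sqrt (by linarith))

/-- For the lower bound fix `r` in `(s, 1)`, close to `1`. If `s₁ ≤ r`, monotonicity makes the first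
term at least `betaOne` at `r`, which tends to `1`. If `s₁ ≥ r > s`, then `s₂ < 1`, so `betaTwo` is
`1` and the second term is at least `r`. -/
lemma tendsto_chainedBeta_of_lt_one (hd : HasDensities μ π q dπ dq) (hw : AdmissibleWeight q w)
    {s : ℝ} (hs : 0 < s) (hs1 : s < 1) :
    Tendsto (fun n => chainedBeta π dπ dq q w n s) atTop (𝓝 1) := by
  refine tendsto_order.2 ⟨fun a ha => ?_, fun a ha => ?_⟩
  · obtain ⟨b, hab, hb1⟩ := ENNReal.lt_iff_exists_nnreal_btwn.1 ha
    have hb1' : (b : ℝ) < 1 := by exact_mod_cast hb1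
    obtain ⟨r, hr, hr1⟩ := exists_between (max_lt hs1 hb1')
    have hsr : s < r := (le_max_left _ _).trans_lt hr
    have hr0 : 0 < r := hs.trans hsr
    have har : a < ENNReal.ofReal r := hab.trans_le (by
      rw [← ENNReal.ofReal_coe_nnreal]
      exact ENNReal.ofReal_le_ofReal ((le_max_right _ _).trans hr.le))
    filter_upwards [(tendsto_betaOne_of_lt_one (π := π) hw hr0 hr1).eventually_const_lt ha,
      eventually_ne_atTop 0] with n hn hn0
    refine lt_of_lt_of_le (lt_min hn har) ?_
    refine le_iInf fun s₁ => le_iInf fun s₂ => le_iInf fun h₁ => le_iInf fun h₂ =>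
      le_iInf fun h => ?_
    rcases le_total s₁ r with hle | hle
    · exact (min_le_left _ _).trans ((betaOne_anti h₁ hle).trans le_self_add)
    · have h2 : s₂ < 1 := by
        by_contra hge
        nlinarith [not_lt.1 hge]
      rw [betaTwo_eq_one hd hw hn0 h₂ h2, mul_one]
      exact (min_le_right _ _).trans (le_add_left (ENNReal.ofReal_le_ofReal hle))
  · filter_upwards [eventually_ne_atTop 0] with n hn
    exact (chainedBeta_le_one hd hw hn hs).trans_lt ha

end Limits

/-! ### Polynomial rates -/

section Rates

variable {μ π : Measure E} {q : Kernel E E} [IsMarkovKernel q] {dπ : E → ℝ≥0}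
  {dq w : E → E → ℝ≥0} {n : ℕ}

/-- The moment of the importance weight under the proposal from `x`. -/
def localMoment (q : Kernel E E) (w : E → E → ℝ≥0) (r : ℝ) (x : E) : ℝ≥0∞ :=
  ∫⁻ y, impWeight q w x y ^ r ∂(q x)

lemma impWeight_ne_zero (hw : AdmissibleWeight q w) (x y : E) : impWeight q w x y ≠ 0 := by
  rw [impWeight, Ne, ENNReal.div_eq_zero_iff, not_or]
  exact ⟨hw.coe_ne_zero x y, hw.mean_ne_top x⟩

lemma impWeight_ne_top (hw : AdmissibleWeight q w) (x y : E) : impWeight q w x y ≠ ∞ :=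
  ENNReal.div_ne_top ENNReal.coe_ne_top (hw.qwMean_ne_zero x)

lemma measurable_impWeight (hw : AdmissibleWeight q w) :
    Measurable (Function.uncurry (impWeight q w)) :=
  (hw.measurable_weight measurable_fst measurable_snd).div (hw.measurable_qwMean.comp measurable_fst)

lemma measurable_localMoment (hw : AdmissibleWeight q w) (r : ℝ) :
    Measurable (localMoment q w r) :=
  Measurable.lintegral_kernel_prod_right ((measurable_impWeight hw).pow_const r)

lemma lintegral_impWeight (hw : AdmissibleWeight q w) (x : E) :
    ∫⁻ y, impWeight q w x y ∂(q x) = 1 :=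
  hw.lintegral_weight_div_qwMean x

lemma one_le_localMoment (hw : AdmissibleWeight q w) {p : ℝ} (hp : 1 ≤ p) (x : E) :
    1 ≤ localMoment q w p x := by
  have h := rpow_lintegral_le_lintegral_rpow (ν := q x)
    (measurable_impWeight hw).of_uncurry_left hp (f := impWeight q w x)
  rwa [lintegral_impWeight hw, ENNReal.one_rpow] at h

lemma one_le_localMoment_neg (hw : AdmissibleWeight q w) {p : ℝ} (hp : 1 ≤ p) (x : E) :
    1 ≤ localMoment q w (-p) x := by
  have h := lintegral_inv_rpow_neg_le (ν := q x) (f := fun y => (impWeight q w x y)⁻¹)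
    (measurable_impWeight hw).of_uncurry_left.inv
    (fun y => ENNReal.inv_ne_zero.2 (impWeight_ne_top hw x y))
    (fun y => ENNReal.inv_ne_top.2 (impWeight_ne_zero hw x y)) hp
  simp only [inv_inv, ENNReal.inv_rpow, ← ENNReal.rpow_neg] at h
  rwa [lintegral_impWeight hw, ENNReal.one_rpow] at h

lemma localMoment_sq_le (hw : AdmissibleWeight q w) (r : ℝ) (x : E) :
    localMoment q w r x ^ (2 : ℝ) ≤ localMoment q w (2 * r) x := by
  have h := rpow_lintegral_le_lintegral_rpow (ν := q x) (f := fun y => impWeight q w x y ^ r)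
    ((measurable_impWeight hw).of_uncurry_left.pow_const r) one_le_two
  simp only [← ENNReal.rpow_mul, mul_comm r 2] at h
  exact h

lemma one_add_mul_le_sq_add_sq {a b : ℝ≥0∞} (ha : 1 ≤ a) (hb : 1 ≤ b) :
    1 + a * b ≤ a ^ (2 : ℝ) + b ^ (2 : ℝ) := by
  rcases eq_or_ne a ∞ with rfl | hat
  · simp
  rcases eq_or_ne b ∞ with rfl | hbt
  · simp
  lift a to ℝ≥0 using hat
  lift b to ℝ≥0 using hbt
  simp only [ENNReal.rpow_ofNat]
  norm_cast at ha hb ⊢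
  have ha' : (1 : ℝ) ≤ a := by exact_mod_cast ha
  have hb' : (1 : ℝ) ≤ b := by exact_mod_cast hb
  rw [← NNReal.coe_le_coe]
  push_cast
  nlinarith [sq_nonneg ((a : ℝ) - b)]

/-- Both moments are at least one, and `1 + a b ≤ 2 a b ≤ a ^ 2 + b ^ 2` for such `a`, `b`; Jensen
turns the squares into moments of doubled order. This is how the orders `2p` and `-2p` enter the
rate. -/
lemma one_add_localMoment_mul_le (hw : AdmissibleWeight q w) {p : ℝ} (hp : 1 ≤ p) (x : E) :
    1 + localMoment q w p x * localMoment q w (-p) x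
      ≤ localMoment q w (2 * p) x + localMoment q w (-2 * p) x := by
  have h := localMoment_sq_le hw (-p) x
  rw [show (2 : ℝ) * -p = -2 * p by ring] at h
  exact (one_add_mul_le_sq_add_sq (one_le_localMoment hw hp x)
    (one_le_localMoment_neg hw hp x)).trans
    (add_le_add (localMoment_sq_le hw p x) h)

lemma lintegral_localMoment (r : ℝ) : ∫⁻ x, localMoment q w r x ∂π = weightMoment π q w r := rfl

lemma rpow_pinned_mean_le (hn : n ≠ 0) {p : ℝ} (hp : 1 ≤ p) (a : ℝ≥0∞)
    (z : Fin (n - 1) → ℝ≥0∞) :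
    ((a + ∑ i, z i) / n) ^ p ≤ (a ^ p + ∑ i, z i ^ p) / n := by
  obtain ⟨m, rfl⟩ := Nat.exists_eq_succ_of_ne_zero hn
  have h := rpow_mean_le_mean_rpow hn (Fin.cons a z : Fin (m + 1) → ℝ≥0∞) hp
  simp only [Fin.sum_univ_succ, Fin.cons_zero, Fin.cons_succ] at h
  exact h

/-- Jensen over the free trials, then convexity of the power inside the empirical mean; the pinned
trial keeps its weight `1 / n`. -/
lemma qwMean_div_qwTilde_rpow_neg_le (hw : AdmissibleWeight q w) (hn : n ≠ 0) {p : ℝ}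
    (hp : 1 ≤ p) (x y : E) :
    (qwMean q w x / qwTilde q w n x y) ^ (-p)
      ≤ impWeight q w x y ^ p / n + localMoment q w p x := by
  have hn0 : (n : ℝ≥0∞) ≠ 0 := by exact_mod_cast hn
  have hnt : (n : ℝ≥0∞) ≠ ∞ := ENNReal.natCast_ne_top n
  have hm : ∀ i : Fin (n - 1), Measurable fun Y : Fin (n - 1) → E => impWeight q w x (Y i) :=
    fun i => (measurable_impWeight hw).of_uncurry_left.comp (measurable_pi_apply i)
  have hs0 : ∀ Y : Fin (n - 1) → E, impWeight q w x y + ∑ i, impWeight q w x (Y i) ≠ 0 :=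
    fun Y h => impWeight_ne_zero hw x y (add_eq_zero.1 h).1
  have hst : ∀ Y : Fin (n - 1) → E, impWeight q w x y + ∑ i, impWeight q w x (Y i) ≠ ∞ :=
    fun Y => ENNReal.add_ne_top.2 ⟨impWeight_ne_top hw x y,
      ENNReal.sum_ne_top.2 fun i _ => impWeight_ne_top hw x (Y i)⟩
  rw [← lintegral_div_sum_impWeight hw hn]
  have hinv : ∀ Y : Fin (n - 1) → E,
      (n : ℝ≥0∞) / (impWeight q w x y + ∑ i, impWeight q w x (Y i))
        = ((impWeight q w x y + ∑ i, impWeight q w x (Y i)) / n)⁻¹ := fun Y =>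
    (ENNReal.inv_div (Or.inl hnt) (Or.inr (hs0 Y))).symm
  simp only [hinv]
  refine (lintegral_inv_rpow_neg_le ((measurable_const.add
    (Finset.measurable_sum _ fun i _ => hm i)).div_const _)
    (fun Y => (ENNReal.div_pos (hs0 Y) hnt).ne') (fun Y => ENNReal.div_ne_top (hst Y) hn0)
    hp).trans ?_
  calc _ ≤ ∫⁻ Y, (impWeight q w x y ^ p + ∑ i, impWeight q w x (Y i) ^ p) / n
        ∂(Measure.pi fun _ : Fin (n - 1) => q x) :=
        lintegral_mono fun Y => rpow_pinned_mean_le hn hp _ _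
    _ = (impWeight q w x y ^ p + (n - 1 : ℕ) * localMoment q w p x) / n := by
        simp only [div_eq_mul_inv]
        rw [lintegral_mul_const' _ _ (ENNReal.inv_ne_top.2 hn0),
          lintegral_add_left measurable_const,
          lintegral_finsetSum _ fun i _ => (hm i).pow_const p]
        have hi : ∀ i : Fin (n - 1), ∫⁻ Y, impWeight q w x (Y i) ^ p
            ∂(Measure.pi fun _ : Fin (n - 1) => q x) = localMoment q w p x := fun i =>
          lintegral_pi_eval (q x) i (f := fun y => impWeight q w x y ^ p)
            ((measurable_impWeight hw).of_uncurry_left.pow_const p)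
        simp [hi]
    _ ≤ (impWeight q w x y ^ p + n * localMoment q w p x) / n := by
        gcongr
        exact Nat.sub_le _ _
    _ = _ := by
        rw [ENNReal.add_div, mul_comm, ENNReal.mul_div_cancel_right hn0 hnt]

/-- The pointwise form of Markov's inequality for a negative power. -/
lemma one_le_ofReal_rpow_neg_mul {s p : ℝ} (hs : 0 < s) (hp : 0 ≤ p) {z : ℝ≥0∞}
    (hz : z < ENNReal.ofReal (1 / s)) : 1 ≤ ENNReal.ofReal (s ^ (-p)) * z ^ (-p) := by
  have h1 : ENNReal.ofReal (1 / s) ^ (-p) ≤ z ^ (-p) := by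
    rw [ENNReal.rpow_neg, ENNReal.rpow_neg]
    exact ENNReal.inv_le_inv.2 (ENNReal.rpow_le_rpow hz.le hp)
  calc (1 : ℝ≥0∞) = ENNReal.ofReal (s ^ (-p)) * ENNReal.ofReal (1 / s) ^ (-p) := by
        rw [ENNReal.ofReal_rpow_of_pos (by positivity), ← ENNReal.ofReal_mul (by positivity),
          ← Real.mul_rpow hs.le (by positivity), mul_one_div_cancel hs.ne', Real.one_rpow,
          ENNReal.ofReal_one]
    _ ≤ _ := by gcongr

/-- The proposal `q^w` brings one more factor of the importance weight. On the pinned term it raises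
the order to `p + 1`, at cost `1 / n`; on the other term it integrates to one. -/
lemma betaOne_le (hw : AdmissibleWeight q w) (hn : n ≠ 0) {p : ℝ} (hp : 1 ≤ p) {s : ℝ}
    (hs : 0 < s) :
    betaOne π q w n s ≤ ENNReal.ofReal (s ^ (-p))
      * (weightMoment π q w p + weightMoment π q w (p + 1) / n) := by
  have hn0 : (n : ℝ≥0∞) ≠ 0 := by exact_mod_cast hn
  have hset := measurableSet_resampledSmall (n := n) hw s
  have him : ∀ x, Measurable (impWeight q w x) := fun x => (measurable_impWeight hw).of_uncurry_left
  have hx : ∀ x, weightedProposal q w x (resampledSmall q w n s x)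
      ≤ ENNReal.ofReal (s ^ (-p)) * (localMoment q w p x + localMoment q w (p + 1) x / n) := by
    intro x
    have hsx : MeasurableSet (resampledSmall q w n s x) := measurable_prodMk_left hset
    rw [weightedProposal, withDensity_apply _ hsx, ← lintegral_indicator hsx]
    calc _ ≤ ∫⁻ y, ENNReal.ofReal (s ^ (-p)) * (impWeight q w x y ^ (p + 1) / n
          + impWeight q w x y * localMoment q w p x) ∂(q x) := by
          refine lintegral_mono fun y => ?_
          by_cases hy : y ∈ resampledSmall q w n s x
          · rw [Set.indicator_of_mem hy]
            calc impWeight q w x y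
                ≤ impWeight q w x y * (ENNReal.ofReal (s ^ (-p))
                  * (qwMean q w x / qwTilde q w n x y) ^ (-p)) :=
                  le_mul_of_one_le_right' (one_le_ofReal_rpow_neg_mul hs (by linarith) hy)
              _ ≤ impWeight q w x y * (ENNReal.ofReal (s ^ (-p))
                  * (impWeight q w x y ^ p / n + localMoment q w p x)) := by
                  gcongr
                  exact qwMean_div_qwTilde_rpow_neg_le hw hn hp x y
              _ = _ := by
                  rw [ENNReal.rpow_add _ _ (impWeight_ne_zero hw x y) (impWeight_ne_top hw x y),
                    ENNReal.rpow_one]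
                  simp only [div_eq_mul_inv]
                  ring
          · rw [Set.indicator_of_notMem hy]
            exact zero_le
      _ = _ := by
          rw [lintegral_const_mul' _ _ ENNReal.ofReal_ne_top,
            lintegral_add_left (((him x).pow_const _).div_const _),
            lintegral_mul_const _ (him x)]
          simp only [div_eq_mul_inv]
          rw [lintegral_mul_const' _ _ (ENNReal.inv_ne_top.2 hn0)]
          have h1 : ∫⁻ y, impWeight q w x y ∂(q x) = 1 := hw.lintegral_weight_div_qwMean x
          rw [h1, one_mul, add_comm]
          rfl
  rw [betaOne_eq hw hn]
  refine (lintegral_mono hx).trans_eq ?_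
  rw [lintegral_const_mul' _ _ ENNReal.ofReal_ne_top,
    lintegral_add_left (measurable_localMoment hw p), lintegral_localMoment]
  simp only [div_eq_mul_inv]
  rw [lintegral_mul_const' _ _ (ENNReal.inv_ne_top.2 hn0), lintegral_localMoment]

/-- The empirical mean of the unpinned trials has relative moments that are controlled by those of
a single trial. -/
lemma lintegral_sum_rpow_mul_le (hw : AdmissibleWeight q w) {p : ℝ} (hp : 1 ≤ p) {m : ℕ} (x : E)
    {N : ℝ≥0∞} (hN0 : N ≠ 0) (hNt : N ≠ ∞) :
    (∫⁻ Y, ((∑ i, (w x (Y i) : ℝ≥0∞)) / N) ^ p ∂(Measure.pi fun _ : Fin m => q x))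
      * (∫⁻ Y, ((∑ i, (w x (Y i) : ℝ≥0∞)) / N)⁻¹ ∂(Measure.pi fun _ : Fin m => q x)) ^ p
      ≤ localMoment q w p x * localMoment q w (-p) x := by
  have hp0 : 0 < p := by linarith
  -- With no free trial the sum is empty, the first factor is zero, and `0 * ∞ = 0`.
  rcases eq_or_ne m 0 with rfl | hm
  · simp [hp0]
  have hm0 : (m : ℝ≥0∞) ≠ 0 := by exact_mod_cast hm
  have hmt : (m : ℝ≥0∞) ≠ ∞ := ENNReal.natCast_ne_top m
  have him : Measurable (impWeight q w x) := (measurable_impWeight hw).of_uncurry_left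
  -- The scale relating the sum to the empirical mean of importance weights; it cancels between the
  -- `p`-th moment and the `p`-th power of the mean reciprocal.
  set d : ℝ≥0∞ := qwMean q w x * (m / N) with hd
  have hd0 : d ≠ 0 := mul_ne_zero (hw.qwMean_ne_zero x) (ENNReal.div_pos hm0 hNt).ne'
  have hdt : d ≠ ∞ := ENNReal.mul_ne_top (hw.mean_ne_top x) (ENNReal.div_ne_top hmt hN0)
  have hS : ∀ Y : Fin m → E, (∑ i, (w x (Y i) : ℝ≥0∞)) / N
      = d * ((∑ i, impWeight q w x (Y i)) / m) := by
    intro Y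
    have h1 : ∑ i, impWeight q w x (Y i) = (∑ i, (w x (Y i) : ℝ≥0∞)) * (qwMean q w x)⁻¹ := by
      simp only [impWeight, div_eq_mul_inv]
      rw [Finset.sum_mul]
    rw [h1, hd]
    simp only [div_eq_mul_inv]
    calc (∑ i, (w x (Y i) : ℝ≥0∞)) * N⁻¹
        = (∑ i, (w x (Y i) : ℝ≥0∞)) * N⁻¹ * (qwMean q w x * (qwMean q w x)⁻¹)
          * (m * (m : ℝ≥0∞)⁻¹) := by
          rw [ENNReal.mul_inv_cancel (hw.qwMean_ne_zero x) (hw.mean_ne_top x),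
            ENNReal.mul_inv_cancel hm0 hmt, mul_one, mul_one]
      _ = _ := by ring
  simp only [hS]
  have hA : ∫⁻ Y, (d * ((∑ i, impWeight q w x (Y i)) / m)) ^ p
      ∂(Measure.pi fun _ : Fin m => q x) ≤ d ^ p * localMoment q w p x := by
    rw [localMoment, ← lintegral_pi_mean (q x) hm (him.pow_const p),
      ← lintegral_const_mul' _ _ (ENNReal.rpow_ne_top_of_nonneg hp0.le hdt)]
    refine lintegral_mono fun Y => ?_
    rw [ENNReal.mul_rpow_of_nonneg _ _ hp0.le]
    gcongr
    exact rpow_mean_le_mean_rpow hm _ hp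
  have hB : ∫⁻ Y, (d * ((∑ i, impWeight q w x (Y i)) / m))⁻¹
      ∂(Measure.pi fun _ : Fin m => q x) ≤ d⁻¹ * ∫⁻ y, (impWeight q w x y)⁻¹ ∂(q x) := by
    rw [← lintegral_pi_mean (q x) hm (f := fun y => (impWeight q w x y)⁻¹) him.inv,
      ← lintegral_const_mul' _ _ (ENNReal.inv_ne_top.2 hd0)]
    refine lintegral_mono fun Y => ?_
    rw [ENNReal.mul_inv (Or.inl hd0) (Or.inl hdt)]
    gcongr
    exact inv_mean_le_mean_inv hm _ (fun i => impWeight_ne_zero hw x (Y i))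
      fun i => impWeight_ne_top hw x (Y i)
  calc _ ≤ d ^ p * localMoment q w p x * (d⁻¹ * ∫⁻ y, (impWeight q w x y)⁻¹ ∂(q x)) ^ p := by
        gcongr
    _ = (d * d⁻¹) ^ p * (localMoment q w p x * (∫⁻ y, (impWeight q w x y)⁻¹ ∂(q x)) ^ p) := by
        rw [ENNReal.mul_rpow_of_nonneg d⁻¹ _ hp0.le, ENNReal.mul_rpow_of_nonneg d d⁻¹ hp0.le]
        ring
    _ ≤ 1 * (localMoment q w p x * localMoment q w (-p) x) := by
        rw [ENNReal.mul_inv_cancel hd0 hdt, ENNReal.one_rpow]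
        gcongr
        refine (rpow_lintegral_le_lintegral_rpow him.inv hp).trans_eq ?_
        simp only [Pi.inv_apply, ENNReal.inv_rpow, ← ENNReal.rpow_neg]
        rfl
    _ = _ := one_mul _

/-- The empirical mean splits into its pinned and free parts, by convexity of the power. The
reciprocal of `qwTilde` is at most that of the pinned part, giving the term `1`, and at most the
mean reciprocal of the free part, giving a product of moments of orders `p` and `-p`. -/
lemma lintegral_qwHatPinned_div_rpow_le (hw : AdmissibleWeight q w) (hn : n ≠ 0) {p : ℝ}
    (hp : 1 ≤ p) (x y : E) :
    ∫⁻ Y, (qwHatPinned w n x y Y / qwTilde q w n x y) ^ p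
        ∂(Measure.pi fun _ : Fin (n - 1) => q x)
      ≤ 2 ^ (p - 1) * (localMoment q w (2 * p) x + localMoment q w (-2 * p) x) := by
  have hp0 : 0 ≤ p := by linarith
  have hn0 : (n : ℝ≥0∞) ≠ 0 := by exact_mod_cast hn
  have hnt : (n : ℝ≥0∞) ≠ ∞ := ENNReal.natCast_ne_top n
  set I := (qwTilde q w n x y)⁻¹ with hI
  have hIt : I ≠ ∞ := ENNReal.inv_ne_top.2 (hw.qwTilde_ne_zero x y)
  have hu0 : (w x y : ℝ≥0∞) / n ≠ 0 := (ENNReal.div_pos (hw.coe_ne_zero x y) hnt).ne'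
  have hut : (w x y : ℝ≥0∞) / n ≠ ∞ := ENNReal.div_ne_top ENNReal.coe_ne_top hn0
  have hIle : I ≤ ((w x y : ℝ≥0∞) / n)⁻¹ := by
    rw [hI, AdmissibleWeight.inv_qwTilde]
    refine (lintegral_mono (g := fun _ => ((w x y : ℝ≥0∞) / n)⁻¹) fun Y => ?_).trans_eq (by simp)
    rw [qwHatPinned]
    exact ENNReal.inv_le_inv.2 (ENNReal.div_le_div_right le_self_add _)
  have hIle' : I ≤ ∫⁻ Y, ((∑ i, (w x (Y i) : ℝ≥0∞)) / n)⁻¹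
      ∂(Measure.pi fun _ : Fin (n - 1) => q x) := by
    rw [hI, AdmissibleWeight.inv_qwTilde]
    refine lintegral_mono fun Y => ?_
    rw [qwHatPinned]
    exact ENNReal.inv_le_inv.2 (ENNReal.div_le_div_right le_add_self _)
  have hpt : ∀ Y : Fin (n - 1) → E, (qwHatPinned w n x y Y / qwTilde q w n x y) ^ p
      ≤ 2 ^ (p - 1) * (1 + ((∑ i, (w x (Y i) : ℝ≥0∞)) / n) ^ p * I ^ p) := by
    intro Y
    have hH : qwHatPinned w n x y Y = w x y / n + (∑ i, (w x (Y i) : ℝ≥0∞)) / n := by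
      rw [qwHatPinned, ENNReal.add_div]
    rw [div_eq_mul_inv, ENNReal.mul_rpow_of_nonneg _ _ hp0, hH]
    calc _ ≤ 2 ^ (p - 1) * (((w x y : ℝ≥0∞) / n) ^ p
          + ((∑ i, (w x (Y i) : ℝ≥0∞)) / n) ^ p) * I ^ p := by
          gcongr
          exact ENNReal.rpow_add_le_mul_rpow_add_rpow _ _ hp
      _ = 2 ^ (p - 1) * (((w x y : ℝ≥0∞) / n * I) ^ p
          + ((∑ i, (w x (Y i) : ℝ≥0∞)) / n) ^ p * I ^ p) := by
          rw [ENNReal.mul_rpow_of_nonneg _ _ hp0]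
          ring
      _ ≤ _ := by
          gcongr
          refine ENNReal.rpow_le_one ?_ hp0
          calc (w x y : ℝ≥0∞) / n * I ≤ (w x y : ℝ≥0∞) / n * ((w x y : ℝ≥0∞) / n)⁻¹ := by gcongr
            _ = 1 := ENNReal.mul_inv_cancel hu0 hut
  have h2t : (2 : ℝ≥0∞) ^ (p - 1) ≠ ∞ :=
    ENNReal.rpow_ne_top_of_nonneg (by linarith) ENNReal.ofNat_ne_top
  refine (lintegral_mono hpt).trans ?_
  rw [lintegral_const_mul' _ _ h2t, lintegral_add_left measurable_const,
    lintegral_mul_const' _ _ (ENNReal.rpow_ne_top_of_nonneg hp0 hIt)]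
  simp only [lintegral_const, measure_univ, mul_one]
  refine mul_le_mul_right ((add_le_add_right ?_ 1).trans (one_add_localMoment_mul_le hw hp x)) _
  refine le_trans ?_ (lintegral_sum_rpow_mul_le hw hp (m := n - 1) x hn0 hnt)
  gcongr

/-- The minimum of reciprocals is the reciprocal of a maximum, so Jensen on the product of the two
trial spaces applies; the power of a maximum is at most the sum of the powers. -/
lemma zeta_rpow_neg_le (hw : AdmissibleWeight q w) (hn : n ≠ 0) {p : ℝ} (hp : 1 ≤ p) (x y : E) :
    zeta q w n x y ^ (-p)
      ≤ 2 ^ (p - 1) * (localMoment q w (2 * p) x + localMoment q w (-2 * p) x)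
        + 2 ^ (p - 1) * (localMoment q w (2 * p) y + localMoment q w (-2 * p) y) := by
  have hp0 : 0 ≤ p := by linarith
  let R : E → E → (Fin (n - 1) → E) → ℝ≥0∞ := fun x y Y =>
    qwHatPinned w n x y Y / qwTilde q w n x y
  have hRm : ∀ x y, Measurable (R x y) := fun x y =>
    (hw.measurable_qwHatPinned measurable_const measurable_const measurable_id).div_const _
  have hR0 : ∀ x y Y, R x y Y ≠ 0 := fun x y Y =>
    (ENNReal.div_pos (hw.qwHatPinned_ne_zero x y Y) (hw.qwTilde_ne_top hn x y)).ne'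
  have hRt : ∀ x y Y, R x y Y ≠ ∞ := fun x y Y =>
    ENNReal.div_ne_top (AdmissibleWeight.qwHatPinned_ne_top hn x y Y) (hw.qwTilde_ne_zero x y)
  have hRinv : ∀ x y Y, qwTilde q w n x y / qwHatPinned w n x y Y = (R x y Y)⁻¹ := fun x y Y =>
    (ENNReal.inv_div (Or.inl (hw.qwTilde_ne_top hn x y)) (Or.inl (hw.qwTilde_ne_zero x y))).symm
  let ν := (Measure.pi fun _ : Fin (n - 1) => q x).prod (Measure.pi fun _ : Fin (n - 1) => q y)
  have hm : Measurable fun r : (Fin (n - 1) → E) × (Fin (n - 1) → E) =>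
      max (R x y r.1) (R y x r.2) :=
    ((hRm x y).comp measurable_fst).max ((hRm y x).comp measurable_snd)
  have hz : zeta q w n x y = ∫⁻ r, (max (R x y r.1) (R y x r.2))⁻¹ ∂ν := by
    have hp' := lintegral_prod (μ := Measure.pi fun _ : Fin (n - 1) => q x)
      (ν := Measure.pi fun _ : Fin (n - 1) => q y)
      (fun r => (max (R x y r.1) (R y x r.2))⁻¹) hm.inv.aemeasurable
    rw [hp', zeta]
    refine lintegral_congr fun Y => lintegral_congr fun Z => ?_
    rw [hRinv, hRinv]
    exact ((ENNReal.inv_strictAnti.antitone).map_max).symm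
  rw [hz]
  refine (lintegral_inv_rpow_neg_le hm (fun r => ?_) (fun r => ?_) hp).trans ?_
  · exact ((pos_iff_ne_zero.2 (hR0 x y r.1)).trans_le (le_max_left _ _)).ne'
  · exact max_lt (lt_top_iff_ne_top.2 (hRt _ _ _)) (lt_top_iff_ne_top.2 (hRt _ _ _)) |>.ne
  calc _ ≤ ∫⁻ r, (R x y r.1 ^ p + R y x r.2 ^ p) ∂ν := by
        refine lintegral_mono fun r => ?_
        rcases max_choice (R x y r.1) (R y x r.2) with h | h <;> simp only [h]
        · exact le_self_add
        · exact le_add_self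
    _ = ∫⁻ Y, R x y Y ^ p ∂(Measure.pi fun _ : Fin (n - 1) => q x)
        + ∫⁻ Z, R y x Z ^ p ∂(Measure.pi fun _ : Fin (n - 1) => q y) := by
        have hm1 : Measurable fun r : (Fin (n - 1) → E) × (Fin (n - 1) → E) => R x y r.1 ^ p :=
          ((hRm x y).comp measurable_fst).pow_const p
        rw [lintegral_add_left hm1]
        congr 1
        · exact measurePreserving_fst.lintegral_comp ((hRm x y).pow_const p)
        · exact measurePreserving_snd.lintegral_comp ((hRm y x).pow_const p)
    _ ≤ _ := add_le_add (lintegral_qwHatPinned_div_rpow_le hw hn hp x y)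
        (lintegral_qwHatPinned_div_rpow_le hw hn hp y x)

/-! ### From moment bounds to the rate -/

variable [SigmaFinite μ] [IsProbabilityMeasure π]

/-- The Markov bound is a function of `x` plus the same function of `y`. Both marginals of the
stationary semi-ideal pair are `π`, by reversibility, so the two terms add up and `2 ^ (p - 1)`
becomes `2 ^ p`. -/
lemma betaTwo_le (hd : HasDensities μ π q dπ dq) (hw : AdmissibleWeight q w) (hn : n ≠ 0) {p : ℝ}
    (hp : 1 ≤ p) {s : ℝ} (hs : 0 < s) :
    betaTwo π dπ dq q w n s ≤ ENNReal.ofReal (s ^ (-p))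
      * (2 ^ p * (weightMoment π q w (2 * p) + weightMoment π q w (-2 * p))) := by
  have hmarkov := isMarkovKernel_semiIdeal hd hw hn
  let h : E → ℝ≥0∞ := fun x =>
    2 ^ (p - 1) * (localMoment q w (2 * p) x + localMoment q w (-2 * p) x)
  have hh : Measurable h :=
    ((measurable_localMoment hw _).add (measurable_localMoment hw _)).const_mul _
  have h2t : (2 : ℝ≥0∞) ^ (p - 1) ≠ ∞ :=
    ENNReal.rpow_ne_top_of_nonneg (by linarith) ENNReal.ofNat_ne_top
  have hrev := map_swap_compProd_mhKernel hd (measurable_semiIdealDensity (n := n) hd hw)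
    (lintegral_semiIdealDensity_le_one hw hn) (measurable_semiIdealFlow hd hw)
    (mul_semiIdealDensity hw hn) semiIdealFlow_symm
  have hset := measurableSet_zeta_lt (n := n) hw s
  let κ := mhKernel q (semiIdealDensity dπ dq q w n)
  have hinth : ∫⁻ x, h x ∂π
      = 2 ^ (p - 1) * (weightMoment π q w (2 * p) + weightMoment π q w (-2 * p)) := by
    simp only [h]
    rw [lintegral_const_mul' _ _ h2t, lintegral_add_left (measurable_localMoment hw _),
      lintegral_localMoment, lintegral_localMoment]
  calc betaTwo π dπ dq q w n s
      = (π ⊗ₘ κ) {r | zeta q w n r.1 r.2 < ENNReal.ofReal (1 / s)} := by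
        rw [betaTwo, semiIdealKernel_eq_mhKernel hd hw, Measure.compProd_apply hset]
        rfl
    _ = ∫⁻ r, {r : E × E | zeta q w n r.1 r.2 < ENNReal.ofReal (1 / s)}.indicator 1 r
        ∂(π ⊗ₘ κ) := (lintegral_indicator_one hset).symm
    _ ≤ ∫⁻ r, ENNReal.ofReal (s ^ (-p)) * (h r.1 + h r.2) ∂(π ⊗ₘ κ) := by
        refine lintegral_mono fun r => ?_
        by_cases hr : r ∈ {r : E × E | zeta q w n r.1 r.2 < ENNReal.ofReal (1 / s)}
        · rw [Set.indicator_of_mem hr]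
          refine (one_le_ofReal_rpow_neg_mul hs (by linarith : 0 ≤ p) hr).trans ?_
          gcongr
          exact zeta_rpow_neg_le hw hn hp r.1 r.2
        · rw [Set.indicator_of_notMem hr]
          exact zero_le
    _ = ENNReal.ofReal (s ^ (-p)) * (∫⁻ x, h x ∂π + ∫⁻ x, h x ∂π) := by
        have hm1 : Measurable fun r : E × E => h r.1 := hh.comp measurable_fst
        rw [lintegral_const_mul' _ _ ENNReal.ofReal_ne_top, lintegral_add_left hm1]
        congr 2
        · exact measurePreserving_fst_compProd.lintegral_comp hh
        · exact (measurePreserving_snd_compProd hrev).lintegral_comp hh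
    _ = _ := by
        rw [hinth, ← two_mul, ← mul_assoc 2]
        congr 2
        nth_rewrite 1 [← ENNReal.rpow_one 2]
        rw [← ENNReal.rpow_add _ _ two_ne_zero ENNReal.ofNat_ne_top]
        congr 1
        ring

lemma one_le_weightMoment (hw : AdmissibleWeight q w) {p : ℝ} (hp : 1 ≤ p) :
    1 ≤ weightMoment π q w p := by
  calc (1 : ℝ≥0∞) = ∫⁻ _, 1 ∂π := by simp
    _ ≤ _ := lintegral_mono fun x => one_le_localMoment hw hp x

lemma weightMoment_ne_top {r t : ℝ} (hr : 0 ≤ r) (hrt : r ≤ t)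
    (ht : weightMoment π q w t ≠ ∞) : weightMoment π q w r ≠ ∞ := by
  have h : weightMoment π q w r ≤ 1 + weightMoment π q w t := by
    calc _ ≤ ∫⁻ x, ∫⁻ y, (1 + impWeight q w x y ^ t) ∂(q x) ∂π := by
          refine lintegral_mono fun x => lintegral_mono fun y => ?_
          rcases le_total (impWeight q w x y) 1 with h | h
          · exact (ENNReal.rpow_le_one h hr).trans le_self_add
          · exact (ENNReal.rpow_le_rpow_of_exponent_le h hrt).trans le_add_self
      _ = _ := by
          have h1 : ∀ x, ∫⁻ y, (1 + impWeight q w x y ^ t) ∂(q x)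
              = 1 + ∫⁻ y, impWeight q w x y ^ t ∂(q x) := fun x => by
            rw [lintegral_add_left measurable_const]; simp
          simp only [h1]
          rw [lintegral_add_left measurable_const]
          simp [weightMoment]
  exact ne_top_of_le_ne_top (ENNReal.add_ne_top.2 ⟨ENNReal.one_ne_top, ht⟩) h

/-- One of `u ^ (1 + p)` and `u ^ (-p)` is at least one. This lets the bound cover the value `1`
assigned at `s = 1`. -/
lemma one_le_rateConst {p c₁ c₂ : ℝ} (hp : 1 ≤ p) (h₁ : 1 ≤ c₁) (h₂ : 1 ≤ c₂) :
    1 ≤ rateConst p c₁ c₂ := by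
  have hu : 0 < c₁ * p / (c₂ * (1 + p)) := by positivity
  rw [rateConst]
  set u := c₁ * p / (c₂ * (1 + p))
  rcases le_total 1 u with h | h
  · have h1 : 1 ≤ u ^ (1 + p) := Real.one_le_rpow h (by linarith)
    have h2 : 0 ≤ c₁ * u ^ (-p) := by positivity
    nlinarith
  · have h1 : 1 ≤ u ^ (-p) := Real.one_le_rpow_of_pos_of_le_one_of_nonpos hu h (by linarith)
    have h2 : 0 ≤ c₂ * u ^ (1 + p) := by positivity
    nlinarith

/-- Splitting `s = s₁ s₂` with `s₁` proportional to `s ^ (p / (1 + 2 p))`. -/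
lemma chainedBeta_le_of_le {p c₁ c₂ : ℝ} (hp : 1 ≤ p) (h₁ : 0 < c₁) (h₂ : 0 < c₂)
    (hb₁ : ∀ s : ℝ, 0 < s → betaOne π q w n s ≤ ENNReal.ofReal (s ^ (-p) * c₁))
    (hb₂ : ∀ s : ℝ, 0 < s → betaTwo π dπ dq q w n s ≤ ENNReal.ofReal (s ^ (-p) * c₂))
    {s : ℝ} (hs : 0 < s) :
    chainedBeta π dπ dq q w n s
      ≤ ENNReal.ofReal (s ^ (-(p ^ 2 / (1 + 2 * p))) * rateConst p c₁ c₂) := by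
  have hu : 0 < c₁ * p / (c₂ * (1 + p)) := by positivity
  rw [rateConst]
  set u := c₁ * p / (c₂ * (1 + p))
  -- This exponent `θ` solves `-p θ = (1 + p) θ - p`, giving both terms the same power of `s`. Any
  -- positive `u` would do; this one yields `rateConst`.
  set s₁ := u * s ^ (p / (1 + 2 * p)) with hs₁
  have hs₁0 : 0 < s₁ := by positivity
  have hp2 : (1 + 2 * p) ≠ 0 := by positivity
  refine (chainedBeta_le hs₁0 (div_pos hs hs₁0) (mul_div_cancel₀ s hs₁0.ne')).trans ?_
  refine (add_le_add (hb₁ s₁ hs₁0) (mul_le_mul_right (hb₂ _ (div_pos hs hs₁0)) _)).trans_eq ?_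
  rw [← ENNReal.ofReal_mul hs₁0.le, ← ENNReal.ofReal_add (by positivity) (by positivity)]
  congr 1
  have e1 : s₁ ^ (-p) = u ^ (-p) * s ^ (-(p ^ 2 / (1 + 2 * p))) := by
    rw [hs₁, Real.mul_rpow hu.le (by positivity), ← Real.rpow_mul hs.le]
    congr 2
    field_simp
  have e2 : s₁ * (s / s₁) ^ (-p) = u ^ (1 + p) * s ^ (-(p ^ 2 / (1 + 2 * p))) := by
    have h1 : s₁ * (s / s₁) ^ (-p) = s₁ ^ (1 + p) * s ^ (-p) := by
      rw [Real.div_rpow hs.le hs₁0.le, Real.rpow_add hs₁0, Real.rpow_one, Real.rpow_neg hs₁0.le p]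
      field_simp
    rw [h1, hs₁, Real.mul_rpow hu.le (by positivity), ← Real.rpow_mul hs.le, mul_assoc,
      ← Real.rpow_add hs]
    congr 2
    field_simp
    ring
  rw [← mul_assoc, e1, e2]
  ring

/-- The polynomial rate of the comparison function. -/
theorem exists_chainedBeta_le_rateConst (hd : HasDensities μ π q dπ dq)
    (hw : AdmissibleWeight q w) {p : ℝ} (hp : 1 ≤ p) (h2p : weightMoment π q w (2 * p) ≠ ∞)
    (hneg : weightMoment π q w (-2 * p) ≠ ∞) :
    ∃ K : ℝ, 0 ≤ K ∧ ∀ n : ℕ, n ≠ 0 →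
      1 ≤ rateConst p (rateC₁ π q w p K n) (rateC₂ π q w p 0 0 n) ∧
      ∀ s : ℝ, 0 < s → chainedBeta π dπ dq q w n s
        ≤ ENNReal.ofReal (s ^ (-(p ^ 2 / (1 + 2 * p)))
          * rateConst p (rateC₁ π q w p K n) (rateC₂ π q w p 0 0 n)) := by
  have hMp : weightMoment π q w p ≠ ∞ := weightMoment_ne_top (by linarith) (by linarith) h2p
  have hMp1 : weightMoment π q w (p + 1) ≠ ∞ :=
    weightMoment_ne_top (by linarith) (by linarith) h2p
  -- `K₁` is the moment of order `p + 1`, finite because `p + 1 ≤ 2 * p`.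
  refine ⟨(weightMoment π q w (p + 1)).toReal, ENNReal.toReal_nonneg, fun n hn => ?_⟩
  have hn0 : (0 : ℝ) < n := by exact_mod_cast Nat.pos_of_ne_zero hn
  have hone : ∀ {r : ℝ}, 1 ≤ r → weightMoment π q w r ≠ ∞ → 1 ≤ (weightMoment π q w r).toReal :=
    fun hr ht => by
      rw [← ENNReal.toReal_one]
      exact ENNReal.toReal_mono ht (one_le_weightMoment hw hr)
  have hc₁ : 1 ≤ rateC₁ π q w p (weightMoment π q w (p + 1)).toReal n := by
    rw [rateC₁]
    have h1 := hone hp hMp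
    have h2 : 0 ≤ (weightMoment π q w (p + 1)).toReal * (n : ℝ)⁻¹ := by positivity
    linarith
  have hsum : 1 ≤ (weightMoment π q w (2 * p)).toReal + (weightMoment π q w (-2 * p)).toReal := by
    have h1 := hone (by linarith : 1 ≤ 2 * p) h2p
    have h2 : 0 ≤ (weightMoment π q w (-2 * p)).toReal := ENNReal.toReal_nonneg
    linarith
  have hpow : (2 : ℝ) ^ p ≤ 2 ^ (p + 1) :=
    Real.rpow_le_rpow_of_exponent_le one_le_two (by linarith)
  have h2p1 : (1 : ℝ) ≤ 2 ^ p := Real.one_le_rpow one_le_two (by linarith)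
  have hC₂ : rateC₂ π q w p 0 0 n = 2 ^ (p + 1)
      * ((weightMoment π q w (2 * p)).toReal + (weightMoment π q w (-2 * p)).toReal) := by
    rw [rateC₂]; ring
  have hc₂ : 1 ≤ rateC₂ π q w p 0 0 n := by
    rw [hC₂]
    nlinarith
  refine ⟨one_le_rateConst hp hc₁ hc₂, fun s hs => ?_⟩
  refine chainedBeta_le_of_le hp (by linarith) (by linarith) (fun t ht => ?_) (fun t ht => ?_) hs
  · refine (betaOne_le hw hn hp ht).trans_eq ?_
    rw [ENNReal.ofReal_mul (by positivity), rateC₁, ENNReal.ofReal_add ENNReal.toReal_nonneg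
      (by positivity), ENNReal.ofReal_toReal hMp, ENNReal.ofReal_mul ENNReal.toReal_nonneg,
      ENNReal.ofReal_toReal hMp1, ENNReal.ofReal_inv_of_pos hn0, ENNReal.ofReal_natCast,
      div_eq_mul_inv]
  · refine (betaTwo_le hd hw hn hp ht).trans ?_
    rw [ENNReal.ofReal_mul (by positivity), hC₂, ENNReal.ofReal_mul (by positivity),
      ENNReal.ofReal_add ENNReal.toReal_nonneg ENNReal.toReal_nonneg, ENNReal.ofReal_toReal h2p,
      ENNReal.ofReal_toReal hneg]
    gcongr
    rw [← ENNReal.ofReal_ofNat 2, ENNReal.ofReal_rpow_of_pos two_pos]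
    exact ENNReal.ofReal_le_ofReal hpow

end Rates

end MultipleTry

end

/-! ### The theorem -/

theorem theorem1
    {E : Type*} [TopologicalSpace E] [PolishSpace E] [MeasurableSpace E] [BorelSpace E]
    (μ : Measure E) [SigmaFinite μ]
    (π : Measure E) [IsProbabilityMeasure π]
    (q : Kernel E E) [IsMarkovKernel q]
    (dπ : E → ℝ≥0) (hdπ : Measurable dπ)
    (hπ : π = μ.withDensity fun x => (dπ x : ℝ≥0∞))
    (dq : E → E → ℝ≥0) (hdq : Measurable (Function.uncurry dq))
    (hq : ∀ x, q x = μ.withDensity fun y => (dq x y : ℝ≥0∞))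
    (w : E → E → ℝ≥0) (hw : Measurable (Function.uncurry w))
    (hw_pos : ∀ x y, 0 < w x y)
    (hqw : ∀ x, MultipleTry.qwMean q w x ≠ ∞) :
    -- the comparison inequality, with the explicit infimum
    (∀ n : ℕ, 1 ≤ n → ∀ f : E → ℝ, MemLp f 2 π → ∀ s : ℝ, 0 < s →
      ENNReal.ofReal (MultipleTry.dirichletForm π (MultipleTry.idealKernel dπ dq q w) f) ≤
        ENNReal.ofReal
            (s * MultipleTry.dirichletForm π (MultipleTry.mtmKernel dπ dq q w n) f)
          + MultipleTry.chainedBeta π dπ dq q w n s * MultipleTry.oscNorm π f ^ 2) ∧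
    ∃ β : ℕ → ℝ → ℝ≥0∞,
      -- `β` is that infimum, except that its value at `s = 1` may be larger
      (∀ n : ℕ, 1 ≤ n → ∀ s : ℝ, 0 < s →
        MultipleTry.chainedBeta π dπ dq q w n s ≤ β n s ∧
        (s ≠ 1 → β n s = MultipleTry.chainedBeta π dπ dq q w n s)) ∧
      (∀ n : ℕ, 1 ≤ n → ∀ f : E → ℝ, MemLp f 2 π → ∀ s : ℝ, 0 < s →
        ENNReal.ofReal (MultipleTry.dirichletForm π (MultipleTry.idealKernel dπ dq q w) f) ≤
          ENNReal.ofReal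
              (s * MultipleTry.dirichletForm π (MultipleTry.mtmKernel dπ dq q w n) f)
            + β n s * MultipleTry.oscNorm π f ^ 2) ∧
      (∀ s : ℝ, 0 < s →
        Tendsto (fun n => β n s) atTop (𝓝 (if s ≤ 1 then 1 else 0))) ∧
      (∀ p : ℝ, 1 ≤ p →
        MultipleTry.weightMoment π q w (2 * p) ≠ ∞ →
        MultipleTry.weightMoment π q w (-2 * p) ≠ ∞ →
        ∃ K₁ K₂ K₃ : ℝ, 0 ≤ K₁ ∧ 0 ≤ K₂ ∧ 0 ≤ K₃ ∧
          ∀ n : ℕ, 1 ≤ n → ∀ s : ℝ, 0 < s →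
            β n s ≤ ENNReal.ofReal (s ^ (-(p ^ 2 / (1 + 2 * p))) *
              MultipleTry.rateConst p (MultipleTry.rateC₁ π q w p K₁ n)
                (MultipleTry.rateC₂ π q w p K₂ K₃ n))) := by
  have hd : MultipleTry.HasDensities μ π q dπ dq := ⟨hdπ, hπ, hdq, hq⟩
  have hwa : MultipleTry.AdmissibleWeight q w := ⟨hw, hw_pos, hqw⟩
  have hle : ∀ n : ℕ, 1 ≤ n → ∀ s : ℝ, 0 < s → MultipleTry.chainedBeta π dπ dq q w n s
      ≤ if s = 1 then 1 else MultipleTry.chainedBeta π dπ dq q w n s := fun n hn s hs => by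
    split_ifs
    · exact MultipleTry.chainedBeta_le_one hd hwa (Nat.one_le_iff_ne_zero.1 hn) hs
    · exact le_rfl
  refine ⟨fun n hn f hf s hs =>
      MultipleTry.dirichletForm_ideal_le_mtm hd hwa (Nat.one_le_iff_ne_zero.1 hn) hf hs,
    -- The two limit arguments leave out `s = 1`, so the required limit is imposed there; this only
    -- enlarges the function, as `chainedBeta_le_one` shows.
    fun n s => if s = 1 then 1 else MultipleTry.chainedBeta π dπ dq q w n s,
    fun n hn s hs => ⟨hle n hn s hs, fun hs1 => if_neg hs1⟩, fun n hn f hf s hs => ?_,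
    fun s hs => ?_, fun p hp h2p hneg => ?_⟩
  · refine (MultipleTry.dirichletForm_ideal_le_mtm hd hwa (Nat.one_le_iff_ne_zero.1 hn) hf
      hs).trans ?_
    gcongr
    exact hle n hn s hs
  · rcases lt_trichotomy s 1 with h | h | h
    · simpa only [if_neg h.ne, if_pos h.le] using
        MultipleTry.tendsto_chainedBeta_of_lt_one hd hwa hs h
    · simp [h]
    · simpa only [if_neg h.ne', if_neg (not_le.2 h)] using
        MultipleTry.tendsto_chainedBeta_of_one_lt hd hwa h
  · obtain ⟨K, hK, hrate⟩ :=
      MultipleTry.exists_chainedBeta_le_rateConst (dq := dq) hd hwa hp h2p hneg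
    -- The bound on `betaTwo` carries no correction in `1 / n`, so `K₂` and `K₃` can be zero.
    refine ⟨K, 0, 0, hK, le_rfl, le_rfl, fun n hn s hs => ?_⟩
    obtain ⟨hone, hs'⟩ := hrate n (Nat.one_le_iff_ne_zero.1 hn)
    beta_reduce
    split_ifs with h
    · rw [h, Real.one_rpow, one_mul, ← ENNReal.ofReal_one]
      exact ENNReal.ofReal_le_ofReal hone
    · exact hs' s hs
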